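/- **Notation.** $\langle\cdot,\cdot\rangle$ is the bilinear pairing between $\mathscr S'$ and $\mathscr S$ (and the scalar product on $\mathbf R^d$). $\mathscr P(\mathbf R^d)$ is the set of positive measurable functions $\omega$ on $\mathbf R^d$ with $\omega(x+y)\le C\omega(x)(1+|y|)^N$ for some $C,N$. A positive function $v$ is submultiplicative if $v(x+y)\le Cv(x)v(y)$ for some $C$. For $\chi\in\mathscr S(\mathbf R^d)\setminus 0$ and $f\in\mathscr S'(\mathbf R^d)$ let $V_\chi f(x,\xi)=\mathscr F(f\,\chi(\cdot-x))(\xi)$, where $\mathscr Fg(\xi)=(2\pi)^{-d/2}\int g(y)e^{-i\langle y,\xi\rangle}dy$. For $\omega\in\mathscr P(\mathbf R^{2d})$, $M^{p,q}_{(\omega)}(\mathbf R^d)$ is the set of $f\in\mathscr S'(\mathbf R^d)$ for which $$\|f\|_{M^{p,q}_{(\omega)}}=\Big(\int\Big(\int|V_\chi f(x,\xi)\omega(x,\xi)|^p\,dx\Big)^{q/p}d\xi\Big)^{1/q}<\infty$$ (usual modification if $p$ or $q$ is $\infty$), and $M^p_{(\omega)}=M^{p,p}_{(\omega)}$. In every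 norm below, the non-zero Schwartz window is arbitrary but fixed. If $a\in\mathscr S'(\mathbf R^d)$ and $k$ is bounded and continuous, then $\langle a,k\rangle$ means $\iint V_\kappa a(X,\Xi)V_\kappa k(X,-\Xi)\,dX\,d\Xi$ whenever this integral converges absolutely, where $\kappa\in\mathscr S(\mathbf R^d)$ is fixed with $\int\kappa^2=1$; for $a\in\mathscr S$ this is $\int ak$. **Assumptions.** Let $1<p<\infty$, $n,m\ge0$ (e.g. $m=n$), $\omega_1,\omega_2\in\mathscr P(\mathbf R^{2n})$, $C_0>0$. Write $X=(x,y,\zeta)\in\mathbf R^{n}\times\mathbf R^n\times\mathbf R^m$ with dual variables $(\xi,\eta,z)$. Let $v\in\mathscr P(\mathbf R^{2n+m}\times\mathbf R^{2n+m})$ be submultiplicative, with $v(X,\xi,\eta,z)=v(\xi,\eta,z)$ independent of $X$ and $v(t\,\cdot)\le Cv$ for some $C$ and all $t\in[0,1]$. Let $\mathsf d>0$, and let $\varphi\in C^2(\mathbf R^{2n+m})$ be real-valued, with $\partial^\alpha\varphi\in M^{\infty,1}_{(v)}(\mathbf R^{2n+m})$ for $|\alpha|=2$ and $$\left|\det\begin{pmatrix}\varphi''_{x,y}&\varphi''_{x,\zeta}\\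 \varphi''_{\zeta,y}&\varphi''_{\zeta,\zeta}\end{pmatrix}\right|\ge\mathsf d\quad\text{on }\mathbf R^{2n+m}.$$ Put $\|\varphi''\|_{M^{\infty,1}_{(v)}}=\max_{|\alpha|=2}\|\partial^\alpha\varphi\|_{M^{\infty,1}_{(v)}}$. **Proposition.** (1) *(Symbols $a(x,\zeta)$.)* Let $v(\xi,\eta,z)=v_1(\eta)v_2(\xi,z)$ with $v_1\in\mathscr P(\mathbf R^n)$, $v_2\in\mathscr P(\mathbf R^{n+m})$, and let $\omega\in\mathscr P(\mathbf R^{2n+2m})$. Assume that for some constant $C$ and all arguments $\omega_1(y,\eta+\eta')\le C\omega_1(y,\eta)v_1(\eta')$ and $\omega(x,\zeta,\xi+\xi',z+z')\le C\omega(x,\zeta,\xi,z)v_2(\xi',z')$, and that $$\frac{\omega_2(x,\xi)}{\omega_1(y,-\varphi'_y(X))}\le C_0\,\omega(x,\zeta,\xi-\varphi'_x(X),-\varphi'_\zeta(X)).$$ Let $a\in M^{\infty,1}_{(\omega)}(\mathbf R^{n+m})$ and let $\operatorname{Op}_{\varphi,0}(a)$ be the operator with kernel $\int a(x,\zeta)e^{i\varphi(x,y,\zeta)}d\zeta$,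 that is, $\langle\operatorname{Op}_{\varphi,0}(a)f,g\rangle=\langle a,k\rangle$ with $k(x,\zeta)=g(x)\int e^{i\varphi(x,y,\zeta)}f(y)\,dy$, for $f,g\in\mathscr S(\mathbf R^n)$. Then the integral defining $\langle a,k\rangle$ converges absolutely for all $f,g\in\mathscr S(\mathbf R^n)$, $\operatorname{Op}_{\varphi,0}(a)$ extends to a bounded linear operator from $M^p_{(\omega_1)}(\mathbf R^n)$ to $M^p_{(\omega_2)}(\mathbf R^n)$, and $$\|\operatorname{Op}_{\varphi,0}(a)f\|_{M^p_{(\omega_2)}}\le C\,\mathsf d^{-1}\|a\|_{M^{\infty,1}_{(\omega)}}\|f\|_{M^p_{(\omega_1)}}\exp\big(C\|\varphi''\|_{M^{\infty,1}_{(v)}}\big).$$ (2) *(Amplitudes $a(x,y,\zeta)$.)* Let instead $\omega\in\mathscr P(\mathbf R^{4n+2m})$ satisfy $\omega(X,\Xi+\Xi')\le C\omega(X,\Xi)v(\Xi')$ for some constant $C$, and $$\frac{\omega_2(x,\xi)}{\omega_1(y,-\eta)}\le C_0\,\omega(X,\xi-\varphi'_x(X),\eta-\varphi'_y(X),-\varphi'_\zeta(X)).$$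 Let $a\in M^{\infty,1}_{(\omega)}(\mathbf R^{2n+m})$. Then the same conclusion, with the same estimate, holds for the operator $\operatorname{Op}_\varphi(a)$ given by $\langle\operatorname{Op}_\varphi(a)f,g\rangle=\langle a,k\rangle$ with $k(x,y,\zeta)=(2\pi)^{-n}e^{i\varphi(x,y,\zeta)}f(y)g(x)$. In both parts the constant $C$ in the norm estimate depends only on $n,m,p$, the weights, the windows (including $\kappa$) and $C_0$; it is independent of $\mathsf d$, $\varphi$, $a$ and $f$. -/

import Mathlib

open MeasureTheory SchwartzMap
open scoped ENNReal Real

noncomputable section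

namespace FourierOp

/-! ### Weights -/

/-- The class `𝒫(E)`: positive measurable functions `ω` with `ω (x + y) ≤ C ω x (1 + |y|) ^ N`.
Such functions are automatically locally bounded. -/
def IsPolyModerate {E : Type*} [NormedAddCommGroup E] [MeasureSpace E] (ω : E → ℝ) : Prop :=
  (∀ x, 0 < ω x) ∧ AEMeasurable ω volume ∧
    ∃ (C : ℝ) (N : ℕ), ∀ x y, ω (x + y) ≤ C * ω x * (1 + ‖y‖) ^ N

/-- `v (x + y) ≤ C v x v y` for some constant `C`. -/
def IsSubmultiplicative {E : Type*} [Add E] (v : E → ℝ) : Prop :=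
  ∃ C : ℝ, ∀ x y, v (x + y) ≤ C * v x * v y

/-! ### Short-time Fourier transforms and modulation spaces -/

section STFT

variable {ι : Type*} [Fintype ι]

/-- The function `t ↦ exp (-i t)` is smooth with bounded derivatives. -/
theorem hasTemperateGrowth_cexp :
    (fun t : ℝ => Complex.exp (-(t * Complex.I))).HasTemperateGrowth := by
  have hd : ∀ n : ℕ, iteratedDeriv n (fun t : ℝ => Complex.exp (-(t * Complex.I))) =
      fun t : ℝ => (-Complex.I) ^ n * Complex.exp (-(t * Complex.I)) := by
    intro n
    induction n with
    | zero => simp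
    | succ n ih =>
      rw [iteratedDeriv_succ, ih]
      funext t
      have h1 : HasDerivAt (fun t : ℝ => -((t : ℂ) * Complex.I)) (-Complex.I) t := by
        convert! ((Complex.ofRealCLM.hasDerivAt (x := t)).mul_const Complex.I).neg using 1
        simp
      have h2 := (h1.cexp).const_mul ((-Complex.I) ^ n)
      rw [h2.deriv]
      ring
  refine ⟨?_, fun n => ⟨0, 1, fun x => ?_⟩⟩
  · have : ContDiff ℝ (⊤ : ℕ∞) (fun t : ℝ => -((t : ℂ) * Complex.I)) :=
      (Complex.ofRealCLM.contDiff.mul contDiff_const).neg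
    exact this.cexp
  · rw [norm_iteratedFDeriv_eq_norm_iteratedDeriv, hd]
    have : ‖Complex.exp (-((x : ℂ) * Complex.I))‖ = 1 := by
      have := Complex.norm_exp_ofReal_mul_I (-x)
      simpa using this
    simp [this]

/-- The function `y ↦ exp (-i ⟨y, ξ⟩)`. -/
def expInner (ξ : EuclideanSpace ℝ ι) (y : EuclideanSpace ℝ ι) : ℂ :=
  Complex.exp (-((inner ℝ y ξ : ℝ) * Complex.I))

theorem expInner_hasTemperateGrowth (ξ : EuclideanSpace ℝ ι) :
    (expInner ξ).HasTemperateGrowth :=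
  hasTemperateGrowth_cexp.comp (Function.hasTemperateGrowth_inner_left ξ)

/-- The time-frequency shifted window `y ↦ exp (-i ⟨y, ξ⟩) χ (y - x)`. -/
def tfShift (χ : 𝓢(EuclideanSpace ℝ ι, ℂ)) (x ξ : EuclideanSpace ℝ ι) :
    𝓢(EuclideanSpace ℝ ι, ℂ) :=
  smulLeftCLM ℂ (expInner ξ) (compSubConstCLM ℂ x χ)

theorem tfShift_apply (χ : 𝓢(EuclideanSpace ℝ ι, ℂ)) (x ξ y : EuclideanSpace ℝ ι) :
    tfShift χ x ξ y = expInner ξ y * χ (y - x) := by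
  simp [tfShift, expInner_hasTemperateGrowth]

/-- `(2π) ^ (-d / 2)`, where `d` is the dimension. -/
def fourierConst (ι : Type*) [Fintype ι] : ℝ := (2 * π) ^ (-(Fintype.card ι : ℝ) / 2)

/-- The short-time Fourier transform `V_χ f (x, ξ) = ℱ (f · χ(· - x)) (ξ)` of a tempered
distribution, with `ℱ g (ξ) = (2π) ^ (-d/2) ∫ g(y) exp (-i ⟨y, ξ⟩) dy`. -/
def stft (χ : 𝓢(EuclideanSpace ℝ ι, ℂ)) (f : 𝓢'(EuclideanSpace ℝ ι, ℂ))
    (x ξ : EuclideanSpace ℝ ι) : ℂ :=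
  fourierConst ι * f (tfShift χ x ξ)

/-- The short-time Fourier transform of a (bounded continuous) function. -/
def stftFun (χ : 𝓢(EuclideanSpace ℝ ι, ℂ)) (k : EuclideanSpace ℝ ι → ℂ)
    (x ξ : EuclideanSpace ℝ ι) : ℂ :=
  fourierConst ι * ∫ y, k y * tfShift χ x ξ y

/-- The norm of the weighted modulation space `M^{p,q}_{(ω)}` with window `χ`; a tempered
distribution belongs to the space if and only if the value is finite. -/
def modNorm (ω : EuclideanSpace ℝ ι × EuclideanSpace ℝ ι → ℝ) (p q : ℝ≥0∞)
    (χ : 𝓢(EuclideanSpace ℝ ι, ℂ)) (f : 𝓢'(EuclideanSpace ℝ ι, ℂ)) : ℝ≥0∞ :=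
  eLpNorm (fun ξ => eLpNorm (fun x => stft χ f x ξ * (ω (x, ξ) : ℂ)) p volume) q volume

/-- The integrand of the duality pairing `⟨a, k⟩` in terms of short-time Fourier transforms. -/
def pairingIntegrand (κ : 𝓢(EuclideanSpace ℝ ι, ℂ)) (a : 𝓢'(EuclideanSpace ℝ ι, ℂ))
    (k : EuclideanSpace ℝ ι → ℂ) (Z : EuclideanSpace ℝ ι × EuclideanSpace ℝ ι) : ℂ :=
  stft κ a Z.1 Z.2 * stftFun κ k Z.1 (-Z.2)

/-- The duality pairing `⟨a, k⟩ = ∬ V_κ a (X, Ξ) V_κ k (X, -Ξ) dX dΞ`, where `∫ κ² = 1`.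
It equals `∫ a k` (see `stftPairing_coe`) when `a` is a Schwartz function and `k` is bounded and
continuous, and it extends the latter to all `a` for which the double integral converges
absolutely. -/
def stftPairing (κ : 𝓢(EuclideanSpace ℝ ι, ℂ)) (a : 𝓢'(EuclideanSpace ℝ ι, ℂ))
    (k : EuclideanSpace ℝ ι → ℂ) : ℂ :=
  ∫ Z, pairingIntegrand κ a k Z

end STFT

section Consistency

open FourierTransform

variable {ι : Type*} [Fintype ι]

theorem fourierConst_sq : (fourierConst ι) ^ 2 * (2 * π) ^ (Fintype.card ι) = 1 := by
  have h : (0 : ℝ) < 2 * π := by positivity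
  rw [fourierConst, ← Real.rpow_natCast, ← Real.rpow_natCast, ← Real.rpow_mul h.le,
    ← Real.rpow_add h]
  have : (-(Fintype.card ι : ℝ) / 2 * ((2 : ℕ) : ℝ) + (Fintype.card ι : ℝ)) = 0 := by
    push_cast; ring
  rw [this, Real.rpow_zero]

theorem integral_fourier_mul_fourierInv (u : 𝓢(EuclideanSpace ℝ ι, ℂ))
    {w : EuclideanSpace ℝ ι → ℂ} (hw : Integrable w) :
    ∫ ξ, 𝓕 (u : EuclideanSpace ℝ ι → ℂ) ξ * 𝓕⁻ w ξ = ∫ y, u y * w y := by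
  have h := VectorFourier.integral_fourierIntegral_smul_eq_flip (μ := volume) (ν := volume)
    (L := -innerₗ (EuclideanSpace ℝ ι)) (f := w) (g := 𝓕 (u : EuclideanSpace ℝ ι → ℂ))
    Real.continuous_fourierChar (by simp; fun_prop) hw
    (by rw [← SchwartzMap.fourier_coe]; exact (𝓕 u).integrable)
  have h1 : ∀ x, VectorFourier.fourierIntegral Real.fourierChar volume
      ((-innerₗ (EuclideanSpace ℝ ι)).flip) (𝓕 (u : EuclideanSpace ℝ ι → ℂ)) x = u x := by
    intro x
    have h2 : 𝓕⁻ (𝓕 (u : EuclideanSpace ℝ ι → ℂ)) x = u x := by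
      rw [← SchwartzMap.fourier_coe, ← SchwartzMap.fourierInv_coe,
        FourierTransform.fourierInv_fourier_eq]
    rw [← h2, Real.fourierInv_eq]
    simp [VectorFourier.fourierIntegral, real_inner_comm]
  simp only [h1, smul_eq_mul] at h
  calc _ = ∫ ξ, 𝓕⁻ w ξ * 𝓕 (u : EuclideanSpace ℝ ι → ℂ) ξ := by simp_rw [mul_comm]
    _ = _ := h
    _ = _ := by simp_rw [mul_comm]

theorem stft_coe_smul (κ a : 𝓢(EuclideanSpace ℝ ι, ℂ)) (X η : EuclideanSpace ℝ ι) :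
    stft κ (a : 𝓢'(EuclideanSpace ℝ ι, ℂ)) X ((2 * π) • η) =
      fourierConst ι * 𝓕 (SchwartzMap.pairing (ContinuousLinearMap.mul ℂ ℂ) a
        (compSubConstCLM ℂ X κ) : EuclideanSpace ℝ ι → ℂ) η := by
  rw [stft, SchwartzMap.coe_apply, Real.fourier_eq']
  congr 2
  funext y
  simp only [tfShift_apply, expInner, inner_smul_right, SchwartzMap.pairing_apply_apply,
    ContinuousLinearMap.mul_apply', SchwartzMap.compSubConstCLM_apply, smul_eq_mul]
  rw [mul_assoc, mul_comm (κ (y - X))]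
  congr 2
  push_cast
  ring

theorem stftFun_neg_smul (κ : 𝓢(EuclideanSpace ℝ ι, ℂ)) (k : EuclideanSpace ℝ ι → ℂ)
    (X η : EuclideanSpace ℝ ι) :
    stftFun κ k X (-((2 * π) • η)) = fourierConst ι * 𝓕⁻ (fun y => k y * κ (y - X)) η := by
  rw [stftFun, Real.fourierInv_eq']
  congr 2
  funext y
  simp only [tfShift_apply, expInner, inner_smul_right, inner_neg_right, smul_eq_mul]
  rw [mul_left_comm]
  congr 2
  push_cast
  ring

/-- For a Schwartz function `a` and a bounded continuous function `k`, the pairing is the classical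
one. -/
theorem stftPairing_coe (κ : 𝓢(EuclideanSpace ℝ ι, ℂ)) (hκ : ∫ y, κ y ^ 2 = 1)
    (a : 𝓢(EuclideanSpace ℝ ι, ℂ)) (k : EuclideanSpace ℝ ι → ℂ) (hk : Continuous k) (B : ℝ)
    (hB : ∀ y, ‖k y‖ ≤ B)
    (hint : Integrable (pairingIntegrand κ (a : 𝓢'(EuclideanSpace ℝ ι, ℂ)) k) volume) :
    stftPairing κ (a : 𝓢'(EuclideanSpace ℝ ι, ℂ)) k = ∫ y, a y * k y := by
  have hw : ∀ X, Integrable (fun y => k y * κ (y - X)) := fun X =>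
    Integrable.bdd_mul (κ.integrable.comp_sub_right X) hk.aestronglyMeasurable
      (Filter.Eventually.of_forall hB)
  have inner_eq : ∀ X, ∫ Ξ, pairingIntegrand κ (a : 𝓢'(EuclideanSpace ℝ ι, ℂ)) k (X, Ξ) =
      ∫ y, a y * k y * κ (y - X) ^ 2 := by
    intro X
    have h1 := Measure.integral_comp_smul (volume : Measure (EuclideanSpace ℝ ι))
      (fun Ξ => pairingIntegrand κ (a : 𝓢'(EuclideanSpace ℝ ι, ℂ)) k (X, Ξ)) (2 * π)
    have hpos : (0 : ℝ) < (2 * π) ^ (Fintype.card ι) := by positivity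
    rw [finrank_euclideanSpace, abs_of_pos (inv_pos.2 hpos), eq_inv_smul_iff₀ hpos.ne'] at h1
    rw [← h1]
    simp only [pairingIntegrand, stft_coe_smul, stftFun_neg_smul]
    have h2 : ∀ η, (fourierConst ι : ℂ) * 𝓕 (SchwartzMap.pairing (ContinuousLinearMap.mul ℂ ℂ) a
        (compSubConstCLM ℂ X κ) : EuclideanSpace ℝ ι → ℂ) η *
        (fourierConst ι * 𝓕⁻ (fun y => k y * κ (y - X)) η) =
        ((fourierConst ι : ℂ) ^ 2) * (𝓕 (SchwartzMap.pairing (ContinuousLinearMap.mul ℂ ℂ) a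
        (compSubConstCLM ℂ X κ) : EuclideanSpace ℝ ι → ℂ) η *
        𝓕⁻ (fun y => k y * κ (y - X)) η) := fun η => by ring
    simp only [h2]
    rw [integral_const_mul, integral_fourier_mul_fourierInv _ (hw X), Complex.real_smul,
      ← mul_assoc]
    have h3 := fourierConst_sq (ι := ι)
    have h4 : (((2 * π) ^ Fintype.card ι : ℝ) : ℂ) * (fourierConst ι : ℂ) ^ 2 = 1 := by
      rw [mul_comm]; exact_mod_cast h3
    rw [h4, one_mul]
    congr 1
    funext y
    simp only [SchwartzMap.pairing_apply_apply, ContinuousLinearMap.mul_apply',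
      SchwartzMap.compSubConstCLM_apply]
    ring
  rw [stftPairing, Measure.volume_eq_prod, integral_prod _ (by rwa [Measure.volume_eq_prod] at hint)]
  simp only [inner_eq]
  have hak : Integrable (fun y => a y * k y) := by
    simp_rw [mul_comm (a _)]
    exact Integrable.bdd_mul a.integrable hk.aestronglyMeasurable (Filter.Eventually.of_forall hB)
  have hκ2 : Integrable (fun y => κ y ^ 2) := by
    by_contra h
    rw [integral_undef h] at hκ
    exact zero_ne_one hκ
  have hswap : Integrable (Function.uncurry fun X y => a y * k y * κ (y - X) ^ 2)
      ((volume : Measure (EuclideanSpace ℝ ι)).prod volume) := by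
    have h5 := Integrable.convolution_integrand (μ := (volume : Measure (EuclideanSpace ℝ ι)))
      (ν := volume) (ContinuousLinearMap.mul ℂ ℂ) hak hκ2.comp_neg
    refine h5.congr (Filter.Eventually.of_forall fun p => ?_)
    simp [Function.uncurry]
  rw [integral_integral_swap hswap]
  congr 1
  funext y
  rw [integral_const_mul, integral_sub_left_eq_self (fun z => κ z ^ 2) volume y, hκ, mul_one]

end Consistency

/-! ### The underlying spaces -/

/-- `ℝⁿ` -/
abbrev Rn (n : ℕ) : Type := EuclideanSpace ℝ (Fin n)

/-- `ℝⁿ⁺ᵐ`, with points `(x, ζ)` -/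
abbrev Rnm (n m : ℕ) : Type := EuclideanSpace ℝ (Fin n ⊕ Fin m)

/-- `ℝ²ⁿ⁺ᵐ`, with points `(x, y, ζ)` -/
abbrev Rnnm (n m : ℕ) : Type := EuclideanSpace ℝ (Fin n ⊕ (Fin n ⊕ Fin m))

variable {n m : ℕ}

/-- The point `(x, ζ)`. -/
def mk2 (x : Rn n) (ζ : Rn m) : Rnm n m := WithLp.toLp 2 (Sum.elim x ζ)

/-- The point `(x, y, ζ)`. -/
def mk3 (x y : Rn n) (ζ : Rn m) : Rnnm n m :=
  WithLp.toLp 2 (Sum.elim x (Sum.elim y ζ))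

/-- The `x`-component of `(x, ζ)`. -/
def px2 (Y : Rnm n m) : Rn n := WithLp.toLp 2 fun i => Y (Sum.inl i)

/-- The `ζ`-component of `(x, ζ)`. -/
def pz2 (Y : Rnm n m) : Rn m := WithLp.toLp 2 fun k => Y (Sum.inr k)

/-- The `x`-component of `(x, y, ζ)`. -/
def px (X : Rnnm n m) : Rn n := WithLp.toLp 2 fun i => X (Sum.inl i)

/-- The `y`-component of `(x, y, ζ)`. -/
def py (X : Rnnm n m) : Rn n := WithLp.toLp 2 fun j => X (Sum.inr (Sum.inl j))

/-- The `ζ`-component of `(x, y, ζ)`. -/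
def pz (X : Rnnm n m) : Rn m := WithLp.toLp 2 fun k => X (Sum.inr (Sum.inr k))

/-! ### Phase functions -/

/-- `∂_i ∂_j φ (X)` -/
def secondPartial {ι : Type*} [Fintype ι] [DecidableEq ι] (φ : EuclideanSpace ℝ ι → ℝ)
    (i j : ι) (X : EuclideanSpace ℝ ι) : ℝ :=
  fderiv ℝ (fun Y => fderiv ℝ φ Y (EuclideanSpace.single j 1)) X (EuclideanSpace.single i 1)

/-- The matrix with the blocks `φ''_{x,y}`, `φ''_{x,ζ}` in the first row and
`φ''_{ζ,y}`, `φ''_{ζ,ζ}` in the second one. -/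
def mixedHessian (φ : Rnnm n m → ℝ) (X : Rnnm n m) :
    Matrix (Fin n ⊕ Fin m) (Fin n ⊕ Fin m) ℝ :=
  Matrix.fromBlocks
    (Matrix.of fun i j => secondPartial φ (Sum.inl i) (Sum.inr (Sum.inl j)) X)
    (Matrix.of fun i l => secondPartial φ (Sum.inl i) (Sum.inr (Sum.inr l)) X)
    (Matrix.of fun k j => secondPartial φ (Sum.inr (Sum.inr k)) (Sum.inr (Sum.inl j)) X)
    (Matrix.of fun k l => secondPartial φ (Sum.inr (Sum.inr k)) (Sum.inr (Sum.inr l)) X)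

/-- The tempered distribution `u` is given by the continuous function `h`. -/
def IsGivenBy {ι : Type*} [Fintype ι] (u : 𝓢'(EuclideanSpace ℝ ι, ℂ))
    (h : EuclideanSpace ℝ ι → ℝ) : Prop :=
  ∀ ψ : 𝓢(EuclideanSpace ℝ ι, ℂ), HasCompactSupport ψ → u ψ = ∫ x, (h x : ℂ) * ψ x

/-- `‖φ''‖_{M^{∞,1}_{(v)}}`, the largest of the norms of the second order derivatives, which are
given as a family of tempered distributions. -/
def hessNorm {ι : Type*} [Fintype ι] (v : EuclideanSpace ℝ ι × EuclideanSpace ℝ ι → ℝ)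
    (χ : 𝓢(EuclideanSpace ℝ ι, ℂ)) (Φ : ι → ι → 𝓢'(EuclideanSpace ℝ ι, ℂ)) : ℝ≥0∞ :=
  ⨆ i, ⨆ j, modNorm v ∞ 1 χ (Φ i j)

/-- The assumptions on the real-valued phase function `φ`: it is of class `C²`, its second order
derivatives are (given by) elements `Φ i j` of `M^{∞,1}_{(v)}`, and the modulus of the determinant
of its mixed Hessian is bounded from below by `d`. -/
structure IsPhase (v : Rnnm n m × Rnnm n m → ℝ) (χ : 𝓢(Rnnm n m, ℂ)) (d : ℝ)
    (φ : Rnnm n m → ℝ)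
    (Φ : Fin n ⊕ (Fin n ⊕ Fin m) → Fin n ⊕ (Fin n ⊕ Fin m) → 𝓢'(Rnnm n m, ℂ)) : Prop where
  contDiff : ContDiff ℝ 2 φ
  isGivenBy : ∀ i j, IsGivenBy (Φ i j) (secondPartial φ i j)
  mem : ∀ i j, modNorm v ∞ 1 χ (Φ i j) < ∞
  det : ∀ X, d ≤ |(mixedHessian φ X).det|

/-! ### Fourier integral operators -/

/-- The function `(x, y, ζ) ↦ (2π) ^ (-n) exp (i φ (x, y, ζ)) f (y) g (x)`, whose pairing with an
amplitude `a (x, y, ζ)` is `⟨Op_φ(a) f, g⟩`. -/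
def opKernelFun (φ : Rnnm n m → ℝ) (f g : 𝓢(Rn n, ℂ)) (X : Rnnm n m) : ℂ :=
  (((2 * π) ^ n)⁻¹ : ℝ) * (Complex.exp (Complex.I * φ X) * f (py X) * g (px X))

/-- The function `(x, ζ) ↦ ∫ exp (i φ (x, y, ζ)) f (y) dy · g (x)`, whose pairing with a
symbol `a (x, ζ)` is `⟨Op_{φ,0}(a) f, g⟩`. -/
def opZeroKernelFun (φ : Rnnm n m → ℝ) (f g : 𝓢(Rn n, ℂ)) (Y : Rnm n m) : ℂ :=
  (∫ y, Complex.exp (Complex.I * φ (mk3 (px2 Y) y (pz2 Y))) * f y) * g (px2 Y)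

/-- `T` is the Fourier integral operator `Op_φ(a)` with amplitude `a (x, y, ζ)` on Schwartz
functions: `⟨T f, g⟩ = (2π) ^ (-n) ∭ a (x, y, ζ) exp (i φ (x, y, ζ)) f (y) g (x) dx dy dζ`, where the
right-hand side is the absolutely convergent duality pairing. -/
def ExtendsOp (κ : 𝓢(Rnnm n m, ℂ)) (φ : Rnnm n m → ℝ) (a : 𝓢'(Rnnm n m, ℂ))
    (T : 𝓢'(Rn n, ℂ) → 𝓢'(Rn n, ℂ)) : Prop :=
  ∀ f g : 𝓢(Rn n, ℂ),
    Integrable (pairingIntegrand κ a (opKernelFun φ f g)) volume ∧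
      T (f : 𝓢'(Rn n, ℂ)) g = stftPairing κ a (opKernelFun φ f g)

/-- `T` is the Fourier integral operator `Op_{φ,0}(a)` with symbol `a (x, ζ)` on Schwartz
functions, i.e. the operator with kernel `∫ a (x, ζ) exp (i φ (x, y, ζ)) dζ`:
`⟨T f, g⟩ = ∭ a (x, ζ) exp (i φ (x, y, ζ)) f (y) g (x) dx dy dζ`, where the right-hand side is the
absolutely convergent duality pairing. -/
def ExtendsOpZero (κ : 𝓢(Rnm n m, ℂ)) (φ : Rnnm n m → ℝ) (a : 𝓢'(Rnm n m, ℂ))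
    (T : 𝓢'(Rn n, ℂ) → 𝓢'(Rn n, ℂ)) : Prop :=
  ∀ f g : 𝓢(Rn n, ℂ),
    Integrable (pairingIntegrand κ a (opZeroKernelFun φ f g)) volume ∧
      T (f : 𝓢'(Rn n, ℂ)) g = stftPairing κ a (opZeroKernelFun φ f g)

/-- `T` restricts to a linear operator from `{N₁ < ∞}` to `{N₂ < ∞}` of norm at most `K`. -/
def IsBoundedLinear (N₁ N₂ : 𝓢'(Rn n, ℂ) → ℝ≥0∞) (K : ℝ)
    (T : 𝓢'(Rn n, ℂ) → 𝓢'(Rn n, ℂ)) : Prop :=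
  (∀ f g, N₁ f < ∞ → N₁ g < ∞ → T (f + g) = T f + T g) ∧
  (∀ (c : ℂ) (f), N₁ f < ∞ → T (c • f) = c • T f) ∧
  ∀ f, N₁ f < ∞ → N₂ (T f) ≤ ENNReal.ofReal K * N₁ f

end FourierOp

end

noncomputable section

namespace FourierOp

/-! Both parts are proved by expanding functions into time-frequency atoms and applying Schur's test
on phase space. With `γ` a dual window of `χ`, inversion of the short-time Fourier transform writes
`f` as a superposition of shifts `γ_z` with coefficients `V_χ f (z)`, up to a constant. Hence `V_χ
(Op f) (w)` is the integral of `V_χ f (z)` against the matrix element of the operator between `γ_z`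
and `χ_w`. Writing the symbol through `V_κ a` as well, this element is the integral over `l` of `V_κ
a (l)` times `kerInt`, an integral over `Y = (x, y, ζ)` of `exp (i φ)` and three wave packets in the
variables `Q Y = y`, `P Y = x` and `R Y`. For symbols `R Y = (x, ζ)`, for amplitudes `R Y = Y`;
nothing else distinguishes the two cases before the weights are compared.

To estimate `kerInt`, localize to unit balls around points `Z` and split off from the phase its
first order Taylor polynomial. What remains is the Fourier transform, at the frequency `kerFreq = P*
w₂ - Q* z₂ - R* l₂ - φ'(Z)`, of a Schwartz amplitude times `exp (i r_Z)`, where `r_Z` is the Taylor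
remainder. By the integral formula `r_Z (Y)` is a sum of terms `Y_i Y_j` times averages of `∂_i ∂_j
φ (Z + t Y)`. Since `φ''` lies in `M^{∞,1}_{(v)}`, these averages are superpositions of characters
whose coefficients have a majorant independent of `Z` and integrable against `v`;
submultiplicativity and the dilation condition make them multipliers of a weighted Fourier algebra.
The exponential series then yields the factor `exp (C ‖φ''‖)` and a majorant `b` of all localized
Fourier transforms which is again independent of `Z` (`exists_isMultiplier_phase`,
`exists_kerInt_bound`).

The weight hypotheses are made for `kerFreq`: adding it to `l₂` gives exactly the frequency at which
`ω` is evaluated in the assumption, with `ξ = w₂` and, for amplitudes, `η = -z₂`. So, up to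
polynomial factors absorbed by the decay of the wave packets, the weighted matrix elements are
bounded by the kernel `schurKer` (`kernel_le`).

In Schur's test the integral over `z` removes the position `z₁` by decay and the `y`-component of
the frequency by translation. The integral over `Z` is then done by decay in `x` and, in `(y, ζ)`,
by the substitution `(y, ζ) ↦ (φ'_x, φ'_ζ)`, whose Jacobian is the given determinant; this produces
`d⁻¹`. The integral over `w` is the transposed case. The substitution has to be globally injective,
a version of Hadamard's theorem: the derivative is bounded and uniformly continuous with determinant
bounded below, so local inverses exist at a uniform scale, and a lifting argument applies
(`injective_of_det`). Schur's test bounds the operator on `L^p` of phase space, and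
`IsSchurForm.exists_operator` turns the form into an operator on the modulation space. -/

theorem one_add_norm_add_le {E : Type*} [SeminormedAddCommGroup E] (x y : E) : 1 + ‖x + y‖ ≤ (1 + ‖x‖) * (1 + ‖y‖) := by
  nlinarith [norm_add_le x y, norm_nonneg x, norm_nonneg y,
    mul_nonneg (norm_nonneg x) (norm_nonneg y)]

theorem one_add_norm_add_pow_le {E : Type*} [SeminormedAddCommGroup E] (x y : E) (M : ℕ) :
    (1 + ‖x + y‖) ^ M ≤ (1 + ‖x‖) ^ M * (1 + ‖y‖) ^ M := by
  rw [← mul_pow]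
  exact pow_le_pow_left₀ (by positivity) (one_add_norm_add_le x y) M

/-! ### Directed Schwartz seminorms and products with affine substitutions -/

section SchwartzNorm

variable {E E' : Type*} [NormedAddCommGroup E] [NormedSpace ℝ E] [NormedAddCommGroup E']
  [NormedSpace ℝ E']

/-- The supremum of the Schwartz seminorms of order at most `(K, K)`. -/
def schwartzNorm (K : ℕ) : Seminorm ℂ 𝓢(E, ℂ) :=
  (Finset.Iic (K, K)).sup (schwartzSeminormFamily ℂ E ℂ)

theorem schwartzNorm_nonneg (K : ℕ) (f : 𝓢(E, ℂ)) : 0 ≤ schwartzNorm K f := apply_nonneg _ _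

theorem one_add_pow_mul_le_schwartzNorm {K k n : ℕ} (hk : k ≤ K) (hn : n ≤ K) (f : 𝓢(E, ℂ))
    (x : E) : (1 + ‖x‖) ^ k * ‖iteratedFDeriv ℝ n f x‖ ≤ 2 ^ K * schwartzNorm K f :=
  one_add_le_sup_seminorm_apply (𝕜 := ℂ) (m := (K, K)) hk hn f x

theorem one_add_pow_mul_apply_le_schwartzNorm {K k : ℕ} (hk : k ≤ K) (f : 𝓢(E, ℂ)) (x : E) :
    (1 + ‖x‖) ^ k * ‖f x‖ ≤ 2 ^ K * schwartzNorm K f := by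
  simpa using one_add_pow_mul_le_schwartzNorm hk (Nat.zero_le K) f x

theorem schwartzNorm_le {K : ℕ} {f : 𝓢(E, ℂ)} {B : ℝ} (hB : 0 ≤ B)
    (h : ∀ k ≤ K, ∀ n ≤ K, ∀ x, ‖x‖ ^ k * ‖iteratedFDeriv ℝ n f x‖ ≤ B) :
    schwartzNorm K f ≤ B := by
  refine Seminorm.finset_sup_apply_le hB fun i hi => ?_
  rw [Finset.mem_Iic] at hi
  exact SchwartzMap.seminorm_le_bound ℂ _ _ _ hB (h _ hi.1 _ hi.2)

theorem schwartzNorm_mono {K K' : ℕ} (h : K ≤ K') (f : 𝓢(E, ℂ)) :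
    schwartzNorm K f ≤ schwartzNorm K' f :=
  (Finset.sup_mono (f := schwartzSeminormFamily ℂ E ℂ)
    (Finset.Iic_subset_Iic.2 (Prod.mk_le_mk.2 ⟨h, h⟩))) f

/-- The seminorms `schwartzNorm K` increase with `K` and generate the topology, so a finite family
controlling `q` is dominated by a single one. -/
theorem exists_schwartzNorm_bound (q : Seminorm ℂ 𝓢(E, ℂ)) (hq : Continuous q) :
    ∃ (K : ℕ) (C : ℝ), 0 < C ∧ ∀ f, q f ≤ C * schwartzNorm K f := by
  obtain ⟨s, C, hC, hs⟩ := Seminorm.bound_of_continuous (schwartz_withSeminorms ℂ E ℂ) q hq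
  obtain ⟨K, hK⟩ : ∃ K : ℕ, s ⊆ Finset.Iic (K, K) := by
    refine ⟨s.sup fun m => m.1 + m.2, fun m hm => ?_⟩
    have := Finset.le_sup (f := fun m : ℕ × ℕ => m.1 + m.2) hm
    rw [Finset.mem_Iic, Prod.le_def]
    constructor
    · exact (Nat.le_add_right _ _).trans this
    · exact (Nat.le_add_left _ _).trans this
  refine ⟨K, C, by positivity, fun f => (hs f).trans ?_⟩
  have : s.sup (schwartzSeminormFamily ℂ E ℂ) f ≤ schwartzNorm K f :=
    (Finset.sup_mono (f := schwartzSeminormFamily ℂ E ℂ) hK) f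
  rw [smul_apply, NNReal.smul_def, smul_eq_mul]
  gcongr

theorem continuous_schwartzNorm (K : ℕ) : Continuous (schwartzNorm (E := E) K) := by
  have h : ∀ s : Finset (ℕ × ℕ),
      Continuous (s.sup (schwartzSeminormFamily ℂ E ℂ) : Seminorm ℂ 𝓢(E, ℂ)) := by
    intro s
    induction s using Finset.cons_induction with
    | empty => exact continuous_const (y := (0 : ℝ))
    | cons a s ha ih =>
      rw [Finset.sup_cons]
      exact ((schwartz_withSeminorms ℂ E ℂ).continuous_seminorm a).sup ih
  exact h _

theorem exists_schwartzNorm_bound_clm (T : 𝓢(E, ℂ) →L[ℂ] 𝓢(E', ℂ)) (K : ℕ) :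
    ∃ (K' : ℕ) (C : ℝ), 0 < C ∧ ∀ f, schwartzNorm K (T f) ≤ C * schwartzNorm K' f :=
  exists_schwartzNorm_bound ((schwartzNorm K).comp T.toLinearMap)
    ((continuous_schwartzNorm K).comp T.continuous)

theorem exists_schwartzNorm_bound_functional (T : 𝓢(E, ℂ) →L[ℂ] ℂ) :
    ∃ (K : ℕ) (C : ℝ), 0 < C ∧ ∀ f, ‖T f‖ ≤ C * schwartzNorm K f :=
  exists_schwartzNorm_bound ((normSeminorm ℂ ℂ).comp T.toLinearMap)
    (continuous_norm.comp T.continuous)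

/-- The Schwartz function `Y ↦ ρ (Y) g (A Y + s)`. -/
def mulComp (ρ : 𝓢(E, ℂ)) (g : 𝓢(E', ℂ)) (A : E →L[ℝ] E') (s : E') : 𝓢(E, ℂ) :=
  smulLeftCLM ℂ (fun Y => g (A Y + s)) ρ

theorem mulComp_apply (ρ : 𝓢(E, ℂ)) (g : 𝓢(E', ℂ)) (A : E →L[ℝ] E') (s : E') (Y : E) :
    mulComp ρ g A s Y = ρ Y * g (A Y + s) := by
  have h : (fun Y => g (A Y + s)).HasTemperateGrowth :=
    g.hasTemperateGrowth.comp (A.hasTemperateGrowth.add (.const s))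
  rw [mulComp, smulLeftCLM_apply_apply h, smul_eq_mul, mul_comm]

theorem norm_iteratedFDeriv_comp_affine_le (g : 𝓢(E', ℂ)) (A : E →L[ℝ] E') (s : E') (j : ℕ)
    (Y : E) : ‖iteratedFDeriv ℝ j (fun Y => g (A Y + s)) Y‖ ≤
      ‖A‖ ^ j * ‖iteratedFDeriv ℝ j g (A Y + s)‖ := by
  have h1 : ContDiff ℝ j (fun Z => g (Z + s)) := (g.smooth j).comp (contDiff_id.add contDiff_const)
  have h2 := A.iteratedFDeriv_comp_right h1 Y (i := j) le_rfl
  have h3 : (fun Y => g (A Y + s)) = (fun Z => g (Z + s)) ∘ A := rfl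
  rw [h3, h2]
  refine (ContinuousMultilinearMap.norm_compContinuousLinearMap_le _ _).trans ?_
  rw [iteratedFDeriv_comp_add_right]
  simp [mul_comm]

/-- Peetre's inequality: `1 + ‖s‖` is at most the product of `1 + ‖A Y + s‖` and `1 + ‖A Y‖`. The
first factor is absorbed by the decay of `g`, the second by that of `ρ`, even if `A` has a kernel.
This is the source of the decay in the distance between the centres of wave packets. -/
theorem schwartzNorm_mulComp_le (A : E →L[ℝ] E') (K M : ℕ) :
    ∃ C : ℝ, 0 < C ∧ ∀ (ρ : 𝓢(E, ℂ)) (g : 𝓢(E', ℂ)) (s : E'),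
      (1 + ‖s‖) ^ M * schwartzNorm K (mulComp ρ g A s) ≤
        C * (schwartzNorm (K + M) ρ * schwartzNorm (K + M) g) := by
  refine ⟨2 ^ K * ((1 + ‖A‖) ^ (M + K) * (2 ^ (K + M) * 2 ^ (K + M))), by positivity,
    fun ρ g s => ?_⟩
  have hρ0 := schwartzNorm_nonneg (K + M) ρ
  have hg0 := schwartzNorm_nonneg (K + M) g
  have hs : 0 < (1 + ‖s‖) ^ M := by positivity
  rw [mul_comm, ← le_div_iff₀ hs]
  refine schwartzNorm_le (by positivity) fun k hk n hn Y => ?_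
  rw [le_div_iff₀ hs]
  have hfun : (mulComp ρ g A s : E → ℂ) = fun Y => ρ Y * g (A Y + s) :=
    funext (mulComp_apply ρ g A s)
  have hsm : ContDiff ℝ n (fun Y => g (A Y + s)) :=
    (g.smooth n).comp (A.contDiff.add contDiff_const)
  have h1 := norm_iteratedFDeriv_mul_le (ρ.smooth n) hsm Y (n := n) le_rfl
  have hterm : ∀ i ∈ Finset.range (n + 1), ‖Y‖ ^ k * (1 + ‖s‖) ^ M *
      (‖iteratedFDeriv ℝ i ρ Y‖ * ‖iteratedFDeriv ℝ (n - i) (fun Y => g (A Y + s)) Y‖) ≤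
      (1 + ‖A‖) ^ (M + K) * (2 ^ (K + M) * 2 ^ (K + M)) *
        (schwartzNorm (K + M) ρ * schwartzNorm (K + M) g) := by
    intro i hi
    have hi' : i ≤ n := Nat.lt_succ_iff.1 (Finset.mem_range.1 hi)
    have a1 := one_add_pow_mul_le_schwartzNorm (K := K + M) (k := k + M) (n := i) (by omega)
      (by omega) ρ Y
    have a2 := one_add_pow_mul_le_schwartzNorm (K := K + M) (k := M) (n := n - i) (by omega)
      (by omega) g (A Y + s)
    have a3 := norm_iteratedFDeriv_comp_affine_le g A s (n - i) Y
    have a4 : (1 + ‖s‖) ^ M ≤ (1 + ‖A Y + s‖) ^ M * ((1 + ‖A‖) ^ M * (1 + ‖Y‖) ^ M) := by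
      have := one_add_norm_add_pow_le (A Y + s) (-(A Y)) M
      rw [add_neg_cancel_comm, norm_neg] at this
      refine this.trans ?_
      gcongr
      rw [← mul_pow]
      gcongr
      nlinarith [A.le_opNorm Y, norm_nonneg A, norm_nonneg Y]
    have a5 : ‖A‖ ^ (n - i) ≤ (1 + ‖A‖) ^ K :=
      (pow_le_pow_left₀ (norm_nonneg _) (by linarith) _).trans
        (pow_le_pow_right₀ (by linarith [norm_nonneg A]) (by omega))
    have a6 : ‖Y‖ ^ k ≤ (1 + ‖Y‖) ^ k := pow_le_pow_left₀ (norm_nonneg _) (by linarith) _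
    calc _ ≤ (1 + ‖Y‖) ^ k * ((1 + ‖A Y + s‖) ^ M * ((1 + ‖A‖) ^ M * (1 + ‖Y‖) ^ M)) *
          (‖iteratedFDeriv ℝ i ρ Y‖ *
            ((1 + ‖A‖) ^ K * ‖iteratedFDeriv ℝ (n - i) g (A Y + s)‖)) := by
            gcongr
            exact a3.trans (by gcongr)
      _ = (1 + ‖A‖) ^ (M + K) * (((1 + ‖Y‖) ^ (k + M) * ‖iteratedFDeriv ℝ i ρ Y‖) *
            ((1 + ‖A Y + s‖) ^ M * ‖iteratedFDeriv ℝ (n - i) g (A Y + s)‖)) := by ring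
      _ ≤ (1 + ‖A‖) ^ (M + K) * ((2 ^ (K + M) * schwartzNorm (K + M) ρ) *
            (2 ^ (K + M) * schwartzNorm (K + M) g)) := by gcongr
      _ = _ := by ring
  rw [hfun]
  calc _ ≤ ‖Y‖ ^ k * (∑ i ∈ Finset.range (n + 1), (n.choose i : ℝ) * ‖iteratedFDeriv ℝ i ρ Y‖ *
        ‖iteratedFDeriv ℝ (n - i) (fun Y => g (A Y + s)) Y‖) * (1 + ‖s‖) ^ M := by gcongr
    _ = ∑ i ∈ Finset.range (n + 1), (n.choose i : ℝ) * (‖Y‖ ^ k * (1 + ‖s‖) ^ M *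
      (‖iteratedFDeriv ℝ i ρ Y‖ * ‖iteratedFDeriv ℝ (n - i) (fun Y => g (A Y + s)) Y‖)) := by
        rw [Finset.mul_sum, Finset.sum_mul]
        exact Finset.sum_congr rfl fun i _ => by ring
    _ ≤ ∑ i ∈ Finset.range (n + 1), (n.choose i : ℝ) * ((1 + ‖A‖) ^ (M + K) *
        (2 ^ (K + M) * 2 ^ (K + M)) * (schwartzNorm (K + M) ρ * schwartzNorm (K + M) g)) :=
        Finset.sum_le_sum fun i hi => mul_le_mul_of_nonneg_left (hterm i hi) (by positivity)
    _ = 2 ^ n * ((1 + ‖A‖) ^ (M + K) *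
        (2 ^ (K + M) * 2 ^ (K + M)) * (schwartzNorm (K + M) ρ * schwartzNorm (K + M) g)) := by
        rw [← Finset.sum_mul]
        congr 1
        exact_mod_cast Nat.sum_range_choose n
    _ ≤ 2 ^ K * ((1 + ‖A‖) ^ (M + K) *
        (2 ^ (K + M) * 2 ^ (K + M)) * (schwartzNorm (K + M) ρ * schwartzNorm (K + M) g)) := by
        gcongr; norm_num
    _ = _ := by ring

end SchwartzNorm

/-! ### Continuous families of Schwartz functions -/

section Continuity

variable {Z E F : Type*} [NormedAddCommGroup E] [NormedSpace ℝ E]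
  [NormedAddCommGroup F] [NormedSpace ℝ F]

theorem continuous_iteratedFDeriv_param [NormedAddCommGroup Z] [NormedSpace ℝ Z] {f : Z × E → F}
    (hf : ContDiff ℝ (⊤ : ℕ∞) f) (n : ℕ) :
    Continuous fun p : Z × E => iteratedFDeriv ℝ n (fun y => f (p.1, y)) p.2 := by
  have h : ∀ p : Z × E, iteratedFDeriv ℝ n (fun y => f (p.1, y)) p.2 =
      (iteratedFDeriv ℝ n f p).compContinuousLinearMap
        (fun _ => ContinuousLinearMap.inr ℝ Z E) := by
    intro p
    have h1 : ContDiff ℝ n (fun q => f ((p.1, 0) + q)) :=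
      (hf.of_le (by exact_mod_cast le_top)).comp (contDiff_const.add contDiff_id)
    have h2 := (ContinuousLinearMap.inr ℝ Z E).iteratedFDeriv_comp_right h1 p.2 (i := n) le_rfl
    have h3 : (fun y => f (p.1, y)) =
        (fun q => f ((p.1, 0) + q)) ∘ ContinuousLinearMap.inr ℝ Z E := by
      funext y; simp
    rw [h3, h2, iteratedFDeriv_comp_add_left]
    simp
  simp only [h]
  exact (ContinuousMultilinearMap.compContinuousLinearMapL (fun _ : Fin n =>
    ContinuousLinearMap.inr ℝ Z E)).continuous.comp
    (hf.continuous_iteratedFDeriv (by exact_mod_cast le_top))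

/-- A locally bounded family of Schwartz functions with jointly continuous derivatives is a
continuous family. -/
theorem continuous_schwartz_of_continuous_iteratedFDeriv [TopologicalSpace Z] [ProperSpace E]
    {h : Z → 𝓢(E, ℂ)}
    (h1 : ∀ n, Continuous fun p : Z × E => iteratedFDeriv ℝ n (h p.1) p.2)
    (h2 : ∀ z₀ K, ∃ C : ℝ, ∀ᶠ z in nhds z₀, schwartzNorm K (h z) ≤ C) : Continuous h := by
  rw [continuous_iff_continuousAt]
  intro z₀
  rw [ContinuousAt, (schwartz_withSeminorms ℂ E ℂ).tendsto_nhds]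
  rintro ⟨k, n⟩ ε hε
  obtain ⟨C, hC⟩ := h2 z₀ (k + 1 + n)
  have hC0 : 0 ≤ C := (schwartzNorm_nonneg _ _).trans hC.self_of_nhds
  set B : ℝ := 2 * (2 ^ (k + 1 + n) * C) with hB
  -- Outside the ball of radius `R` a spare power of `‖y‖` bounds the difference by `B / R`. Inside
  -- it joint continuity and compactness make the difference uniformly small.
  obtain ⟨R, hR0, hR⟩ : ∃ R : ℝ, 0 < R ∧ B / R < ε / 2 := by
    refine ⟨2 * (B + 1) / ε, by positivity, ?_⟩
    rw [div_lt_iff₀ (by positivity)]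
    field_simp
    linarith
  have hcomp : IsCompact (Metric.closedBall (0 : E) R) := isCompact_closedBall _ _
  have hunif : ∀ᶠ z in nhds z₀, ∀ y ∈ Metric.closedBall (0 : E) R,
      ‖y‖ ^ k * ‖iteratedFDeriv ℝ n (h z) y - iteratedFDeriv ℝ n (h z₀) y‖ < ε / 2 := by
    have hc : Continuous fun p : Z × E => ‖p.2‖ ^ k *
        ‖iteratedFDeriv ℝ n (h p.1) p.2 - iteratedFDeriv ℝ n (h z₀) p.2‖ := by
      have := (h1 n).comp (continuous_const.prodMk continuous_snd : Continuous fun p : Z × E =>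
        (z₀, p.2))
      exact (continuous_snd.norm.pow k).mul ((h1 n).sub this).norm
    refine hcomp.eventually_forall_of_forall_eventually fun y _ => ?_
    refine (hc.tendsto (z₀, y)).eventually (gt_mem_nhds ?_)
    simpa using by positivity
  filter_upwards [hC, hunif] with z hz hz'
  rw [schwartzSeminormFamily_apply]
  refine lt_of_le_of_lt (SchwartzMap.seminorm_le_bound ℂ k n _ (M := ε / 2) (by positivity)
    fun y => ?_) (half_lt_self hε)
  have hsub : iteratedFDeriv ℝ n (⇑(h z - h z₀)) y =
      iteratedFDeriv ℝ n (h z) y - iteratedFDeriv ℝ n (h z₀) y := by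
    have : (⇑(h z - h z₀)) = (h z : E → ℂ) - h z₀ := rfl
    rw [this, iteratedFDeriv_sub_apply ((h z).smooth n).contDiffAt ((h z₀).smooth n).contDiffAt]
  rw [hsub]
  by_cases hy : y ∈ Metric.closedBall (0 : E) R
  · exact (hz' y hy).le
  · have hy' : R < ‖y‖ := by simpa using hy
    have b1 := one_add_pow_mul_le_schwartzNorm (K := k + 1 + n) (k := k + 1) (n := n) (by omega)
      (by omega) (h z) y
    have b2 := one_add_pow_mul_le_schwartzNorm (K := k + 1 + n) (k := k + 1) (n := n) (by omega)
      (by omega) (h z₀) y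
    have hz0 := hC.self_of_nhds
    have b3 : ‖y‖ ^ (k + 1) * ‖iteratedFDeriv ℝ n (h z) y - iteratedFDeriv ℝ n (h z₀) y‖ ≤ B := by
      calc _ ≤ (1 + ‖y‖) ^ (k + 1) *
            (‖iteratedFDeriv ℝ n (h z) y‖ + ‖iteratedFDeriv ℝ n (h z₀) y‖) := by
            gcongr
            · linarith
            · exact norm_sub_le _ _
        _ ≤ 2 ^ (k + 1 + n) * schwartzNorm (k + 1 + n) (h z) +
            2 ^ (k + 1 + n) * schwartzNorm (k + 1 + n) (h z₀) := by rw [mul_add]; gcongr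
        _ ≤ 2 ^ (k + 1 + n) * C + 2 ^ (k + 1 + n) * C := by gcongr
        _ = B := by rw [hB]; ring
    refine le_trans ?_ hR.le
    rw [le_div_iff₀ hR0]
    refine le_trans ?_ b3
    rw [pow_succ]
    have : 0 ≤ ‖y‖ ^ k * ‖iteratedFDeriv ℝ n (h z) y - iteratedFDeriv ℝ n (h z₀) y‖ := by positivity
    nlinarith

end Continuity

/-! ### Functionals applied to integrals of Schwartz functions -/

section Superposition

variable {Z : Type*} [TopologicalSpace Z] [SecondCountableTopology Z] [MeasurableSpace Z]
  [OpensMeasurableSpace Z] {μ : Measure Z} {E : Type} [NormedAddCommGroup E] [NormedSpace ℝ E]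

/-- Differentiation under the integral sign, once per induction step. The target space is kept
general because the derivative of an `F`-valued function takes values in the linear maps from `E` to
`F`. -/
theorem iteratedFDeriv_eq_integral (n : ℕ) :
    ∀ {F : Type} [NormedAddCommGroup F] [NormedSpace ℝ F] (h : Z → 𝓢(E, F))
      (g : 𝓢(E, F)), Continuous h →
      (∀ k n, Integrable (fun z => SchwartzMap.seminorm ℝ k n (h z)) μ) →
      (∀ y, g y = ∫ z, h z y ∂μ) →
      ∀ y, iteratedFDeriv ℝ n g y = ∫ z, iteratedFDeriv ℝ n (h z) y ∂μ := by
  induction n with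
  | zero =>
    intro F _ _ h g hc hint hg y
    simp only [iteratedFDeriv_zero_eq_comp, Function.comp_apply]
    rw [hg]
    exact ((continuousMultilinearCurryFin0 ℝ E F).symm.toContinuousLinearEquiv.integral_comp_comm
      _).symm
  | succ n ih =>
    intro F _ _ h g hc hint hg y
    have hev : ∀ y, Continuous fun z => h z y := fun y =>
      (BoundedContinuousFunction.evalCLM ℝ y).continuous.comp
        ((toBoundedContinuousFunctionCLM ℝ E F).continuous.comp hc)
    have hcont' : Continuous fun z => fderivCLM ℝ E F (h z) := (fderivCLM ℝ E F).continuous.comp hc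
    have hev' : ∀ y, Continuous fun z => fderivCLM ℝ E F (h z) y := fun y =>
      (BoundedContinuousFunction.evalCLM ℝ y).continuous.comp
        ((toBoundedContinuousFunctionCLM ℝ E (E →L[ℝ] F)).continuous.comp hcont')
    have hint' : ∀ k n, Integrable
        (fun z => SchwartzMap.seminorm ℝ k n (fderivCLM ℝ E F (h z))) μ := by
      intro k n
      refine (hint k (n + 1)).mono'
        (((schwartz_withSeminorms ℝ E (E →L[ℝ] F)).continuous_seminorm (k, n)).comp
          hcont').aestronglyMeasurable (Filter.Eventually.of_forall fun z => ?_)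
      rw [Real.norm_of_nonneg (apply_nonneg _ _)]
      refine SchwartzMap.seminorm_le_bound ℝ k n _ (apply_nonneg _ _) fun x => ?_
      have : (⇑(fderivCLM ℝ E F (h z))) = fderiv ℝ (h z) :=
        funext fun x => fderivCLM_apply (𝕜 := ℝ) (h z) x
      rw [this, norm_iteratedFDeriv_fderiv]
      exact SchwartzMap.le_seminorm ℝ k (n + 1) (h z) x
    have hg' : ∀ y, fderivCLM ℝ E F g y = ∫ z, fderivCLM ℝ E F (h z) y ∂μ := by
      intro y
      have h1 := hasFDerivAt_integral_of_dominated_of_fderiv_le (𝕜 := ℝ) (μ := μ)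
        (F := fun y z => h z y)
        (F' := fun y z => fderiv ℝ (h z) y) (x₀ := y) (s := Set.univ)
        (bound := fun z => SchwartzMap.seminorm ℝ 0 1 (h z)) Filter.univ_mem
        (Filter.Eventually.of_forall fun x => (hev x).aestronglyMeasurable)
        ((hint 0 0).mono' (hev y).aestronglyMeasurable
          (Filter.Eventually.of_forall fun z => SchwartzMap.norm_le_seminorm ℝ (h z) y))
        (hev' y).aestronglyMeasurable
        (Filter.Eventually.of_forall fun z x _ => by
          have := SchwartzMap.norm_iteratedFDeriv_le_seminorm ℝ (h z) 1 x
          rwa [norm_iteratedFDeriv_one] at this)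
        (hint 0 1)
        (Filter.Eventually.of_forall fun z x _ => (h z).hasFDerivAt x)
      rw [fderivCLM_apply]
      have h2 : (g : E → F) = fun y => ∫ z, h z y ∂μ := funext hg
      rw [h2, h1.fderiv]
      rfl
    have h3 := ih (fun z => fderivCLM ℝ E F (h z)) (fderivCLM ℝ E F g) hcont' hint' hg' y
    simp only [iteratedFDeriv_succ_eq_comp_right, Function.comp_apply]
    have h4 : ∀ f : 𝓢(E, F), (fun y => fderiv ℝ f y) = ⇑(fderivCLM ℝ E F f) := fun f =>
      funext fun x => (fderivCLM_apply (𝕜 := ℝ) f x).symm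
    simp only [h4, h3]
    exact (ContinuousLinearEquiv.integral_comp_comm (𝕜 := ℝ) (E := E [×n]→L[ℝ] (E →L[ℝ] F))
      (F := E [×n.succ]→L[ℝ] F) (μ := μ)
      (continuousMultilinearCurryRightEquiv' ℝ n E F).symm.toContinuousLinearEquiv _).symm

variable (E) in
/-- Bounded continuous functions with values in the multilinear maps of degree `n`. -/
abbrev MultilinearBCF (n : ℕ) : Type :=
  BoundedContinuousFunction E (ContinuousMultilinearMap ℝ (fun _ : Fin n => E) ℂ)

instance (n : ℕ) : NormedAddCommGroup (MultilinearBCF E n) :=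
  BoundedContinuousFunction.instNormedAddCommGroup

instance (n : ℕ) : NormedSpace ℂ (MultilinearBCF E n) :=
  BoundedContinuousFunction.instNormedSpace

variable (E) in
/-- A finite product of spaces of bounded continuous functions. -/
abbrev DerivSpace (K : ℕ) : Type := (i : Fin (K + 1) × Fin (K + 1)) → MultilinearBCF E i.2

instance (K : ℕ) : NormedAddCommGroup (DerivSpace E K) := Pi.normedAddCommGroup

instance (K : ℕ) : NormedSpace ℂ (DerivSpace E K) := Pi.normedSpace

instance (K : ℕ) : NormedSpace ℝ (DerivSpace E K) := NormedSpace.restrictScalars ℝ ℂ _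

/-- The bounded continuous function `x ↦ ‖x‖ ^ k D^n f (x)`. -/
def weightedDeriv (k n : ℕ) (f : 𝓢(E, ℂ)) :
    MultilinearBCF E n :=
  BoundedContinuousFunction.ofNormedAddCommGroup
    (fun x => (‖x‖ ^ k) • iteratedFDeriv ℝ n f x)
    ((continuous_norm.pow k).smul ((f.smooth n).continuous_iteratedFDeriv le_rfl))
    (SchwartzMap.seminorm ℂ k n f) (fun x => by
      rw [norm_smul, norm_pow, norm_norm]; exact SchwartzMap.le_seminorm ℂ k n f x)

/-- The embedding of the Schwartz space into a finite product of spaces of bounded continuous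
functions given by weighted derivatives of order at most `K`. -/
def weightedDerivs (K : ℕ) : 𝓢(E, ℂ) →L[ℂ] DerivSpace E K :=
  SchwartzMap.mkCLMtoNormedSpace (fun f i => weightedDeriv i.1 i.2 f)
    (fun f g => by
      funext i; ext1 x
      change ‖x‖ ^ _ • iteratedFDeriv ℝ _ (⇑(f + g)) x = ‖x‖ ^ _ • iteratedFDeriv ℝ _ f x +
        ‖x‖ ^ _ • iteratedFDeriv ℝ _ g x
      have : (⇑(f + g)) = (f : E → ℂ) + g := rfl
      rw [this, iteratedFDeriv_add_apply (f.smooth _).contDiffAt (g.smooth _).contDiffAt, smul_add])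
    (fun c f => by
      funext i; ext1 x
      change ‖x‖ ^ _ • iteratedFDeriv ℝ _ (⇑(c • f)) x = c • ‖x‖ ^ _ • iteratedFDeriv ℝ _ f x
      have : (⇑(c • f)) = c • (f : E → ℂ) := rfl
      rw [this, iteratedFDeriv_const_smul_apply (f.smooth _).contDiffAt, smul_comm])
    ⟨Finset.Iic (K, K), 1, zero_le_one, fun f => by
      rw [one_mul, pi_norm_le_iff_of_nonneg (apply_nonneg _ _)]
      intro i
      refine (BoundedContinuousFunction.norm_ofNormedAddCommGroup_le _ (apply_nonneg _ _) _).trans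
        ?_
      exact Seminorm.le_def.1 (Finset.le_sup (f := schwartzSeminormFamily ℂ E ℂ)
        (b := ((i.1 : ℕ), (i.2 : ℕ)))
        (Finset.mem_Iic.2 (Prod.mk_le_mk.2 ⟨by omega, by omega⟩))) f⟩

theorem schwartzNorm_le_norm_weightedDerivs (K : ℕ) (f : 𝓢(E, ℂ)) :
    schwartzNorm K f ≤ ‖weightedDerivs K f‖ := by
  refine schwartzNorm_le (norm_nonneg _) fun k hk n hn x => ?_
  have h1 := norm_le_pi_norm (weightedDerivs K f) (⟨k, by omega⟩, ⟨n, by omega⟩)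
  have h2 := (weightedDeriv k n f).norm_coe_le_norm x
  refine le_trans (le_of_eq ?_) (h2.trans h1)
  change _ = ‖‖x‖ ^ k • iteratedFDeriv ℝ n f x‖
  rw [norm_smul, norm_pow, norm_norm]

theorem norm_weightedDeriv_le (k n : ℕ) (f : 𝓢(E, ℂ)) :
    ‖weightedDeriv k n f‖ ≤ SchwartzMap.seminorm ℂ k n f :=
  BoundedContinuousFunction.norm_ofNormedAddCommGroup_le _ (apply_nonneg _ _) _

theorem norm_weightedDerivs_le (K : ℕ) (f : 𝓢(E, ℂ)) : ‖weightedDerivs K f‖ ≤ schwartzNorm K f := by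
  rw [pi_norm_le_iff_of_nonneg (schwartzNorm_nonneg _ _)]
  intro i
  refine (norm_weightedDeriv_le i.1 i.2 f).trans ?_
  exact Seminorm.le_def.1 (Finset.le_sup (f := schwartzSeminormFamily ℂ E ℂ)
    (b := ((i.1 : ℕ), (i.2 : ℕ)))
    (Finset.mem_Iic.2 (Prod.mk_le_mk.2 ⟨by omega, by omega⟩))) f

/-- A functional which is bounded by the norm of an embedding extends to a continuous functional on
the target. -/
theorem exists_strongDual_comp_eq {V Y : Type*} [AddCommGroup V] [Module ℂ V]
    [NormedAddCommGroup Y] [NormedSpace ℂ Y] (J : V →ₗ[ℂ] Y) (a : V →ₗ[ℂ] ℂ) (C : ℝ)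
    (hJ : ∀ f, J f = 0 → f = 0) (ha : ∀ f, ‖a f‖ ≤ C * ‖J f‖) :
    ∃ b : StrongDual ℂ Y, ∀ f, b (J f) = a f := by
  -- The functional is transported to the range of `J`, where the hypothesis makes it bounded, and
  -- then extended by the Hahn–Banach theorem.
  set e := LinearEquiv.ofInjective J ((injective_iff_map_eq_zero _).2 hJ) with he
  set b₀ : StrongDual ℂ (LinearMap.range J) :=
    (a.comp e.symm.toLinearMap).mkContinuous C (fun x => by
      obtain ⟨f, rfl⟩ := e.surjective x
      have : ((e f : LinearMap.range J) : Y) = J f := rfl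
      have h2 : ‖e f‖ = ‖J f‖ := by rw [← this]; rfl
      simpa [h2] using ha f) with hb₀
  obtain ⟨b, hb, -⟩ := exists_extension_norm_eq (LinearMap.range J) b₀
  refine ⟨b, fun f => ?_⟩
  have h1 := hb (e f)
  have h2 : ((e f : LinearMap.range J) : Y) = J f := rfl
  rw [h2] at h1
  rw [h1]
  simp [hb₀]

/-- A continuous linear functional on the Schwartz space commutes with pointwise integrals of
integrable families of Schwartz functions. -/
theorem clm_eq_integral (a : 𝓢(E, ℂ) →L[ℂ] ℂ) {h : Z → 𝓢(E, ℂ)} {g : 𝓢(E, ℂ)} (hc : Continuous h)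
    (hint : ∀ K, Integrable (fun z => schwartzNorm K (h z)) μ) (hg : ∀ y, g y = ∫ z, h z y ∂μ) :
    a g = ∫ z, a (h z) ∂μ := by
  -- The Schwartz space is not normed. But `a` is controlled by one seminorm, so it factors through
  -- the Banach space of weighted derivatives up to order `K`, where Bochner integrals commute with
  -- continuous functionals and can be evaluated pointwise.
  obtain ⟨K, C, hC, ha⟩ := exists_schwartzNorm_bound_functional a
  set J := weightedDerivs (E := E) K with hJ
  have hbound : ∀ f, ‖a f‖ ≤ C * ‖J f‖ := fun f =>
    (ha f).trans (by gcongr; exact schwartzNorm_le_norm_weightedDerivs K f)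
  have hzero : ∀ f, J f = 0 → f = 0 := by
    intro f hf
    have h1 : schwartzNorm K f ≤ 0 := (schwartzNorm_le_norm_weightedDerivs K f).trans
      (by rw [← hJ, hf, norm_zero])
    ext x
    have h2 := one_add_pow_mul_apply_le_schwartzNorm (k := 0) (Nat.zero_le K) f x
    have h3 : ‖f x‖ ≤ 0 := by
      have : (2 : ℝ) ^ K * schwartzNorm K f ≤ 0 :=
        mul_nonpos_of_nonneg_of_nonpos (by positivity) h1
      simpa using h2.trans this
    exact norm_le_zero_iff.1 h3
  obtain ⟨b, hba⟩ := exists_strongDual_comp_eq J.toLinearMap a.toLinearMap C hzero hbound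
  replace hba : ∀ f, b (J f) = a f := hba
  have hJc : Continuous fun z => J (h z) := J.continuous.comp hc
  have hseminorm : ∀ k n, Integrable (fun z => SchwartzMap.seminorm ℝ k n (h z)) μ := by
    intro k n
    refine (hint (k + n)).mono'
      (((schwartz_withSeminorms ℝ E ℂ).continuous_seminorm (k, n)).comp hc).aestronglyMeasurable
      (Filter.Eventually.of_forall fun z => ?_)
    rw [Real.norm_of_nonneg (apply_nonneg _ _)]
    refine SchwartzMap.seminorm_le_bound ℝ k n _ (apply_nonneg _ _) fun x => ?_
    refine (SchwartzMap.le_seminorm ℂ k n (h z) x).trans ?_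
    exact Seminorm.le_def.1 (Finset.le_sup (f := schwartzSeminormFamily ℂ E ℂ) (b := (k, n))
      (Finset.mem_Iic.2 (Prod.mk_le_mk.2 ⟨by omega, by omega⟩))) (h z)
  have : SecondCountableTopologyEither Z (DerivSpace E K) :=
    secondCountableTopologyEither_of_left _ _
  have hJint : Integrable (fun z => J (h z)) μ := by
    refine (hint K).mono' hJc.aestronglyMeasurable (Filter.Eventually.of_forall fun z => ?_)
    exact norm_weightedDerivs_le K (h z)
  have hJg : J g = ∫ z, J (h z) ∂μ := by
    funext i
    ext1 x
    have h1 := ((BoundedContinuousFunction.evalCLM ℂ x).comp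
      (ContinuousLinearMap.proj (R := ℂ) (φ := fun i : Fin (K + 1) × Fin (K + 1) =>
        MultilinearBCF E i.2) i)).integral_comp_comm hJint
    refine Eq.trans ?_ h1
    change ‖x‖ ^ (i.1 : ℕ) • iteratedFDeriv ℝ i.2 g x =
      ∫ z, ‖x‖ ^ (i.1 : ℕ) • iteratedFDeriv ℝ i.2 (h z) x ∂μ
    rw [integral_smul, iteratedFDeriv_eq_integral _ h g hc hseminorm hg]
  rw [← hba, hJg, ← b.integral_comp_comm hJint]
  simp only [hba]

end Superposition

/-! ### Characters and time-frequency shifts -/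

section ExpInner

variable {ι : Type} [Fintype ι]

theorem norm_expInner (ξ y : EuclideanSpace ℝ ι) : ‖expInner ξ y‖ = 1 := by
  have := Complex.norm_exp_ofReal_mul_I (-(inner ℝ y ξ : ℝ))
  rw [expInner]
  simpa using this

theorem expInner_add_left (ξ η y : EuclideanSpace ℝ ι) :
    expInner (ξ + η) y = expInner ξ y * expInner η y := by
  simp only [expInner, inner_add_right, ← Complex.exp_add]
  push_cast; ring_nf

theorem expInner_add_right (ξ y z : EuclideanSpace ℝ ι) :
    expInner ξ (y + z) = expInner ξ y * expInner ξ z := by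
  simp only [expInner, inner_add_left, ← Complex.exp_add]
  push_cast; ring_nf

theorem expInner_neg_mul_self (ξ y : EuclideanSpace ℝ ι) :
    expInner (-ξ) y * expInner ξ y = 1 := by
  rw [← expInner_add_left]
  simp [expInner]

theorem expInner_zero_left (y : EuclideanSpace ℝ ι) : expInner 0 y = 1 := by
  simp [expInner]

theorem contDiff_expInner :
    ContDiff ℝ (⊤ : ℕ∞) fun p : EuclideanSpace ℝ ι × EuclideanSpace ℝ ι => expInner p.1 p.2 := by
  unfold expInner
  have h1 : ContDiff ℝ (⊤ : ℕ∞) fun p : EuclideanSpace ℝ ι × EuclideanSpace ℝ ι =>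
      (inner ℝ p.2 p.1 : ℝ) := contDiff_snd.inner ℝ contDiff_fst
  exact ((Complex.ofRealCLM.contDiff.comp h1).mul contDiff_const).neg.cexp

theorem continuous_expInner :
    Continuous fun p : EuclideanSpace ℝ ι × EuclideanSpace ℝ ι => expInner p.1 p.2 :=
  contDiff_expInner.continuous

@[fun_prop]
theorem Continuous.expInner {Z : Type*} [TopologicalSpace Z] {f g : Z → EuclideanSpace ℝ ι}
    (hf : Continuous f) (hg : Continuous g) : Continuous fun z => expInner (f z) (g z) :=
  continuous_expInner.comp (hf.prodMk hg)

theorem norm_iteratedFDeriv_expInner_le (ξ y : EuclideanSpace ℝ ι) (n : ℕ) :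
    ‖iteratedFDeriv ℝ n (expInner ξ) y‖ ≤ ‖ξ‖ ^ n := by
  have hd : ∀ n : ℕ, iteratedDeriv n (fun t : ℝ => Complex.exp (-(t * Complex.I))) =
      fun t : ℝ => (-Complex.I) ^ n * Complex.exp (-(t * Complex.I)) := by
    intro n
    induction n with
    | zero => simp
    | succ n ih =>
      rw [iteratedDeriv_succ, ih]
      funext t
      have h1 : HasDerivAt (fun t : ℝ => -((t : ℂ) * Complex.I)) (-Complex.I) t := by
        convert! ((Complex.ofRealCLM.hasDerivAt (x := t)).mul_const Complex.I).neg using 1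
        simp
      have h2 := (h1.cexp).const_mul ((-Complex.I) ^ n)
      rw [h2.deriv]
      ring
  have hc : expInner ξ = (fun t : ℝ => Complex.exp (-(t * Complex.I))) ∘ innerSL ℝ ξ := by
    funext y
    simp [expInner, real_inner_comm]
  have hs : ContDiff ℝ n (fun t : ℝ => Complex.exp (-(t * Complex.I))) :=
    ((Complex.ofRealCLM.contDiff.mul contDiff_const).neg).cexp
  rw [hc, (innerSL ℝ ξ).iteratedFDeriv_comp_right hs y le_rfl]
  refine (ContinuousMultilinearMap.norm_compContinuousLinearMap_le _ _).trans ?_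
  rw [norm_iteratedFDeriv_eq_norm_iteratedDeriv, hd]
  have h1 : ‖Complex.exp (-(((innerSL ℝ ξ) y : ℝ) * Complex.I))‖ = 1 := by
    have := Complex.norm_exp_ofReal_mul_I (-((innerSL ℝ ξ) y))
    simpa using this
  rw [norm_mul, h1]
  simp

theorem continuous_tfShift_apply (χ : 𝓢(EuclideanSpace ℝ ι, ℂ)) {Z : Type*} [TopologicalSpace Z]
    {x ξ y : Z → EuclideanSpace ℝ ι} (hx : Continuous x) (hξ : Continuous ξ) (hy : Continuous y) :
    Continuous fun z => tfShift χ (x z) (ξ z) (y z) := by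
  simp only [tfShift_apply]
  exact (Continuous.expInner hξ hy).mul (χ.continuous.comp (hy.sub hx))

theorem norm_tfShift_apply (χ : 𝓢(EuclideanSpace ℝ ι, ℂ)) (x ξ y : EuclideanSpace ℝ ι) :
    ‖tfShift χ x ξ y‖ = ‖χ (y - x)‖ := by
  rw [tfShift_apply, norm_mul, norm_expInner, one_mul]

/-- A translation costs powers of `1 + ‖x‖` by the triangle inequality, and every derivative falling
on the character costs a factor `‖ξ‖`. Only the polynomial nature of the growth matters: it is later
beaten by the rapid decay of `tfPair`. -/
theorem schwartzNorm_tfShift_le (K : ℕ) (χ : 𝓢(EuclideanSpace ℝ ι, ℂ))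
    (x ξ : EuclideanSpace ℝ ι) : schwartzNorm K (tfShift χ x ξ) ≤
      4 ^ K * ((1 + ‖x‖) ^ K * (1 + ‖ξ‖) ^ K) * schwartzNorm K χ := by
  have h0 := schwartzNorm_nonneg K χ
  refine schwartzNorm_le (by positivity) fun k hk n hn y => ?_
  have hfun : (tfShift χ x ξ : EuclideanSpace ℝ ι → ℂ) = fun y => expInner ξ y * χ (y + -x) := by
    funext y; rw [tfShift_apply, sub_eq_add_neg]
  have hsm : ContDiff ℝ n (fun y => χ (y + -x)) :=
    (χ.smooth n).comp (contDiff_id.add contDiff_const)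
  have hse : ContDiff ℝ n (expInner ξ) :=
    (contDiff_expInner.comp (contDiff_const.prodMk contDiff_id)).of_le (by exact_mod_cast le_top)
  have h1 := norm_iteratedFDeriv_mul_le hse hsm y (n := n) le_rfl
  have hterm : ∀ i ∈ Finset.range (n + 1), ‖y‖ ^ k * (‖iteratedFDeriv ℝ i (expInner ξ) y‖ *
      ‖iteratedFDeriv ℝ (n - i) (fun y => χ (y + -x)) y‖) ≤
      (1 + ‖x‖) ^ K * (1 + ‖ξ‖) ^ K * (2 ^ K * schwartzNorm K χ) := by
    intro i hi
    have hi' : i ≤ n := Nat.lt_succ_iff.1 (Finset.mem_range.1 hi)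
    rw [iteratedFDeriv_comp_add_right]
    have a1 := one_add_pow_mul_le_schwartzNorm (K := K) (k := k) (n := n - i) hk (by omega) χ
      (y + -x)
    have a2 : ‖y‖ ^ k ≤ (1 + ‖y + -x‖) ^ k * (1 + ‖x‖) ^ k := by
      have := one_add_norm_add_pow_le (y + -x) x k
      rw [neg_add_cancel_right] at this
      exact (pow_le_pow_left₀ (norm_nonneg _) (by linarith) _).trans this
    have a3 : ‖iteratedFDeriv ℝ i (expInner ξ) y‖ ≤ (1 + ‖ξ‖) ^ K :=
      (norm_iteratedFDeriv_expInner_le ξ y i).trans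
        ((pow_le_pow_left₀ (norm_nonneg _) (by linarith) _).trans
          (pow_le_pow_right₀ (by linarith [norm_nonneg ξ]) (by omega)))
    have a4 : (1 + ‖x‖) ^ k ≤ (1 + ‖x‖) ^ K :=
      pow_le_pow_right₀ (by linarith [norm_nonneg x]) hk
    calc _ ≤ ((1 + ‖y + -x‖) ^ k * (1 + ‖x‖) ^ K) * ((1 + ‖ξ‖) ^ K *
          ‖iteratedFDeriv ℝ (n - i) χ (y + -x)‖) := by
            gcongr
            exact a2.trans (by gcongr)
      _ = (1 + ‖x‖) ^ K * (1 + ‖ξ‖) ^ K *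
          ((1 + ‖y + -x‖) ^ k * ‖iteratedFDeriv ℝ (n - i) χ (y + -x)‖) := by ring
      _ ≤ _ := by gcongr
  rw [hfun]
  calc _ ≤ ‖y‖ ^ k * (∑ i ∈ Finset.range (n + 1), (n.choose i : ℝ) *
        ‖iteratedFDeriv ℝ i (expInner ξ) y‖ *
        ‖iteratedFDeriv ℝ (n - i) (fun y => χ (y + -x)) y‖) := by gcongr
    _ = ∑ i ∈ Finset.range (n + 1), (n.choose i : ℝ) * (‖y‖ ^ k *
      (‖iteratedFDeriv ℝ i (expInner ξ) y‖ *
        ‖iteratedFDeriv ℝ (n - i) (fun y => χ (y + -x)) y‖)) := by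
        rw [Finset.mul_sum]
        exact Finset.sum_congr rfl fun i _ => by ring
    _ ≤ ∑ i ∈ Finset.range (n + 1), (n.choose i : ℝ) *
        ((1 + ‖x‖) ^ K * (1 + ‖ξ‖) ^ K * (2 ^ K * schwartzNorm K χ)) :=
        Finset.sum_le_sum fun i hi => mul_le_mul_of_nonneg_left (hterm i hi) (by positivity)
    _ = 2 ^ n * ((1 + ‖x‖) ^ K * (1 + ‖ξ‖) ^ K * (2 ^ K * schwartzNorm K χ)) := by
        rw [← Finset.sum_mul]
        congr 1
        exact_mod_cast Nat.sum_range_choose n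
    _ ≤ 2 ^ K * ((1 + ‖x‖) ^ K * (1 + ‖ξ‖) ^ K * (2 ^ K * schwartzNorm K χ)) := by
        gcongr; norm_num
    _ = _ := by
        have : (4 : ℝ) ^ K = 2 ^ K * 2 ^ K := by rw [← mul_pow]; norm_num
        rw [this]; ring

/-- Continuity into the Schwartz space makes the short-time Fourier transform of every tempered
distribution continuous, hence measurable, and its essential suprema true suprema. -/
theorem continuous_tfShift (χ : 𝓢(EuclideanSpace ℝ ι, ℂ)) :
    Continuous fun z : EuclideanSpace ℝ ι × EuclideanSpace ℝ ι => tfShift χ z.1 z.2 := by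
  refine continuous_schwartz_of_continuous_iteratedFDeriv (fun n => ?_) fun z₀ K => ?_
  · have h : ∀ z : EuclideanSpace ℝ ι × EuclideanSpace ℝ ι,
        (tfShift χ z.1 z.2 : EuclideanSpace ℝ ι → ℂ) =
        fun y => expInner z.2 y * χ (y - z.1) := fun z => funext (tfShift_apply χ z.1 z.2)
    simp only [h]
    refine continuous_iteratedFDeriv_param (Z := EuclideanSpace ℝ ι × EuclideanSpace ℝ ι)
      (f := fun p => expInner p.1.2 p.2 * χ (p.2 - p.1.1)) ?_ n
    exact (contDiff_expInner.comp ((contDiff_snd.comp contDiff_fst).prodMk contDiff_snd)).mul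
      ((χ.smooth _).comp (contDiff_snd.sub (contDiff_fst.comp contDiff_fst)))
  · have hc : Continuous fun z : EuclideanSpace ℝ ι × EuclideanSpace ℝ ι =>
        4 ^ K * ((1 + ‖z.1‖) ^ K * (1 + ‖z.2‖) ^ K) * schwartzNorm K χ := by fun_prop
    refine ⟨4 ^ K * ((1 + ‖z₀.1‖) ^ K * (1 + ‖z₀.2‖) ^ K) * schwartzNorm K χ + 1, ?_⟩
    filter_upwards [hc.continuousAt.eventually (gt_mem_nhds (lt_add_one _))] with z hz
    exact (schwartzNorm_tfShift_le K χ z.1 z.2).trans hz.le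

theorem continuous_stft (χ : 𝓢(EuclideanSpace ℝ ι, ℂ)) (f : 𝓢'(EuclideanSpace ℝ ι, ℂ)) :
    Continuous fun z : EuclideanSpace ℝ ι × EuclideanSpace ℝ ι => stft χ f z.1 z.2 := by
  have h : Continuous fun g : 𝓢(EuclideanSpace ℝ ι, ℂ) => f g := f.continuous
  exact continuous_const.mul (h.comp (continuous_tfShift χ))

end ExpInner

/-! ### Polynomial decay functions -/

section Decay

/-- `(1 + ‖x‖) ^ (-M)` -/
def decay {E : Type*} [NormedAddCommGroup E] (M : ℕ) (x : E) : ℝ := ((1 + ‖x‖) ^ M)⁻¹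

variable {E : Type*} [NormedAddCommGroup E]

theorem decay_pos (M : ℕ) (x : E) : 0 < decay M x := by unfold decay; positivity

theorem decay_le_one (M : ℕ) (x : E) : decay M x ≤ 1 :=
  inv_le_one_of_one_le₀ (one_le_pow₀ (by linarith [norm_nonneg x]))

@[fun_prop]
theorem continuous_decay (M : ℕ) : Continuous (decay M : E → ℝ) :=
  ((continuous_const.add continuous_norm).pow M).inv₀ fun x =>
    (pow_pos (by positivity : (0 : ℝ) < 1 + ‖x‖) M).ne'

/-- The accounting rule of all the estimates: of the `N + M` available powers, `N` pay for a weight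
or a growing seminorm and `M` are kept for integrability. -/
theorem one_add_norm_pow_mul_decay (M N : ℕ) (x : E) :
    (1 + ‖x‖) ^ N * decay (N + M) x = decay M x := by
  have : (0 : ℝ) < 1 + ‖x‖ := by positivity
  rw [decay, decay, pow_add]; field_simp

theorem integrable_decay {ι : Type*} [Fintype ι] {M : ℕ} (hM : Fintype.card ι < M) :
    Integrable (decay M : EuclideanSpace ℝ ι → ℝ) := by
  have h := integrable_one_add_norm (μ := (volume : Measure (EuclideanSpace ℝ ι))) (r := M)
    (by rw [finrank_euclideanSpace]; exact_mod_cast hM)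
  refine h.congr (Filter.Eventually.of_forall fun x => ?_)
  simp only [decay]
  rw [Real.rpow_neg (by positivity), Real.rpow_natCast]

end Decay

/-! ### Fourier integrals and the short-time Fourier transform of Schwartz functions -/

open FourierTransform

variable {ι : Type} [Fintype ι]

/-- The Fourier integral `∫ h(Y) exp (-i ⟨Y, Θ⟩) dY`. -/
def fourInt (h : EuclideanSpace ℝ ι → ℂ) (Θ : EuclideanSpace ℝ ι) : ℂ :=
  ∫ Y, h Y * expInner Θ Y

theorem fourier_eq_fourInt (h : EuclideanSpace ℝ ι → ℂ) (w : EuclideanSpace ℝ ι) :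
    𝓕 h w = fourInt h ((2 * π) • w) := by
  rw [Real.fourier_eq', fourInt]
  congr 1
  funext y
  rw [smul_eq_mul, mul_comm, expInner, inner_smul_right]
  congr 2
  push_cast
  ring

theorem fourInt_eq_fourier (h : EuclideanSpace ℝ ι → ℂ) (Θ : EuclideanSpace ℝ ι) :
    fourInt h Θ = 𝓕 h ((2 * π)⁻¹ • Θ) := by
  rw [fourier_eq_fourInt, smul_inv_smul₀ (by positivity)]

theorem continuous_fourInt {h : EuclideanSpace ℝ ι → ℂ} (hh : Integrable h) :
    Continuous (fourInt h) := by
  refine continuous_of_dominated (bound := fun y => ‖h y‖) (fun Θ => ?_)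
    (fun Θ => Filter.Eventually.of_forall fun y => ?_) hh.norm
    (Filter.Eventually.of_forall fun y => by fun_prop)
  · exact hh.aestronglyMeasurable.mul
      (Continuous.expInner continuous_const continuous_id).aestronglyMeasurable
  · rw [norm_mul, norm_expInner, mul_one]

/-- Continuity of the Fourier transform on the Schwartz space, with the frequency rescaled by `2 *
π`. The constants are uniform in `h`, which allows families of amplitudes depending on `Z`. -/
theorem fourInt_decay (ι : Type) [Fintype ι] (M : ℕ) : ∃ (K : ℕ) (C : ℝ), 0 < C ∧
    ∀ (h : 𝓢(EuclideanSpace ℝ ι, ℂ)) (Θ : EuclideanSpace ℝ ι),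
      ‖fourInt h Θ‖ ≤ C * schwartzNorm K h * decay M Θ := by
  obtain ⟨K, C, hC, hK⟩ := exists_schwartzNorm_bound_clm
    (fourierCLM ℂ 𝓢(EuclideanSpace ℝ ι, ℂ)) M
  refine ⟨K, (2 * π) ^ M * (2 ^ M * C), by positivity, fun h Θ => ?_⟩
  have h1 := one_add_pow_mul_apply_le_schwartzNorm (K := M) le_rfl
    (fourierCLM ℂ 𝓢(EuclideanSpace ℝ ι, ℂ) h) ((2 * π)⁻¹ • Θ)
  have h2 : fourierCLM ℂ 𝓢(EuclideanSpace ℝ ι, ℂ) h ((2 * π)⁻¹ • Θ) = fourInt h Θ := by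
    rw [fourInt_eq_fourier]; rfl
  rw [h2] at h1
  have h3 : (1 + ‖Θ‖) ^ M ≤ (2 * π) ^ M * (1 + ‖(2 * π)⁻¹ • Θ‖) ^ M := by
    rw [← mul_pow]
    gcongr
    rw [norm_smul, norm_inv, Real.norm_of_nonneg (by positivity), mul_add,
      mul_inv_cancel_left₀ (by positivity)]
    linarith [Real.pi_gt_three]
  rw [decay, ← div_eq_mul_inv, le_div_iff₀ (by positivity), mul_comm]
  calc _ ≤ (2 * π) ^ M * (1 + ‖(2 * π)⁻¹ • Θ‖) ^ M * ‖fourInt h Θ‖ := by gcongr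
    _ = (2 * π) ^ M * ((1 + ‖(2 * π)⁻¹ • Θ‖) ^ M * ‖fourInt h Θ‖) := by ring
    _ ≤ (2 * π) ^ M * (2 ^ M * (C * schwartzNorm K h)) := by
        refine mul_le_mul_of_nonneg_left ?_ (by positivity)
        exact h1.trans (mul_le_mul_of_nonneg_left (hK h) (by positivity))
    _ = _ := by ring

/-- The square of the normalizing constant is the Jacobian of the dilation by `2 * π` between the
two conventions for the Fourier transform. -/
theorem fourierConst_sq_mul_integral_smul (F : EuclideanSpace ℝ ι → ℂ) :
    (fourierConst ι : ℂ) ^ 2 * ∫ η, F η = ∫ w, F ((2 * π) • w) := by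
  have h1 := Measure.integral_comp_smul (volume : Measure (EuclideanSpace ℝ ι)) F (2 * π)
  have hpos : (0 : ℝ) < (2 * π) ^ (Fintype.card ι) := by positivity
  rw [finrank_euclideanSpace, abs_of_pos (inv_pos.2 hpos)] at h1
  rw [h1, Complex.real_smul]
  congr 1
  have h3 := fourierConst_sq (ι := ι)
  have h4 : (fourierConst ι : ℝ) ^ 2 = ((2 * π) ^ Fintype.card ι)⁻¹ :=
    eq_inv_of_mul_eq_one_left h3
  exact_mod_cast h4

/-- Fourier inversion. -/
theorem fourInt_inversion {h : EuclideanSpace ℝ ι → ℂ} (hh : Integrable h)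
    (hF : Integrable (fourInt h)) {y : EuclideanSpace ℝ ι} (hc : ContinuousAt h y) :
    (fourierConst ι : ℂ) ^ 2 * ∫ η, fourInt h η * expInner (-η) y = h y := by
  have hF' : Integrable (𝓕 h) := by
    have : 𝓕 h = fun w => fourInt h ((2 * π) • w) := funext (fourier_eq_fourInt h)
    rw [this]
    exact (integrable_comp_smul_iff volume _ (by positivity)).2 hF
  rw [fourierConst_sq_mul_integral_smul, ← hh.fourierInv_fourier_eq hF' hc, Real.fourierInv_eq']
  congr 1
  funext w
  rw [smul_eq_mul, mul_comm, fourier_eq_fourInt, expInner]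
  congr 2
  rw [inner_neg_right, inner_smul_right, real_inner_comm]
  push_cast
  ring

theorem integrable_fourInt (h : 𝓢(EuclideanSpace ℝ ι, ℂ)) : Integrable (fourInt h) := by
  obtain ⟨K, C, hC, hK⟩ := fourInt_decay ι (Fintype.card ι + 1)
  exact ((integrable_decay (Nat.lt_succ_self _)).const_mul (C * schwartzNorm K h)).mono'
    (continuous_fourInt h.integrable).aestronglyMeasurable (Filter.Eventually.of_forall (hK h))

/-- The pairing of a Schwartz function with a time-frequency shifted window. -/
def tfPair (f χ : 𝓢(EuclideanSpace ℝ ι, ℂ)) (u η : EuclideanSpace ℝ ι) : ℂ :=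
  ∫ x, f x * tfShift χ u η x

theorem stft_coe (f χ : 𝓢(EuclideanSpace ℝ ι, ℂ)) (u η : EuclideanSpace ℝ ι) :
    stft χ (f : 𝓢'(EuclideanSpace ℝ ι, ℂ)) u η = fourierConst ι * tfPair f χ u η := by
  rw [stft, SchwartzMap.coe_apply, tfPair]
  simp [mul_comm]

theorem tfPair_eq_fourInt (f χ : 𝓢(EuclideanSpace ℝ ι, ℂ)) (u η : EuclideanSpace ℝ ι) :
    tfPair f χ u η = fourInt (mulComp f χ (ContinuousLinearMap.id ℝ _) (-u)) η := by
  rw [tfPair, fourInt]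
  congr 1
  funext x
  rw [mulComp_apply, tfShift_apply, ContinuousLinearMap.id_apply, ← sub_eq_add_neg]
  ring

/-- Decay in `u` comes from the separation of `f` and the translated window, decay in `η` from the
smoothness of their product. -/
theorem tfPair_decay (ι : Type) [Fintype ι] (M : ℕ) : ∃ (K : ℕ) (C : ℝ), 0 < C ∧
    ∀ (f χ : 𝓢(EuclideanSpace ℝ ι, ℂ)) (u η : EuclideanSpace ℝ ι),
      ‖tfPair f χ u η‖ ≤ C * (schwartzNorm K f * schwartzNorm K χ) * (decay M u * decay M η) := by
  obtain ⟨K, C, hC, hK⟩ := fourInt_decay ι M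
  obtain ⟨C', hC', hK'⟩ := schwartzNorm_mulComp_le
    (ContinuousLinearMap.id ℝ (EuclideanSpace ℝ ι)) K M
  refine ⟨K + M, C * C', by positivity, fun f χ u η => ?_⟩
  rw [tfPair_eq_fourInt]
  refine (hK _ η).trans ?_
  have h1 := hK' f χ (-u)
  rw [norm_neg, ← le_div_iff₀' (by positivity), div_eq_mul_inv] at h1
  have h2 : ((1 + ‖u‖) ^ M)⁻¹ = decay M u := rfl
  rw [h2] at h1
  have h3 := (decay_pos M η).le
  calc _ ≤ C * (C' * (schwartzNorm (K + M) f * schwartzNorm (K + M) χ) * decay M u) *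
        decay M η := by gcongr
    _ = _ := by ring

theorem continuous_tfPair (f χ : 𝓢(EuclideanSpace ℝ ι, ℂ)) :
    Continuous fun z : EuclideanSpace ℝ ι × EuclideanSpace ℝ ι => tfPair f χ z.1 z.2 := by
  obtain ⟨K, hK⟩ : ∃ K : ℝ, ∀ x, ‖χ x‖ ≤ K := ⟨_, fun x => SchwartzMap.norm_le_seminorm ℝ χ x⟩
  refine continuous_of_dominated (bound := fun y => ‖f y‖ * K) (fun z => ?_)
    (fun z => Filter.Eventually.of_forall fun y => ?_) (f.integrable.norm.mul_const K)
    (Filter.Eventually.of_forall fun y => continuous_const.mul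
      (continuous_tfShift_apply χ continuous_fst continuous_snd continuous_const))
  · exact (f.continuous.mul (tfShift χ z.1 z.2).continuous).aestronglyMeasurable
  · rw [norm_mul, norm_tfShift_apply]
    exact mul_le_mul_of_nonneg_left (hK _) (norm_nonneg _)

/-- Covariance under phase space translations; the unimodular factor is irrelevant for estimates. -/
theorem norm_tfPair_tfShift (f χ : 𝓢(EuclideanSpace ℝ ι, ℂ)) (x ξ u η : EuclideanSpace ℝ ι) :
    ‖tfPair (tfShift f x ξ) χ u η‖ = ‖tfPair f χ (u - x) (ξ + η)‖ := by
  have h : tfPair (tfShift f x ξ) χ u η =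
      expInner (ξ + η) x * tfPair f χ (u - x) (ξ + η) := by
    rw [tfPair, ← integral_add_right_eq_self _ x, tfPair, ← integral_const_mul]
    congr 1
    funext y
    simp only [tfShift_apply, add_sub_cancel_right, expInner_add_left, expInner_add_right]
    rw [show y + x - u = y - (u - x) by abel]
    ring
  rw [h, norm_mul, norm_expInner, one_mul]

theorem integrable_tfPair (f χ : 𝓢(EuclideanSpace ℝ ι, ℂ)) :
    Integrable fun z : EuclideanSpace ℝ ι × EuclideanSpace ℝ ι => tfPair f χ z.1 z.2 := by
  obtain ⟨K, C, hC, hK⟩ := tfPair_decay ι (Fintype.card ι + 1)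
  have hd := integrable_decay (ι := ι) (Nat.lt_succ_self (Fintype.card ι))
  exact ((hd.mul_prod hd).const_mul (C * (schwartzNorm K f * schwartzNorm K χ))).mono'
    (continuous_tfPair f χ).aestronglyMeasurable
    (Filter.Eventually.of_forall fun z => hK f χ z.1 z.2)

/-- Inversion formula for the short-time Fourier transform of Schwartz functions. -/
theorem tfPair_inversion (f χ γ : 𝓢(EuclideanSpace ℝ ι, ℂ)) (hγ : ∫ y, χ y * γ y = 1)
    (y : EuclideanSpace ℝ ι) :
    f y = ∫ z : EuclideanSpace ℝ ι × EuclideanSpace ℝ ι,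
      (fourierConst ι : ℂ) ^ 2 * tfPair f χ z.1 z.2 * tfShift γ z.1 (-z.2) y := by
  have hint : Integrable (fun z : EuclideanSpace ℝ ι × EuclideanSpace ℝ ι =>
      (fourierConst ι : ℂ) ^ 2 * tfPair f χ z.1 z.2 * tfShift γ z.1 (-z.2) y) := by
    refine Integrable.mul_bdd (c := SchwartzMap.seminorm ℝ 0 0 γ)
      ((integrable_tfPair f χ).const_mul _)
      (continuous_tfShift_apply γ continuous_fst continuous_snd.neg
        continuous_const).aestronglyMeasurable
      (Filter.Eventually.of_forall fun z => ?_)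
    rw [norm_tfShift_apply]
    exact SchwartzMap.norm_le_seminorm ℝ γ _
  rw [Measure.volume_eq_prod] at hint ⊢
  rw [integral_prod _ hint]
  -- For fixed `u`, Fourier inversion in `η` returns `f * χ (· - u)`. The normalization of the pair
  -- `χ`, `γ` then takes care of the integral over `u`.
  have hin : ∀ u, ∫ η, (fourierConst ι : ℂ) ^ 2 * tfPair f χ u η * tfShift γ u (-η) y =
      f y * (χ (y - u) * γ (y - u)) := by
    intro u
    have h1 := fourInt_inversion (y := y)
      (mulComp f χ (ContinuousLinearMap.id ℝ _) (-u)).integrable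
      (integrable_fourInt _) (mulComp f χ (ContinuousLinearMap.id ℝ _) (-u)).continuous.continuousAt
    rw [mulComp_apply, ContinuousLinearMap.id_apply, ← sub_eq_add_neg] at h1
    rw [← mul_assoc, ← h1, ← integral_const_mul, ← integral_mul_const]
    congr 1
    funext η
    rw [tfPair_eq_fourInt, tfShift_apply]
    ring
  simp only [hin]
  rw [integral_const_mul, integral_sub_left_eq_self (fun z => χ z * γ z) volume y, hγ, mul_one]

/-- A dual window. -/
theorem exists_dual_window (χ : 𝓢(EuclideanSpace ℝ ι, ℂ)) (hχ : χ ≠ 0) :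
    ∃ γ : 𝓢(EuclideanSpace ℝ ι, ℂ), ∫ y, χ y * γ y = 1 := by
  have hpos : 0 < ∫ y, ‖χ y‖ ^ 2 := by
    obtain ⟨x, hx⟩ : ∃ x, χ x ≠ 0 := by
      by_contra! h
      exact hχ (SchwartzMap.ext h)
    have hint : Integrable fun y => ‖χ y‖ ^ 2 := by
      simp only [pow_two]
      exact χ.integrable.norm.mul_bdd (c := SchwartzMap.seminorm ℝ 0 0 χ)
        χ.continuous.norm.aestronglyMeasurable (Filter.Eventually.of_forall fun z => by
          rw [norm_norm]; exact SchwartzMap.norm_le_seminorm ℝ χ z)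
    rw [integral_pos_iff_support_of_nonneg (fun y => by positivity) hint]
    refine IsOpen.measure_pos _ ?_ ⟨x, by simpa using hx⟩
    exact (χ.continuous.norm.pow 2).isOpen_support
  -- The dual window is the complex conjugate of `χ`, divided by the square of its `L²` norm.
  refine ⟨((∫ y, ‖χ y‖ ^ 2 : ℝ) : ℂ)⁻¹ • postcompCLM (𝕜 := ℝ)
    (Complex.conjCLE.toContinuousLinearMap) χ, ?_⟩
  have : ∀ y, χ y * (((∫ y, ‖χ y‖ ^ 2 : ℝ) : ℂ)⁻¹ • postcompCLM (𝕜 := ℝ)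
      (Complex.conjCLE.toContinuousLinearMap) χ) y =
      ((∫ y, ‖χ y‖ ^ 2 : ℝ) : ℂ)⁻¹ * ((‖χ y‖ ^ 2 : ℝ) : ℂ) := by
    intro y
    rw [smul_apply, postcompCLM_apply, smul_eq_mul, mul_left_comm]
    congr 1
    simpa using Complex.mul_conj' (χ y)
  simp only [this]
  rw [integral_const_mul, integral_complex_ofReal, inv_mul_cancel₀]
  exact_mod_cast hpos.ne'

/-! ### Regularization of moderate weights -/

section Weights

variable {E : Type*} [NormedAddCommGroup E]

/-- Continuous moderate weights with constant one. -/
structure IsContModerate (N : ℕ) (w : E → ℝ) : Prop where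
  pos : ∀ x, 0 < w x
  continuous : Continuous w
  add_le : ∀ x y, w (x + y) ≤ w x * (1 + ‖y‖) ^ N

theorem IsContModerate.le_sub {N : ℕ} {w : E → ℝ} (hw : IsContModerate N w) (x y : E) :
    w x ≤ w y * (1 + ‖x - y‖) ^ N := by
  simpa using hw.add_le y (x - y)

/-- Every moderate function is equivalent to a continuous one. -/
theorem exists_isContModerate {ω : E → ℝ} (hpos : ∀ x, 0 < ω x)
    (hmod : ∃ (C : ℝ) (N : ℕ), ∀ x y, ω (x + y) ≤ C * ω x * (1 + ‖y‖) ^ N) :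
    ∃ (N : ℕ) (C : ℝ) (w : E → ℝ), 0 < C ∧ IsContModerate N w ∧ ∀ x, w x ≤ ω x ∧ ω x ≤ C * w x := by
  obtain ⟨C, N, h⟩ := hmod
  have hC : 0 < C := by
    have h0 := h 0 0
    have := hpos 0
    simp only [add_zero, norm_zero, one_pow, mul_one] at h0
    by_contra! hC
    nlinarith
  -- Taking this infimum turns the constant in the moderateness estimate into one. Consequently `w z
  -- / w x` lies between `(1 + ‖z - x‖) ^ (-N)` and `(1 + ‖z - x‖) ^ N`, and continuity follows by
  -- squeezing.
  set w : E → ℝ := fun x => ⨅ y, ω (x + y) * (1 + ‖y‖) ^ N with hw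
  have hbdd : ∀ x, BddBelow (Set.range fun y => ω (x + y) * (1 + ‖y‖) ^ N) := fun x =>
    ⟨0, by rintro _ ⟨y, rfl⟩; have := hpos (x + y); positivity⟩
  have hle : ∀ x, w x ≤ ω x := fun x => (ciInf_le (hbdd x) 0).trans (by simp)
  have hge : ∀ x, ω x ≤ C * w x := by
    intro x
    rw [← div_le_iff₀' hC]
    refine le_ciInf fun y => ?_
    rw [div_le_iff₀' hC]
    have := h (x + y) (-y)
    rw [add_neg_cancel_right, norm_neg] at this
    linarith
  have hwpos : ∀ x, 0 < w x := fun x => by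
    have h1 := hge x
    have h2 := hpos x
    by_contra! h3
    nlinarith
  have hadd : ∀ x y, w (x + y) ≤ w x * (1 + ‖y‖) ^ N := by
    intro x z
    rw [← div_le_iff₀ (by positivity)]
    refine le_ciInf fun y => ?_
    rw [div_le_iff₀ (by positivity)]
    refine (ciInf_le (hbdd _) (y - z)).trans ?_
    rw [add_add_sub_cancel, mul_assoc]
    refine mul_le_mul_of_nonneg_left ?_ (hpos _).le
    have := one_add_norm_add_pow_le y (-z) N
    rwa [norm_neg, ← sub_eq_add_neg] at this
  refine ⟨N, C, w, hC, ⟨hwpos, ?_, hadd⟩, fun x => ⟨hle x, hge x⟩⟩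
  rw [continuous_iff_continuousAt]
  intro x
  have hup : ∀ z, w z ≤ w x * (1 + ‖z - x‖) ^ N := fun z => by simpa using hadd x (z - x)
  have hlow : ∀ z, w x / (1 + ‖z - x‖) ^ N ≤ w z := fun z => by
    rw [div_le_iff₀ (by positivity), norm_sub_rev]
    simpa using hadd z (x - z)
  refine tendsto_of_tendsto_of_tendsto_of_le_of_le (g := fun z => w x / (1 + ‖z - x‖) ^ N)
    (h := fun z => w x * (1 + ‖z - x‖) ^ N) ?_ ?_ hlow hup
  · have : ContinuousAt (fun z => w x / (1 + ‖z - x‖) ^ N) x := by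
      refine ContinuousAt.div (by fun_prop) (by fun_prop) (by positivity)
    simpa [ContinuousAt] using this
  · have : ContinuousAt (fun z => w x * (1 + ‖z - x‖) ^ N) x := by fun_prop
    simpa [ContinuousAt] using this

theorem one_add_norm_prod_pow_le {F : Type*} [NormedAddCommGroup F] (x : E) (y : F) (N : ℕ) :
    (1 + ‖(x, y)‖) ^ N ≤ (1 + ‖x‖) ^ N * (1 + ‖y‖) ^ N := by
  rw [← mul_pow]
  refine pow_le_pow_left₀ (by positivity) ?_ N
  rw [Prod.norm_mk]
  have := max_le_add_of_nonneg (norm_nonneg x) (norm_nonneg y)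
  nlinarith [norm_nonneg x, norm_nonneg y, mul_nonneg (norm_nonneg x) (norm_nonneg y)]

end Weights

/-! ### Independence of `M^{∞,1}` of the window -/

section WindowChange

variable {ι : Type} [Fintype ι]

theorem lintegral_decay_lt_top {M : ℕ} (hM : Fintype.card ι < M) :
    ∫⁻ x : EuclideanSpace ℝ ι, ENNReal.ofReal (decay M x) < ∞ :=
  (integrable_decay hM).lintegral_lt_top

theorem enorm_ofReal {r : ℝ} (hr : 0 ≤ r) : ‖(r : ℂ)‖ₑ = ENNReal.ofReal r := by
  rw [← ofReal_norm, Complex.norm_real, Real.norm_of_nonneg hr]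

/-- A continuous function exceeds its essential supremum only on an open null set, which is empty.
This passes from the essential supremum in the norm to bounds at every point. -/
theorem enorm_le_eLpNorm_top {f : EuclideanSpace ℝ ι → ℂ} (hf : Continuous f)
    (x : EuclideanSpace ℝ ι) : ‖f x‖ₑ ≤ eLpNorm f ∞ volume := by
  by_contra! h
  have h1 := enorm_ae_le_eLpNormEssSup f (volume : Measure (EuclideanSpace ℝ ι))
  rw [eLpNorm_exponent_top] at h
  have h2 : IsOpen {y | eLpNormEssSup f volume < ‖f y‖ₑ} :=
    isOpen_lt continuous_const hf.enorm
  have h3 := h2.measure_pos volume ⟨x, h⟩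
  rw [Filter.Eventually, mem_ae_iff] at h1
  refine h3.ne' (measure_mono_null (fun y hy => ?_) h1)
  simpa using hy

/-- `sup_X |V_χ a (X, Ξ)| w (X, Ξ)` -/
def supStft (w : EuclideanSpace ℝ ι × EuclideanSpace ℝ ι → ℝ) (χ : 𝓢(EuclideanSpace ℝ ι, ℂ))
    (a : 𝓢'(EuclideanSpace ℝ ι, ℂ)) (Ξ : EuclideanSpace ℝ ι) : ℝ≥0∞ :=
  ⨆ X, ‖stft χ a X Ξ * (w (X, Ξ) : ℂ)‖ₑ

/-- The supremum is over uncountably many points, but a supremum of continuous functions is lower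
semicontinuous. -/
theorem measurable_supStft {w : EuclideanSpace ℝ ι × EuclideanSpace ℝ ι → ℝ} (hw : Continuous w)
    (χ : 𝓢(EuclideanSpace ℝ ι, ℂ)) (a : 𝓢'(EuclideanSpace ℝ ι, ℂ)) :
    Measurable (supStft w χ a) := by
  refine LowerSemicontinuous.measurable (lowerSemicontinuous_iSup fun X => ?_)
  refine Continuous.lowerSemicontinuous (Continuous.enorm ?_)
  exact ((continuous_stft χ a).comp (Continuous.prodMk_right X)).mul
    (Complex.continuous_ofReal.comp (hw.comp (Continuous.prodMk_right X)))

theorem lintegral_supStft_le {w : EuclideanSpace ℝ ι × EuclideanSpace ℝ ι → ℝ} (hw : Continuous w)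
    (χ : 𝓢(EuclideanSpace ℝ ι, ℂ)) (a : 𝓢'(EuclideanSpace ℝ ι, ℂ)) :
    ∫⁻ Ξ, supStft w χ a Ξ ≤ modNorm w ∞ 1 χ a := by
  rw [modNorm, eLpNorm_one_eq_lintegral_enorm]
  refine lintegral_mono fun Ξ => ?_
  rw [enorm_eq_self]
  refine iSup_le fun X => enorm_le_eLpNorm_top (f := fun x => stft χ a x Ξ * (w (x, Ξ) : ℂ)) ?_ X
  exact ((continuous_stft χ a).comp (Continuous.prodMk_left Ξ)).mul
    (Complex.continuous_ofReal.comp (hw.comp (Continuous.prodMk_left Ξ)))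

theorem continuous_tfShift_comp (χ : 𝓢(EuclideanSpace ℝ ι, ℂ)) {Z : Type*} [TopologicalSpace Z]
    {f g : Z → EuclideanSpace ℝ ι} (hf : Continuous f) (hg : Continuous g) :
    Continuous fun z => tfShift χ (f z) (g z) := by
  have h := (continuous_tfShift χ).comp (hf.prodMk hg)
  exact h

/-- Expand the shifted window `tfShift χ' X Ξ` into shifts of `χ` by the inversion formula and apply
`a` under the integral. This is legitimate by `clm_eq_integral`, since the coefficients decay faster
than the Schwartz seminorms of the shifts grow. -/
theorem stft_eq_integral_stft (χ γ χ' : 𝓢(EuclideanSpace ℝ ι, ℂ)) (hγ : ∫ y, γ y * χ y = 1)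
    (a : 𝓢'(EuclideanSpace ℝ ι, ℂ)) (X Ξ : EuclideanSpace ℝ ι) :
    stft χ' a X Ξ = ∫ z : EuclideanSpace ℝ ι × EuclideanSpace ℝ ι,
      (fourierConst ι : ℂ) ^ 2 * tfPair (tfShift χ' X Ξ) γ z.1 z.2 * stft χ a z.1 (-z.2) := by
  set g := tfShift χ' X Ξ with hg
  have hcs : Continuous fun z : EuclideanSpace ℝ ι × EuclideanSpace ℝ ι =>
      tfShift χ z.1 (-z.2) :=
    continuous_tfShift_comp χ continuous_fst continuous_snd.neg
  have hc : Continuous fun z : EuclideanSpace ℝ ι × EuclideanSpace ℝ ι =>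
      ((fourierConst ι : ℂ) ^ 2 * tfPair g γ z.1 z.2) • tfShift χ z.1 (-z.2) :=
    (continuous_const.mul (continuous_tfPair g γ)).smul hcs
  have hint : ∀ K, Integrable (fun z : EuclideanSpace ℝ ι × EuclideanSpace ℝ ι =>
      schwartzNorm K (((fourierConst ι : ℂ) ^ 2 * tfPair g γ z.1 z.2) •
        tfShift χ z.1 (-z.2))) := by
    intro K
    obtain ⟨K', C, hC, hK⟩ := tfPair_decay ι (K + (Fintype.card ι + 1))
    have hd := integrable_decay (ι := ι) (Nat.lt_succ_self (Fintype.card ι))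
    have hb : ∀ z : EuclideanSpace ℝ ι × EuclideanSpace ℝ ι,
        schwartzNorm K (((fourierConst ι : ℂ) ^ 2 * tfPair g γ z.1 z.2) • tfShift χ z.1 (-z.2)) ≤
        ‖(fourierConst ι : ℂ) ^ 2‖ * (C * (schwartzNorm K' g * schwartzNorm K' γ) *
          (4 ^ K * schwartzNorm K χ)) *
          (decay (Fintype.card ι + 1) z.1 * decay (Fintype.card ι + 1) z.2) := by
      intro z
      have h0 := schwartzNorm_nonneg K χ
      have h0' := schwartzNorm_nonneg K' g
      have h0'' := schwartzNorm_nonneg K' γ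
      have hd1 := (decay_pos (K + (Fintype.card ι + 1)) z.1).le
      have hd2 := (decay_pos (K + (Fintype.card ι + 1)) z.2).le
      rw [map_smul_eq_mul, norm_mul]
      have h1 := schwartzNorm_tfShift_le K χ z.1 (-z.2)
      rw [norm_neg] at h1
      calc _ ≤ ‖(fourierConst ι : ℂ) ^ 2‖ * (C * (schwartzNorm K' g * schwartzNorm K' γ) *
            (decay (K + (Fintype.card ι + 1)) z.1 * decay (K + (Fintype.card ι + 1)) z.2)) *
            (4 ^ K * ((1 + ‖z.1‖) ^ K * (1 + ‖z.2‖) ^ K) * schwartzNorm K χ) := by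
            gcongr
            exact hK g γ z.1 z.2
        _ = ‖(fourierConst ι : ℂ) ^ 2‖ * (C * (schwartzNorm K' g * schwartzNorm K' γ) *
            (4 ^ K * schwartzNorm K χ)) *
            (((1 + ‖z.1‖) ^ K * decay (K + (Fintype.card ι + 1)) z.1) *
              ((1 + ‖z.2‖) ^ K * decay (K + (Fintype.card ι + 1)) z.2)) := by ring
        _ = _ := by rw [one_add_norm_pow_mul_decay, one_add_norm_pow_mul_decay]
    have hm : Continuous fun z : EuclideanSpace ℝ ι × EuclideanSpace ℝ ι =>
        schwartzNorm K (((fourierConst ι : ℂ) ^ 2 * tfPair g γ z.1 z.2) •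
          tfShift χ z.1 (-z.2)) := Continuous.comp (continuous_schwartzNorm K) hc
    refine Integrable.mono' ((hd.mul_prod hd).const_mul (‖(fourierConst ι : ℂ) ^ 2‖ *
      (C * (schwartzNorm K' g * schwartzNorm K' γ) * (4 ^ K * schwartzNorm K χ))))
      hm.aestronglyMeasurable (Filter.Eventually.of_forall fun z => ?_)
    rw [Real.norm_of_nonneg (schwartzNorm_nonneg _ _)]
    exact hb z
  have h := clm_eq_integral (μ := volume) (a : 𝓢(EuclideanSpace ℝ ι, ℂ) →L[ℂ] ℂ) hc hint
    (tfPair_inversion g γ χ hγ)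
  have h' : a g = ∫ z : EuclideanSpace ℝ ι × EuclideanSpace ℝ ι,
      a (((fourierConst ι : ℂ) ^ 2 * tfPair g γ z.1 z.2) • tfShift χ z.1 (-z.2)) := h
  rw [stft, ← hg, h', ← integral_const_mul]
  congr 1
  funext z
  rw [map_smul, stft, smul_eq_mul]
  ring

/-- Change of windows in `M^{∞,1}`. -/
theorem exists_stft_bound {N : ℕ} {w : EuclideanSpace ℝ ι × EuclideanSpace ℝ ι → ℝ}
    (hw : IsContModerate N w) (χ : 𝓢(EuclideanSpace ℝ ι, ℂ)) (hχ : χ ≠ 0)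
    (χ' : 𝓢(EuclideanSpace ℝ ι, ℂ)) : ∃ C : ℝ≥0∞, C < ∞ ∧ ∀ a : 𝓢'(EuclideanSpace ℝ ι, ℂ),
      ∃ A : EuclideanSpace ℝ ι → ℝ≥0∞, Measurable A ∧
        (∀ X Ξ, ‖stft χ' a X Ξ‖ₑ * ENNReal.ofReal (w (X, Ξ)) ≤ A Ξ) ∧
        ∫⁻ Ξ, A Ξ ≤ C * modNorm w ∞ 1 χ a := by
  obtain ⟨γ, hγ⟩ := exists_dual_window χ hχ
  simp only [mul_comm (χ _)] at hγ
  set M := Fintype.card ι + 1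
  obtain ⟨K, C, hC, hK⟩ := tfPair_decay ι (N + M)
  set I : ℝ≥0∞ := ∫⁻ x : EuclideanSpace ℝ ι, ENNReal.ofReal (decay M x) with hI
  have hIlt : I < ∞ := lintegral_decay_lt_top (Nat.lt_succ_self _)
  set c : ℝ := ‖(fourierConst ι : ℂ) ^ 2‖ * (C * (schwartzNorm K χ' * schwartzNorm K γ)) with hc
  have hc0 : 0 ≤ c := by
    have h0 := schwartzNorm_nonneg K χ'
    have h0' := schwartzNorm_nonneg K γ
    positivity
  refine ⟨ENNReal.ofReal c * I * I, ENNReal.mul_lt_top (ENNReal.mul_lt_top ENNReal.ofReal_lt_top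
    hIlt) hIlt, fun a => ?_⟩
  set A₀ := supStft w χ a
  have hA₀ : Measurable A₀ := measurable_supStft hw.continuous χ a
  have hker : Measurable fun p : EuclideanSpace ℝ ι × EuclideanSpace ℝ ι =>
      A₀ (-p.2) * ENNReal.ofReal (decay M (p.1 + p.2)) :=
    (hA₀.comp measurable_snd.neg).mul
      (((continuous_decay M).comp (continuous_fst.add continuous_snd)).measurable.ennreal_ofReal)
  -- The reproducing formula bounds the new transform by the old one convolved with a decaying
  -- kernel. The supremum in position factors out of the position integral, whose value is `I`; in
  -- frequency a convolution with an integrable function remains.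
  refine ⟨fun Ξ => ENNReal.ofReal c * I * ∫⁻ η, A₀ (-η) * ENNReal.ofReal (decay M (Ξ + η)),
    (hker.lintegral_prod_right').const_mul _, fun X Ξ => ?_, ?_⟩
  · have hpt : ∀ z : EuclideanSpace ℝ ι × EuclideanSpace ℝ ι,
        ‖(fourierConst ι : ℂ) ^ 2 * tfPair (tfShift χ' X Ξ) γ z.1 z.2 * stft χ a z.1 (-z.2)‖ₑ *
          ENNReal.ofReal (w (X, Ξ)) ≤ ENNReal.ofReal c * (ENNReal.ofReal (decay M (z.1 - X)) *
            (A₀ (-z.2) * ENNReal.ofReal (decay M (Ξ + z.2)))) := by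
      intro z
      have h1 : ‖stft χ a z.1 (-z.2) * (w (z.1, -z.2) : ℂ)‖ₑ ≤ A₀ (-z.2) :=
        le_iSup (fun X => ‖stft χ a X (-z.2) * (w (X, -z.2) : ℂ)‖ₑ) z.1
      have h2 : ‖(fourierConst ι : ℂ) ^ 2 * tfPair (tfShift χ' X Ξ) γ z.1 z.2‖ * w (X, Ξ) ≤
          c * (decay M (z.1 - X) * decay M (Ξ + z.2)) * w (z.1, -z.2) := by
        have hw1 := hw.le_sub (X, Ξ) (z.1, -z.2)
        have hw2 := one_add_norm_prod_pow_le (z.1 - X) (Ξ + z.2) N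
        rw [Prod.mk_sub_mk, sub_neg_eq_add] at hw1
        have hw3 : (1 + ‖(X - z.1, Ξ + z.2)‖) ^ N ≤ (1 + ‖z.1 - X‖) ^ N * (1 + ‖Ξ + z.2‖) ^ N := by
          rwa [Prod.norm_mk, norm_sub_rev, ← Prod.norm_mk]
        have h3 := hK χ' γ (z.1 - X) (Ξ + z.2)
        have hp := hw.pos (z.1, -z.2)
        have hd1 := (decay_pos (N + M) (z.1 - X)).le
        have hd2 := (decay_pos (N + M) (Ξ + z.2)).le
        have h0 := schwartzNorm_nonneg K χ'
        have h0' := schwartzNorm_nonneg K γ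
        rw [norm_mul, norm_tfPair_tfShift]
        calc _ ≤ ‖(fourierConst ι : ℂ) ^ 2‖ * (C * (schwartzNorm K χ' * schwartzNorm K γ) *
              (decay (N + M) (z.1 - X) * decay (N + M) (Ξ + z.2))) *
              (w (z.1, -z.2) * ((1 + ‖z.1 - X‖) ^ N * (1 + ‖Ξ + z.2‖) ^ N)) := by
              gcongr
              · exact (hw.pos _).le
              · exact hw1.trans (by gcongr)
          _ = c * (((1 + ‖z.1 - X‖) ^ N * decay (N + M) (z.1 - X)) *
              ((1 + ‖Ξ + z.2‖) ^ N * decay (N + M) (Ξ + z.2))) * w (z.1, -z.2) := by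
              rw [hc]; ring
          _ = _ := by rw [one_add_norm_pow_mul_decay, one_add_norm_pow_mul_decay]
      have e1 : ∀ (u : ℂ) (r : ℝ), 0 ≤ r → ‖u‖ₑ * ENNReal.ofReal r = ENNReal.ofReal (‖u‖ * r) :=
        fun u r _ => by rw [ENNReal.ofReal_mul (norm_nonneg _), ofReal_norm]
      rw [enorm_mul, mul_right_comm, e1 _ _ (hw.pos _).le]
      refine (mul_le_mul_left (ENNReal.ofReal_le_ofReal h2) _).trans ?_
      have hd1 := (decay_pos M (z.1 - X)).le
      have hd2 := (decay_pos M (Ξ + z.2)).le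
      rw [ENNReal.ofReal_mul (by positivity), ENNReal.ofReal_mul hc0, ENNReal.ofReal_mul hd1]
      rw [enorm_mul, enorm_ofReal (hw.pos _).le] at h1
      calc _ = ENNReal.ofReal c * (ENNReal.ofReal (decay M (z.1 - X)) *
            ((‖stft χ a z.1 (-z.2)‖ₑ * ENNReal.ofReal (w (z.1, -z.2))) *
              ENNReal.ofReal (decay M (Ξ + z.2)))) := by ring
        _ ≤ _ := by gcongr
    rw [stft_eq_integral_stft χ γ χ' hγ]
    refine (mul_le_mul_left (enorm_integral_le_lintegral_enorm _) _).trans ?_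
    rw [← lintegral_mul_const' _ _ ENNReal.ofReal_ne_top]
    refine (lintegral_mono hpt).trans ?_
    have hm1 : Measurable fun u => ENNReal.ofReal (decay M (u - X)) :=
      ((continuous_decay M).comp (continuous_id.sub continuous_const)).measurable.ennreal_ofReal
    have hm2 : Measurable fun η => A₀ (-η) * ENNReal.ofReal (decay M (Ξ + η)) := by
      have h := hker.comp (measurable_prodMk_left (x := Ξ))
      exact h
    rw [lintegral_const_mul' _ _ ENNReal.ofReal_ne_top, Measure.volume_eq_prod,
      lintegral_prod_mul hm1.aemeasurable hm2.aemeasurable,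
      lintegral_sub_right_eq_self (fun u => ENNReal.ofReal (decay M u)) X]
    exact (mul_assoc _ _ _).ge
  · rw [lintegral_const_mul _ hker.lintegral_prod_right', lintegral_lintegral_swap hker.aemeasurable]
    have : ∀ η, ∫⁻ Ξ, A₀ (-η) * ENNReal.ofReal (decay M (Ξ + η)) = A₀ (-η) * I := by
      intro η
      have hm : Measurable fun Ξ => ENNReal.ofReal (decay M (Ξ + η)) :=
        ((continuous_decay M).comp (continuous_id.add continuous_const)).measurable.ennreal_ofReal
      rw [lintegral_const_mul _ hm,
        lintegral_add_right_eq_self (fun u => ENNReal.ofReal (decay M u)) η]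
    simp only [this]
    rw [lintegral_mul_const' _ _ hIlt.ne, lintegral_neg_eq_self (fun η => A₀ η)]
    calc _ = ENNReal.ofReal c * I * I * ∫⁻ η, A₀ η := by ring
      _ ≤ _ := by gcongr; exact lintegral_supStft_le hw.continuous χ a

end WindowChange

/-! ### Multipliers of a weighted Fourier algebra, uniform in the base point -/

section Multiplier

variable {ι : Type} [Fintype ι]

@[fun_prop]
theorem measurable_expInner_comp {Z : Type*} [MeasurableSpace Z] {f g : Z → EuclideanSpace ℝ ι}
    (hf : Measurable f) (hg : Measurable g) : Measurable fun z => expInner (f z) (g z) := by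
  have h := (continuous_expInner (ι := ι)).measurable.comp (hf.prodMk hg)
  exact h

theorem continuous_and_zero_integrable {h : EuclideanSpace ℝ ι → ℂ} (hc : Continuous h)
    (h0 : ∀ Y, 1 < ‖Y‖ → h Y = 0) : Integrable h := by
  refine hc.integrable_of_hasCompactSupport (HasCompactSupport.of_support_subset_isCompact
    (isCompact_closedBall (0 : EuclideanSpace ℝ ι) 1) fun Y hY => ?_)
  by_contra hn
  exact hY (h0 Y (by simpa using hn))

/-- Multiplication by the functions `ψ Z` increases, uniformly in `Z`, the weighted `L¹` norm of a
majorant of the Fourier transform of functions supported in the unit ball at most by the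
factor `B`. -/
structure IsMultiplier (V : EuclideanSpace ℝ ι → ℝ≥0∞)
    (ψ : EuclideanSpace ℝ ι → EuclideanSpace ℝ ι → ℂ) (B : ℝ≥0∞) : Prop where
  continuous : ∀ Z, Continuous (ψ Z)
  exists_majorant : ∀ β₀ : EuclideanSpace ℝ ι → ℝ≥0∞, Measurable β₀ →
    ∃ β : EuclideanSpace ℝ ι → ℝ≥0∞, Measurable β ∧
      ∫⁻ Θ, β Θ * V Θ ≤ B * ∫⁻ Θ, β₀ Θ * V Θ ∧
      ∀ (Z : EuclideanSpace ℝ ι) (h : EuclideanSpace ℝ ι → ℂ), Continuous h →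
        (∀ Y, 1 < ‖Y‖ → h Y = 0) → (∀ Θ, ‖fourInt h Θ‖ₑ ≤ β₀ Θ) →
        ∀ Θ, ‖fourInt (fun Y => ψ Z Y * h Y) Θ‖ₑ ≤ β Θ

variable {V : EuclideanSpace ℝ ι → ℝ≥0∞}
  {ψ ψ' : EuclideanSpace ℝ ι → EuclideanSpace ℝ ι → ℂ} {B B' : ℝ≥0∞}

theorem IsMultiplier.mono (h : IsMultiplier V ψ B) (hB : B ≤ B') : IsMultiplier V ψ B' := by
  refine ⟨h.continuous, fun β₀ hβ₀ => ?_⟩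
  obtain ⟨β, hβ, hi, hh⟩ := h.exists_majorant β₀ hβ₀
  exact ⟨β, hβ, hi.trans (by gcongr), hh⟩

theorem IsMultiplier.zero : IsMultiplier V (fun _ _ => 0) 0 :=
  ⟨fun _ => continuous_const, fun β₀ _ => ⟨0, measurable_zero, by simp, fun Z h _ _ _ Θ => by
    simp [fourInt]⟩⟩

theorem IsMultiplier.mul (h : IsMultiplier V ψ B) (h' : IsMultiplier V ψ' B') :
    IsMultiplier V (fun Z Y => ψ Z Y * ψ' Z Y) (B * B') := by
  refine ⟨fun Z => (h.continuous Z).mul (h'.continuous Z), fun β₀ hβ₀ => ?_⟩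
  obtain ⟨β₁, hβ₁, hi₁, hh₁⟩ := h'.exists_majorant β₀ hβ₀
  obtain ⟨β, hβ, hi, hh⟩ := h.exists_majorant β₁ hβ₁
  refine ⟨β, hβ, hi.trans (by rw [mul_assoc]; gcongr), fun Z g hg hg0 hgβ Θ => ?_⟩
  have := hh Z (fun Y => ψ' Z Y * g Y) ((h'.continuous Z).mul hg)
    (fun Y hY => by simp only [hg0 Y hY, mul_zero]) (hh₁ Z g hg hg0 hgβ) Θ
  simpa only [mul_assoc] using this

theorem IsMultiplier.add (hV : Measurable V) (h : IsMultiplier V ψ B)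
    (h' : IsMultiplier V ψ' B') : IsMultiplier V (fun Z Y => ψ Z Y + ψ' Z Y) (B + B') := by
  refine ⟨fun Z => (h.continuous Z).add (h'.continuous Z), fun β₀ hβ₀ => ?_⟩
  obtain ⟨β₁, hβ₁, hi₁, hh₁⟩ := h'.exists_majorant β₀ hβ₀
  obtain ⟨β, hβ, hi, hh⟩ := h.exists_majorant β₀ hβ₀
  refine ⟨fun Θ => β Θ + β₁ Θ, hβ.add hβ₁, ?_, fun Z g hg hg0 hgβ Θ => ?_⟩
  · simp only [add_mul]
    rw [lintegral_add_left (by fun_prop)]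
    gcongr
  · have hint : ∀ (F : EuclideanSpace ℝ ι → ℂ), Continuous F →
        Integrable fun Y => F Y * g Y * expInner Θ Y := fun F hF =>
      continuous_and_zero_integrable ((hF.mul hg).mul (by fun_prop))
        fun Y hY => by simp only [hg0 Y hY, mul_zero, zero_mul]
    have : fourInt (fun Y => (ψ Z Y + ψ' Z Y) * g Y) Θ =
        fourInt (fun Y => ψ Z Y * g Y) Θ + fourInt (fun Y => ψ' Z Y * g Y) Θ := by
      simp only [fourInt, add_mul]
      exact integral_add (hint _ (h.continuous Z)) (hint _ (h'.continuous Z))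
    rw [this]
    exact (enorm_add_le _ _).trans (add_le_add (hh Z g hg hg0 hgβ Θ) (hh₁ Z g hg hg0 hgβ Θ))

theorem IsMultiplier.sum (hV : Measurable V) {α : Type*} (s : Finset α)
    {ψ : α → EuclideanSpace ℝ ι → EuclideanSpace ℝ ι → ℂ} {B : α → ℝ≥0∞}
    (h : ∀ i ∈ s, IsMultiplier V (ψ i) (B i)) :
    IsMultiplier V (fun Z Y => ∑ i ∈ s, ψ i Z Y) (∑ i ∈ s, B i) := by
  induction s using Finset.cons_induction with
  | empty => simpa using IsMultiplier.zero
  | cons a s ha ih =>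
    simp only [Finset.sum_cons]
    exact (h a (Finset.mem_cons_self a s)).add hV
      (ih fun i hi => h i (Finset.mem_cons_of_mem hi))

/-- Exponential series: `ψ ^ k` is controlled by the `k`-th iterate of the choice `R` of majorants,
with bound `B ^ k`, and the sum with weights `1 / k!` gives `exp B`. The choice `R` need not be
linear, as only its iterates on `β₀` occur. -/
theorem IsMultiplier.exp (hV : Measurable V) (h : IsMultiplier V ψ B) (hB : B ≠ ∞) :
    IsMultiplier V (fun Z Y => Complex.exp (ψ Z Y)) (ENNReal.ofReal (Real.exp B.toReal)) := by
  refine ⟨fun Z => (h.continuous Z).cexp, fun β₀ hβ₀ => ?_⟩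
  choose! R hRm hRi hR using h.exists_majorant
  set b : ℕ → EuclideanSpace ℝ ι → ℝ≥0∞ := fun k => R^[k] β₀ with hb
  have hbs : ∀ k, b (k + 1) = R (b k) := fun k => Function.iterate_succ_apply' _ _ _
  have hbm : ∀ k, Measurable (b k) := by
    intro k
    induction k with
    | zero => exact hβ₀
    | succ k ih => rw [hbs]; exact hRm _ ih
  have hbi : ∀ k, ∫⁻ Θ, b k Θ * V Θ ≤ B ^ k * ∫⁻ Θ, β₀ Θ * V Θ := by
    intro k
    induction k with
    | zero => simp [hb]
    | succ k ih =>
      rw [hbs, pow_succ', mul_assoc]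
      exact (hRi _ (hbm k)).trans (by gcongr)
  refine ⟨fun Θ => ∑' k : ℕ, ENNReal.ofReal ((k.factorial : ℝ)⁻¹) * b k Θ,
    Measurable.tsum fun k => (hbm k).const_mul _, ?_, fun Z g hg hg0 hgβ Θ => ?_⟩
  · simp only [← ENNReal.tsum_mul_right]
    rw [lintegral_tsum fun k => (by have := hbm k; fun_prop)]
    have h1 : ∀ k : ℕ, ∫⁻ Θ, ENNReal.ofReal ((k.factorial : ℝ)⁻¹) * b k Θ * V Θ ≤
        ENNReal.ofReal (B.toReal ^ k / k.factorial) * ∫⁻ Θ, β₀ Θ * V Θ := by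
      intro k
      simp only [mul_assoc]
      rw [lintegral_const_mul' _ _ ENNReal.ofReal_ne_top, div_eq_inv_mul,
        ENNReal.ofReal_mul (by positivity), mul_assoc, ENNReal.ofReal_pow ENNReal.toReal_nonneg,
        ENNReal.ofReal_toReal hB]
      gcongr
      exact hbi k
    refine (ENNReal.tsum_le_tsum h1).trans ?_
    rw [ENNReal.tsum_mul_right]
    gcongr
    have h2 := NormedSpace.expSeries_div_hasSum_exp B.toReal
    rw [← Real.exp_eq_exp_ℝ] at h2
    rw [← h2.tsum_eq, ENNReal.ofReal_tsum_of_nonneg (fun k => by positivity) h2.summable]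
  · have hk : ∀ k, ∀ Θ, ‖fourInt (fun Y => ψ Z Y ^ k * g Y) Θ‖ₑ ≤ b k Θ := by
      intro k
      induction k with
      | zero => simpa [hb] using hgβ
      | succ k ih =>
        rw [hbs]
        have := hR (b k) (hbm k) Z (fun Y => ψ Z Y ^ k * g Y) (((h.continuous Z).pow k).mul hg)
          (fun Y hY => by simp only [hg0 Y hY, mul_zero]) ih
        simpa only [pow_succ', mul_assoc] using this
    -- Only the unit ball matters, as `g` vanishes outside. There `ψ Z` is bounded, which justifies
    -- integrating the series term by term; `M` may depend on `Z`, since it does not enter the final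
    -- bound.
    obtain ⟨M, hM⟩ := (isCompact_closedBall (0 : EuclideanSpace ℝ ι) 1).exists_bound_of_continuousOn
      (h.continuous Z).continuousOn
    have hM0 : 0 ≤ M := (norm_nonneg _).trans (hM 0 (by simp))
    have hint := continuous_and_zero_integrable hg hg0
    set F : ℕ → EuclideanSpace ℝ ι → ℂ := fun k Y =>
      ((k.factorial : ℝ)⁻¹ : ℂ) * (ψ Z Y ^ k * g Y * expInner Θ Y) with hF
    have hFn : ∀ k Y, ‖F k Y‖ ≤ M ^ k / k.factorial * ‖g Y‖ := by
      intro k Y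
      by_cases hY : 1 < ‖Y‖
      · simp [hF, hg0 Y hY]
      · have hY' := hM Y (by simpa using not_lt.1 hY)
        simp only [hF, norm_mul, norm_pow, norm_expInner, mul_one]
        rw [div_eq_inv_mul, mul_assoc]
        have : ‖((k.factorial : ℝ)⁻¹ : ℂ)‖ = (k.factorial : ℝ)⁻¹ := by simp
        rw [this]
        gcongr
    have hFint : ∀ k, Integrable (F k) := fun k =>
      (hint.norm.const_mul (M ^ k / k.factorial)).mono'
        (Continuous.aestronglyMeasurable (by
          have := h.continuous Z
          simp only [hF]
          fun_prop)) (Filter.Eventually.of_forall (hFn k))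
    have hsum : Summable fun k => ∫ Y, ‖F k Y‖ := by
      refine Summable.of_nonneg_of_le (fun k => integral_nonneg fun Y => norm_nonneg _)
        (fun k => integral_mono (hFint k).norm (hint.norm.const_mul _) (hFn k)) ?_
      simp only [integral_const_mul]
      exact (Real.summable_pow_div_factorial M).mul_right _
    have h3 := hasSum_integral_of_summable_integral_norm hFint hsum
    have h4 : ∀ Y, ∑' k, F k Y = Complex.exp (ψ Z Y) * g Y * expInner Θ Y := by
      intro Y
      have h5 := NormedSpace.expSeries_div_hasSum_exp (ψ Z Y)
      rw [← Complex.exp_eq_exp_ℂ] at h5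
      rw [mul_assoc, ← h5.tsum_eq, ← tsum_mul_right]
      congr 1
      funext k
      simp only [hF]
      push_cast
      ring
    have h6 : fourInt (fun Y => Complex.exp (ψ Z Y) * g Y) Θ = ∑' k, ∫ Y, F k Y := by
      rw [h3.tsum_eq, fourInt]
      simp only [h4]
    rw [h6]
    refine enorm_tsum_le_tsum_enorm.trans (ENNReal.tsum_le_tsum fun k => ?_)
    simp only [hF]
    rw [integral_const_mul, enorm_mul]
    have : ‖((k.factorial : ℝ)⁻¹ : ℂ)‖ₑ = ENNReal.ofReal ((k.factorial : ℝ)⁻¹) := by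
      rw [← Complex.ofReal_inv, enorm_ofReal (by positivity)]
    rw [this]
    gcongr
    exact hk k Θ

/-- Superpositions of characters are multipliers. -/
theorem isMultiplier_of_integral {P : Type*} [MeasurableSpace P] {μ : Measure P} [SFinite μ]
    (hV : Measurable V) {c : ℝ≥0∞} (hsub : ∀ x y, V (x + y) ≤ c * V x * V y)
    (hψ : ∀ Z, Continuous (ψ Z)) (b : EuclideanSpace ℝ ι → P → ℂ)
    (hb : ∀ Z, AEStronglyMeasurable (b Z) μ) (r : P → ℝ≥0∞) (hr : Measurable r)
    (hbr : ∀ Z p, ‖b Z p‖ₑ ≤ r p) (hri : ∫⁻ p, r p ∂μ < ∞) (ν : P → EuclideanSpace ℝ ι)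
    (hν : Measurable ν)
    (hrep : ∀ Z Y, ‖Y‖ ≤ 1 → ψ Z Y = ∫ p, b Z p * expInner (-ν p) Y ∂μ) :
    IsMultiplier V ψ (c * ∫⁻ p, r p * V (ν p) ∂μ) := by
  refine ⟨hψ, fun β₀ hβ₀ => ?_⟩
  have hm : Measurable fun q : EuclideanSpace ℝ ι × P => r q.2 * β₀ (q.1 - ν q.2) :=
    (hr.comp measurable_snd).mul (hβ₀.comp (measurable_fst.sub (hν.comp measurable_snd)))
  -- Multiplying by the character of index `-ν p` translates the Fourier transform by `ν p`, so the
  -- majorant is an average of translates of `β₀`. Submultiplicativity of `V` prices each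
  -- translation at `V (ν p)`.
  refine ⟨fun Θ => ∫⁻ p, r p * β₀ (Θ - ν p) ∂μ, hm.lintegral_prod_right', ?_,
    fun Z h hh hh0 hhβ Θ => ?_⟩
  · have hm2 : Measurable fun q : EuclideanSpace ℝ ι × P => r q.2 * β₀ (q.1 - ν q.2) * V q.1 :=
      hm.mul (hV.comp measurable_fst)
    calc ∫⁻ Θ, (∫⁻ p, r p * β₀ (Θ - ν p) ∂μ) * V Θ
        = ∫⁻ Θ, ∫⁻ p, r p * β₀ (Θ - ν p) * V Θ ∂μ := by
          refine lintegral_congr fun Θ => ?_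
          rw [lintegral_mul_const]
          exact hr.mul (hβ₀.comp (measurable_const.sub hν))
      _ = ∫⁻ p, (∫⁻ Θ, r p * β₀ (Θ - ν p) * V Θ) ∂μ :=
          lintegral_lintegral_swap hm2.aemeasurable
      _ ≤ ∫⁻ p, (c * (r p * V (ν p)) * ∫⁻ Θ, β₀ Θ * V Θ) ∂μ := by
          refine lintegral_mono fun p => ?_
          rw [← lintegral_sub_right_eq_self (fun Θ => β₀ Θ * V Θ) (ν p),
            ← lintegral_const_mul _ (by fun_prop)]
          refine lintegral_mono fun Θ => ?_
          have := hsub (Θ - ν p) (ν p)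
          rw [sub_add_cancel] at this
          calc r p * β₀ (Θ - ν p) * V Θ ≤
              r p * β₀ (Θ - ν p) * (c * V (Θ - ν p) * V (ν p)) := by gcongr
            _ = _ := by ring
      _ = _ := by
          rw [lintegral_mul_const _ (by fun_prop), lintegral_const_mul _ (by fun_prop)]
  · have hbi : Integrable (b Z) μ :=
      ⟨hb Z, (lintegral_mono (hbr Z)).trans_lt hri⟩
    have hint : Integrable (Function.uncurry fun (Y : EuclideanSpace ℝ ι) (p : P) =>
        h Y * b Z p * (expInner (-ν p) Y * expInner Θ Y)) (volume.prod μ) := by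
      refine Integrable.mul_bdd (c := 1)
        ((continuous_and_zero_integrable hh hh0).mul_prod hbi) ?_
        (Filter.Eventually.of_forall fun q => ?_)
      · have h1 : Measurable fun q : EuclideanSpace ℝ ι × P => expInner (-ν q.2) q.1 :=
          measurable_expInner_comp (hν.comp measurable_snd).neg measurable_fst
        have h2 : Measurable fun q : EuclideanSpace ℝ ι × P => expInner Θ q.1 :=
          measurable_expInner_comp measurable_const measurable_fst
        exact (h1.mul h2).aestronglyMeasurable
      · rw [norm_mul, norm_expInner, norm_expInner, one_mul]
    have key : fourInt (fun Y => ψ Z Y * h Y) Θ = ∫ p, b Z p * fourInt h (Θ - ν p) ∂μ := by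
      calc fourInt (fun Y => ψ Z Y * h Y) Θ
          = ∫ Y, ∫ p, h Y * b Z p * (expInner (-ν p) Y * expInner Θ Y) ∂μ := by
            rw [fourInt]
            congr 1
            funext Y
            by_cases hY : 1 < ‖Y‖
            · simp [hh0 Y hY]
            · rw [hrep Z Y (not_lt.1 hY), mul_assoc, ← integral_mul_const]
              congr 1
              funext p
              ring
        _ = ∫ p, (∫ Y, h Y * b Z p * (expInner (-ν p) Y * expInner Θ Y)) ∂μ :=
            integral_integral_swap hint
        _ = _ := by
            congr 1
            funext p
            rw [fourInt, ← integral_const_mul]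
            congr 1
            funext Y
            rw [sub_eq_add_neg, expInner_add_left]
            ring
    rw [key]
    refine (enorm_integral_le_lintegral_enorm _).trans (lintegral_mono fun p => ?_)
    rw [enorm_mul]
    gcongr
    · exact hbr Z p
    · exact hhβ _

end Multiplier

/-! ### From `M^{∞,1}` to multipliers -/

section Phase

variable {ι : Type} [Fintype ι]

theorem modNorm_le_mul {ω w : EuclideanSpace ℝ ι × EuclideanSpace ℝ ι → ℝ} {c : ℝ}
    (h : ∀ z, |ω z| ≤ c * |w z|) (p q : ℝ≥0∞)
    (χ : 𝓢(EuclideanSpace ℝ ι, ℂ)) (f : 𝓢'(EuclideanSpace ℝ ι, ℂ)) :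
    modNorm ω p q χ f ≤ ENNReal.ofReal c * modNorm w p q χ f := by
  have hi : ∀ ξ, eLpNorm (fun x => stft χ f x ξ * (ω (x, ξ) : ℂ)) p volume ≤
      ENNReal.ofReal c * eLpNorm (fun x => stft χ f x ξ * (w (x, ξ) : ℂ)) p volume := fun ξ => by
    refine eLpNorm_le_mul_eLpNorm_of_ae_le_mul (c := c) (Filter.Eventually.of_forall fun x => ?_) p
    have h1 : ‖(ω (x, ξ) : ℂ)‖ ≤ c * ‖(w (x, ξ) : ℂ)‖ := by
      simpa only [Complex.norm_real, Real.norm_eq_abs] using h (x, ξ)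
    rw [norm_mul, norm_mul, mul_left_comm]
    gcongr
  have ho := eLpNorm_le_mul_eLpNorm_of_ae_le_mul' (μ := volume) (c := c.toNNReal)
    (f := fun ξ => eLpNorm (fun x => stft χ f x ξ * (ω (x, ξ) : ℂ)) p volume)
    (g := fun ξ => eLpNorm (fun x => stft χ f x ξ * (w (x, ξ) : ℂ)) p volume)
    (Filter.Eventually.of_forall hi) q
  exact ho

/-- Multipliers are tested only on functions supported in the unit ball, where this cutoff is
invisible. -/
theorem exists_cutoff (ι : Type) [Fintype ι] : ∃ ρ : 𝓢(EuclideanSpace ℝ ι, ℂ),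
    HasCompactSupport ρ ∧ ∀ Y, ‖Y‖ ≤ 1 → ρ Y = 1 := by
  let f : ContDiffBump (0 : EuclideanSpace ℝ ι) := ⟨1, 2, one_pos, one_lt_two⟩
  have h1 : HasCompactSupport (fun Y => ((f Y : ℝ) : ℂ)) :=
    HasCompactSupport.comp_left (g := Complex.ofReal) f.hasCompactSupport Complex.ofReal_zero
  have h2 : ContDiff ℝ (⊤ : ℕ∞) (fun Y => ((f Y : ℝ) : ℂ)) :=
    Complex.ofRealCLM.contDiff.comp f.contDiff
  refine ⟨h1.toSchwartzMap h2, h1, fun Y hY => ?_⟩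
  have : f Y = 1 := f.one_of_mem_closedBall (by simpa using hY)
  change ((f Y : ℝ) : ℂ) = 1
  rw [this, Complex.ofReal_one]

variable {N : ℕ} {v : EuclideanSpace ℝ ι → ℝ} {c : ℝ}

theorem ofReal_submultiplicative (hv : IsContModerate N v) (hc : 0 ≤ c)
    (hsub : ∀ x y, v (x + y) ≤ c * v x * v y) (x y : EuclideanSpace ℝ ι) :
    ENNReal.ofReal (v (x + y)) ≤
      ENNReal.ofReal c * ENNReal.ofReal (v x) * ENNReal.ofReal (v y) := by
  have hx := hv.pos x
  rw [← ENNReal.ofReal_mul hc, ← ENNReal.ofReal_mul (by positivity)]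
  exact ENNReal.ofReal_le_ofReal (hsub x y)

theorem measurable_ofReal_weight (hv : IsContModerate N v) :
    Measurable fun Θ => ENNReal.ofReal (v Θ) := hv.continuous.measurable.ennreal_ofReal

theorem lintegral_decay_mul_weight_lt_top (hv : IsContModerate N v) {M : ℕ}
    (hM : Fintype.card ι < M) :
    ∫⁻ Θ, ENNReal.ofReal (decay (N + M) Θ) * ENNReal.ofReal (v Θ) < ∞ := by
  have h : ∀ Θ, ENNReal.ofReal (decay (N + M) Θ) * ENNReal.ofReal (v Θ) ≤
      ENNReal.ofReal (v 0) * ENNReal.ofReal (decay M Θ) := by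
    intro Θ
    have h0 := (hv.pos 0).le
    rw [← ENNReal.ofReal_mul (decay_pos _ _).le, ← ENNReal.ofReal_mul h0]
    refine ENNReal.ofReal_le_ofReal ?_
    have h1 := hv.add_le 0 Θ
    rw [zero_add] at h1
    have h2 := (decay_pos (N + M) Θ).le
    rw [← one_add_norm_pow_mul_decay M N Θ]
    calc _ ≤ decay (N + M) Θ * (v 0 * (1 + ‖Θ‖) ^ N) := by gcongr
      _ = _ := by ring
  refine (lintegral_mono h).trans_lt ?_
  rw [lintegral_const_mul' _ _ ENNReal.ofReal_ne_top]
  exact ENNReal.mul_lt_top ENNReal.ofReal_lt_top (lintegral_decay_lt_top hM)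

/-- After multiplication by a cutoff equal to one on the unit ball, `s` becomes a Schwartz function.
Its Fourier inversion formula is a superposition of characters with coefficients integrable against
the moderate weight. Applied to the monomials `Y_i Y_j`. -/
theorem exists_isMultiplier_smooth (hv : IsContModerate N v) (hc : 0 ≤ c)
    (hsub : ∀ x y, v (x + y) ≤ c * v x * v y) {s : EuclideanSpace ℝ ι → ℂ}
    (hs : ContDiff ℝ (⊤ : ℕ∞) s) :
    ∃ B : ℝ≥0∞, B < ∞ ∧ IsMultiplier (fun Θ => ENNReal.ofReal (v Θ)) (fun _ => s) B := by
  obtain ⟨ρ, hρ, hρ1⟩ := exists_cutoff ι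
  have hq0 : HasCompactSupport fun Y => ρ Y * s Y := hρ.mul_right
  set q : 𝓢(EuclideanSpace ℝ ι, ℂ) := hq0.toSchwartzMap ((ρ.smooth _).mul hs) with hq
  have hqa : ∀ Y, q Y = ρ Y * s Y := fun Y => rfl
  have hFc : Continuous (fourInt q) := continuous_fourInt q.integrable
  obtain ⟨K, C, hC, hK⟩ := fourInt_decay ι (N + (Fintype.card ι + 1))
  have hlt : ∫⁻ Θ, ‖(fourierConst ι : ℂ) ^ 2 * fourInt q Θ‖ₑ * ENNReal.ofReal (v Θ) < ∞ := by
    have h1 : ∀ Θ, ‖(fourierConst ι : ℂ) ^ 2 * fourInt q Θ‖ₑ * ENNReal.ofReal (v Θ) ≤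
        ‖(fourierConst ι : ℂ) ^ 2‖ₑ * ENNReal.ofReal (C * schwartzNorm K q) *
        (ENNReal.ofReal (decay (N + (Fintype.card ι + 1)) Θ) * ENNReal.ofReal (v Θ)) := by
      intro Θ
      have h0 := schwartzNorm_nonneg K q
      have h2 : ‖fourInt q Θ‖ₑ ≤ ENNReal.ofReal (C * schwartzNorm K q) *
          ENNReal.ofReal (decay (N + (Fintype.card ι + 1)) Θ) := by
        rw [← ofReal_norm, ← ENNReal.ofReal_mul (by positivity)]
        exact ENNReal.ofReal_le_ofReal (hK q Θ)
      rw [enorm_mul]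
      calc _ ≤ ‖(fourierConst ι : ℂ) ^ 2‖ₑ * (ENNReal.ofReal (C * schwartzNorm K q) *
            ENNReal.ofReal (decay (N + (Fintype.card ι + 1)) Θ)) * ENNReal.ofReal (v Θ) := by
            gcongr
        _ = _ := by ring
    refine (lintegral_mono h1).trans_lt ?_
    rw [lintegral_const_mul' _ _ (ENNReal.mul_ne_top enorm_ne_top ENNReal.ofReal_ne_top)]
    exact ENNReal.mul_lt_top (ENNReal.mul_lt_top enorm_lt_top ENNReal.ofReal_lt_top)
      (lintegral_decay_mul_weight_lt_top hv (Nat.lt_succ_self _))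
  have hfi : ∫⁻ η, ‖(fourierConst ι : ℂ) ^ 2 * fourInt q η‖ₑ < ∞ :=
    ((integrable_fourInt q).const_mul _).2
  refine ⟨ENNReal.ofReal c * ∫⁻ Θ, ‖(fourierConst ι : ℂ) ^ 2 * fourInt q Θ‖ₑ *
    ENNReal.ofReal (v Θ), ENNReal.mul_lt_top ENNReal.ofReal_lt_top hlt, ?_⟩
  refine isMultiplier_of_integral (P := EuclideanSpace ℝ ι) (μ := volume)
    (measurable_ofReal_weight hv) (ofReal_submultiplicative hv hc hsub) (fun _ => hs.continuous)
    (fun _ η => (fourierConst ι : ℂ) ^ 2 * fourInt q η)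
    (fun _ => (continuous_const.mul hFc).aestronglyMeasurable)
    (fun η => ‖(fourierConst ι : ℂ) ^ 2 * fourInt q η‖ₑ)
    (continuous_const.mul hFc).enorm.measurable (fun _ _ => le_rfl)
    hfi id measurable_id fun Z Y hY => ?_
  have h1 := fourInt_inversion q.integrable (integrable_fourInt q)
    (y := Y) q.continuous.continuousAt
  rw [hqa, hρ1 Y hY, one_mul, ← integral_const_mul] at h1
  rw [← h1]
  congr 1
  funext η
  simp only [id]
  ring

theorem fourierConst_pos (ι : Type) [Fintype ι] : 0 < fourierConst ι := by
  unfold fourierConst; positivity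

/-- Fourier transforms of localizations of functions in `M^{∞,1}`. -/
theorem exists_localized_bound (hv : IsContModerate N v) (χ : 𝓢(EuclideanSpace ℝ ι, ℂ))
    (hχ : χ ≠ 0) (ρ : 𝓢(EuclideanSpace ℝ ι, ℂ)) (hρ : HasCompactSupport ρ) :
    ∃ C : ℝ≥0∞, C < ∞ ∧ ∀ (Φ : 𝓢'(EuclideanSpace ℝ ι, ℂ)) (h : EuclideanSpace ℝ ι → ℝ),
      IsGivenBy Φ h → ∃ A : EuclideanSpace ℝ ι → ℝ≥0∞, Measurable A ∧
        (∀ Z η, ‖fourInt (fun Y => (h (Z + Y) : ℂ) * ρ Y) η‖ₑ * ENNReal.ofReal (v η) ≤ A η) ∧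
        ∫⁻ η, A η ≤ C * modNorm (fun z => v z.2) ∞ 1 χ Φ := by
  have hw : IsContModerate N fun z : EuclideanSpace ℝ ι × EuclideanSpace ℝ ι => v z.2 :=
    ⟨fun z => hv.pos _, hv.continuous.comp continuous_snd, fun x y =>
      (hv.add_le x.2 y.2).trans (by
        have := (hv.pos x.2).le
        gcongr
        exact norm_snd_le y)⟩
  obtain ⟨C, hC, hA⟩ := exists_stft_bound hw χ hχ ρ
  have hf : ENNReal.ofReal (fourierConst ι) ≠ 0 := by
    simpa using fourierConst_pos ι
  refine ⟨(ENNReal.ofReal (fourierConst ι))⁻¹ * C,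
    ENNReal.mul_lt_top (ENNReal.inv_lt_top.2 (pos_iff_ne_zero.2 hf)) hC, fun Φ h hΦ => ?_⟩
  obtain ⟨A, hAm, hAb, hAi⟩ := hA Φ
  refine ⟨fun η => (ENNReal.ofReal (fourierConst ι))⁻¹ * A η, hAm.const_mul _, fun Z η => ?_, ?_⟩
  · beta_reduce
    have h1 : ‖stft ρ Φ Z η‖ₑ = ENNReal.ofReal (fourierConst ι) *
        ‖fourInt (fun Y => (h (Z + Y) : ℂ) * ρ Y) η‖ₑ := by
      -- With `ρ` itself as window, the localized Fourier transform is `V_ρ Φ (Z, η)` up to the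
      -- normalizing constant and a phase. Compact support is needed because `IsGivenBy` refers only
      -- to compactly supported test functions.
      have hsupp : HasCompactSupport (tfShift ρ Z η) := by
        have h2 : (tfShift ρ Z η : EuclideanSpace ℝ ι → ℂ) =
            fun y => expInner η y * ρ (y - Z) := funext (tfShift_apply ρ Z η)
        rw [h2]
        refine HasCompactSupport.mul_left ?_
        exact hρ.comp_homeomorph (Homeomorph.subRight Z)
      rw [stft, enorm_mul, enorm_ofReal (fourierConst_pos ι).le, hΦ _ hsupp]
      congr 1
      have h3 : ∫ x, (h x : ℂ) * tfShift ρ Z η x =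
          expInner η Z * fourInt (fun Y => (h (Z + Y) : ℂ) * ρ Y) η := by
        rw [← integral_add_left_eq_self _ Z, fourInt, ← integral_const_mul]
        congr 1
        funext Y
        rw [tfShift_apply, add_sub_cancel_left, expInner_add_right]
        ring
      rw [h3, enorm_mul]
      have : ‖expInner η Z‖ₑ = 1 := by rw [← ofReal_norm, norm_expInner, ENNReal.ofReal_one]
      rw [this, one_mul]
    rw [mul_comm _ (A η), ← div_eq_mul_inv, ENNReal.le_div_iff_mul_le (.inl hf)
      (.inl ENNReal.ofReal_ne_top), mul_right_comm, mul_comm _ (ENNReal.ofReal (fourierConst ι)),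
      ← h1]
    exact hAb Z η
  · rw [lintegral_const_mul' _ _ (ENNReal.inv_ne_top.2 hf), mul_assoc]
    gcongr

theorem integrable_localized {h : EuclideanSpace ℝ ι → ℝ} (hh : Continuous h)
    {ρ : 𝓢(EuclideanSpace ℝ ι, ℂ)} (hρ : HasCompactSupport ρ) (Z : EuclideanSpace ℝ ι) :
    Integrable fun Y => (h (Z + Y) : ℂ) * ρ Y :=
  Continuous.integrable_of_hasCompactSupport (by have := ρ.continuous; fun_prop) hρ.mul_left

/-- The dilation condition at `t = 0` bounds the weight below by `v 0 / c`, so weighted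
integrability implies integrability. -/
theorem le_of_mul_weight_le (hv : IsContModerate N v)
    (hdil : ∀ t ∈ Set.Icc (0 : ℝ) 1, ∀ Ξ, v (t • Ξ) ≤ c * v Ξ) {η : EuclideanSpace ℝ ι}
    {a b : ℝ≥0∞} (h : a * ENNReal.ofReal (v η) ≤ b) :
    a ≤ ENNReal.ofReal (v 0 / c)⁻¹ * b := by
  have h0 := hv.pos 0
  have h1 := fun Ξ => hdil 0 (by simp) Ξ
  simp only [zero_smul] at h1
  have hc : 0 < c := by
    by_contra! h2
    nlinarith [h1 0]
  have h2 : v 0 / c ≤ v η := by rw [div_le_iff₀' hc]; exact h1 η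
  rw [mul_comm, ENNReal.ofReal_inv_of_pos (by positivity), ← div_eq_mul_inv,
    ENNReal.le_div_iff_mul_le (.inl (by simpa using by positivity)) (.inl ENNReal.ofReal_ne_top)]
  refine le_trans ?_ h
  gcongr

theorem integrable_fourInt_localized (hv : IsContModerate N v)
    (hdil : ∀ t ∈ Set.Icc (0 : ℝ) 1, ∀ Ξ, v (t • Ξ) ≤ c * v Ξ) {h : EuclideanSpace ℝ ι → ℝ}
    (hh : Continuous h) {ρ : 𝓢(EuclideanSpace ℝ ι, ℂ)} (hρ : HasCompactSupport ρ)
    {A : EuclideanSpace ℝ ι → ℝ≥0∞}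
    (hA : ∀ Z η, ‖fourInt (fun Y => (h (Z + Y) : ℂ) * ρ Y) η‖ₑ * ENNReal.ofReal (v η) ≤ A η)
    (hAi : ∫⁻ η, A η < ∞) (Z : EuclideanSpace ℝ ι) :
    Integrable (fourInt fun Y => (h (Z + Y) : ℂ) * ρ Y) := by
  refine ⟨(continuous_fourInt (integrable_localized hh hρ Z)).aestronglyMeasurable, ?_⟩
  have h1 : ∀ η, ‖fourInt (fun Y => (h (Z + Y) : ℂ) * ρ Y) η‖ₑ ≤
      ENNReal.ofReal (v 0 / c)⁻¹ * A η := fun η => le_of_mul_weight_le hv hdil (hA Z η)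
  refine (lintegral_mono h1).trans_lt ?_
  rw [lintegral_const_mul' _ _ ENNReal.ofReal_ne_top]
  exact ENNReal.mul_lt_top ENNReal.ofReal_lt_top hAi

/-- Fourier inversion for the localized function, evaluated where the cutoff equals one. -/
theorem localized_inversion {h : EuclideanSpace ℝ ι → ℝ} (hh : Continuous h)
    {ρ : 𝓢(EuclideanSpace ℝ ι, ℂ)} (hρ : HasCompactSupport ρ) (hρ1 : ∀ Y, ‖Y‖ ≤ 1 → ρ Y = 1)
    {Z : EuclideanSpace ℝ ι} (hint : Integrable (fourInt fun Y => (h (Z + Y) : ℂ) * ρ Y))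
    {Y : EuclideanSpace ℝ ι} (hY : ‖Y‖ ≤ 1) :
    (h (Z + Y) : ℂ) = ∫ η, (fourierConst ι : ℂ) ^ 2 *
      fourInt (fun Y => (h (Z + Y) : ℂ) * ρ Y) η * expInner (-η) Y := by
  have hcont : Continuous fun Y => (h (Z + Y) : ℂ) * ρ Y := by
    have := ρ.continuous; fun_prop
  have h1 := fourInt_inversion (integrable_localized hh hρ Z) hint (y := Y) hcont.continuousAt
  rw [hρ1 Y hY, mul_one, ← integral_const_mul] at h1
  rw [← h1]
  simp only [mul_assoc]

/-- A continuous function in `M^{∞,1}_{(v)}` is bounded. -/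
theorem exists_bound_of_isGivenBy (hv : IsContModerate N v)
    (hdil : ∀ t ∈ Set.Icc (0 : ℝ) 1, ∀ Ξ, v (t • Ξ) ≤ c * v Ξ) {χ : 𝓢(EuclideanSpace ℝ ι, ℂ)}
    (hχ : χ ≠ 0) {Φ : 𝓢'(EuclideanSpace ℝ ι, ℂ)} {h : EuclideanSpace ℝ ι → ℝ} (hh : Continuous h)
    (hΦ : IsGivenBy Φ h) (hfin : modNorm (fun z => v z.2) ∞ 1 χ Φ < ∞) :
    ∃ B : ℝ, ∀ Z, |h Z| ≤ B := by
  obtain ⟨ρ, hρ, hρ1⟩ := exists_cutoff ι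
  obtain ⟨C, hC, hCA⟩ := exists_localized_bound hv χ hχ ρ hρ
  obtain ⟨A, hAm, hA, hAi⟩ := hCA Φ h hΦ
  have hAi' := hAi.trans_lt (ENNReal.mul_lt_top hC hfin)
  have hB : ‖(fourierConst ι : ℂ) ^ 2‖ₑ * (ENNReal.ofReal (v 0 / c)⁻¹ * ∫⁻ η, A η) < ∞ :=
    ENNReal.mul_lt_top enorm_lt_top (ENNReal.mul_lt_top ENNReal.ofReal_lt_top hAi')
  refine ⟨(‖(fourierConst ι : ℂ) ^ 2‖ₑ * (ENNReal.ofReal (v 0 / c)⁻¹ * ∫⁻ η, A η)).toReal,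
    fun Z => ?_⟩
  have h1 := localized_inversion hh hρ hρ1
    (integrable_fourInt_localized hv hdil hh hρ hA hAi' Z) (Y := 0) (by simp)
  rw [add_zero] at h1
  have h2 : ‖(h Z : ℂ)‖ₑ ≤ ‖(fourierConst ι : ℂ) ^ 2‖ₑ *
      (ENNReal.ofReal (v 0 / c)⁻¹ * ∫⁻ η, A η) := by
    rw [h1]
    refine (enorm_integral_le_lintegral_enorm _).trans ?_
    rw [← lintegral_const_mul' _ _ ENNReal.ofReal_ne_top, ← lintegral_const_mul' _ _ enorm_ne_top]
    refine lintegral_mono fun η => ?_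
    have h3 : ‖expInner (-η) (0 : EuclideanSpace ℝ ι)‖ₑ = 1 := by
      rw [← ofReal_norm, norm_expInner, ENNReal.ofReal_one]
    rw [enorm_mul, enorm_mul, h3, mul_one]
    gcongr
    exact le_of_mul_weight_le hv hdil (hA Z η)
  have h5 := ENNReal.toReal_mono hB.ne h2
  simpa using h5

/-- A continuous function in `M^{∞,1}_{(v)}` is uniformly continuous. -/
theorem uniformContinuous_of_isGivenBy (hv : IsContModerate N v)
    (hdil : ∀ t ∈ Set.Icc (0 : ℝ) 1, ∀ Ξ, v (t • Ξ) ≤ c * v Ξ) {χ : 𝓢(EuclideanSpace ℝ ι, ℂ)}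
    (hχ : χ ≠ 0) {Φ : 𝓢'(EuclideanSpace ℝ ι, ℂ)} {h : EuclideanSpace ℝ ι → ℝ} (hh : Continuous h)
    (hΦ : IsGivenBy Φ h) (hfin : modNorm (fun z => v z.2) ∞ 1 χ Φ < ∞) :
    UniformContinuous h := by
  obtain ⟨ρ, hρ, hρ1⟩ := exists_cutoff ι
  obtain ⟨C, hC, hCA⟩ := exists_localized_bound hv χ hχ ρ hρ
  obtain ⟨A, hAm, hA, hAi⟩ := hCA Φ h hΦ
  have hAi' := hAi.trans_lt (ENNReal.mul_lt_top hC hfin)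
  set K : ℝ≥0∞ := ‖(fourierConst ι : ℂ) ^ 2‖ₑ * ENNReal.ofReal (v 0 / c)⁻¹ with hK
  have hKt : K ≠ ∞ := ENNReal.mul_ne_top enorm_ne_top ENNReal.ofReal_ne_top
  set I : EuclideanSpace ℝ ι → ℝ≥0∞ := fun Y =>
    ∫⁻ η, K * A η * ‖expInner (-η) Y - expInner (-η) 0‖ₑ with hI
  -- The increments `h (b + Y) - h b` are dominated by `I Y` for all `b` at once, because the
  -- majorant `A` does not depend on the base point. Dominated convergence makes `I Y` tend to zero.
  have hI0 : Filter.Tendsto I (nhds 0) (nhds 0) := by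
    have h1 := tendsto_lintegral_filter_of_dominated_convergence (μ := volume)
      (l := nhds (0 : EuclideanSpace ℝ ι))
      (F := fun Y η => K * A η * ‖expInner (-η) Y - expInner (-η) 0‖ₑ) (f := fun _ => 0)
      (fun η => K * A η * 2) (Filter.Eventually.of_forall fun Y => by
        refine (hAm.const_mul K).mul (Measurable.enorm ?_)
        exact Continuous.measurable (by fun_prop))
      (Filter.Eventually.of_forall fun Y => Filter.Eventually.of_forall fun η => by
        gcongr
        rw [← ofReal_norm]
        refine ENNReal.ofReal_le_of_le_toReal ?_
        refine (norm_sub_le _ _).trans ?_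
        rw [norm_expInner, norm_expInner]
        norm_num)
      (by
        rw [lintegral_mul_const' _ _ (by simp), lintegral_const_mul' _ _ hKt]
        exact ENNReal.mul_ne_top (ENNReal.mul_ne_top hKt hAi'.ne) (by simp))
      ?_
    · simpa using h1
    · have hlt : ∀ᵐ η, A η < ∞ := ae_lt_top hAm hAi'.ne
      filter_upwards [hlt] with η hη
      have h2 : Continuous fun Y => ‖expInner (-η) Y - expInner (-η) (0 : EuclideanSpace ℝ ι)‖ₑ :=
        by fun_prop
      have h3 := ENNReal.Tendsto.const_mul (a := K * A η) (h2.tendsto 0)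
        (.inr (ENNReal.mul_ne_top hKt hη.ne))
      simpa using h3
  refine Metric.uniformContinuous_iff.2 fun ε hε => ?_
  have h1 : ∀ᶠ Y in nhds (0 : EuclideanSpace ℝ ι), I Y < ENNReal.ofReal ε :=
    hI0.eventually_lt_const (by simpa using hε)
  obtain ⟨δ, hδ, hδI⟩ := Metric.eventually_nhds_iff.1 h1
  refine ⟨min δ 1, lt_min hδ one_pos, fun {a b} hab => ?_⟩
  have hY : dist (a - b) 0 < δ := by
    rw [dist_zero_right, ← dist_eq_norm]; exact hab.trans_le (min_le_left _ _)
  have hY1 : ‖a - b‖ ≤ 1 := by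
    rw [← dist_eq_norm]; exact (hab.trans_le (min_le_right _ _)).le
  have hint := integrable_fourInt_localized hv hdil hh hρ hA hAi' b
  have h2 := localized_inversion hh hρ hρ1 hint hY1
  have h3 := localized_inversion hh hρ hρ1 hint (Y := 0) (by simp)
  have hi : ∀ Y, Integrable fun η => (fourierConst ι : ℂ) ^ 2 *
      fourInt (fun Y => (h (b + Y) : ℂ) * ρ Y) η * expInner (-η) Y := fun Y => by
    refine (hint.const_mul _).mul_bdd (c := 1) (Continuous.aestronglyMeasurable (by fun_prop))
      (Filter.Eventually.of_forall fun η => (norm_expInner _ _).le)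
  have h4 : ((h a - h b : ℝ) : ℂ) = ∫ η, (fourierConst ι : ℂ) ^ 2 *
      fourInt (fun Y => (h (b + Y) : ℂ) * ρ Y) η *
        (expInner (-η) (a - b) - expInner (-η) 0) := by
    rw [add_sub_cancel] at h2
    rw [add_zero] at h3
    rw [Complex.ofReal_sub, h2, h3, ← integral_sub (hi _) (hi _)]
    simp only [mul_sub]
  have h5 : ‖((h a - h b : ℝ) : ℂ)‖ₑ ≤ I (a - b) := by
    rw [h4]
    refine (enorm_integral_le_lintegral_enorm _).trans (lintegral_mono fun η => ?_)
    have h6 := le_of_mul_weight_le hv hdil (hA b η)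
    rw [enorm_mul, enorm_mul]
    calc _ ≤ ‖(fourierConst ι : ℂ) ^ 2‖ₑ * (ENNReal.ofReal (v 0 / c)⁻¹ * A η) *
          ‖expInner (-η) (a - b) - expInner (-η) 0‖ₑ := by gcongr
      _ = _ := by rw [hK]; ring
  have h6 := h5.trans_lt (hδI hY)
  rw [← ofReal_norm, ENNReal.ofReal_lt_ofReal_iff hε, Complex.norm_real] at h6
  rwa [Real.dist_eq, ← Real.norm_eq_abs]

/-- For `‖Y‖ ≤ 1` and `t` in `(0, 1]` also `‖t • Y‖ ≤ 1`, so local Fourier inversion expresses `h (Z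
+ t • Y)` through characters of `Y` with frequencies `t • η`. The average is thus a superposition
over the pairs `(t, η)`, and the dilation condition bounds the weight at `t • η` by the weight at
`η`. -/
theorem exists_isMultiplier_average (hv : IsContModerate N v) (hc : 0 ≤ c)
    (hsub : ∀ x y, v (x + y) ≤ c * v x * v y)
    (hdil : ∀ t ∈ Set.Icc (0 : ℝ) 1, ∀ Ξ, v (t • Ξ) ≤ c * v Ξ) (χ : 𝓢(EuclideanSpace ℝ ι, ℂ))
    (hχ : χ ≠ 0) :
    ∃ C : ℝ≥0∞, C < ∞ ∧ ∀ (Φ : 𝓢'(EuclideanSpace ℝ ι, ℂ)) (h : EuclideanSpace ℝ ι → ℝ),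
      Continuous h → IsGivenBy Φ h → modNorm (fun z => v z.2) ∞ 1 χ Φ < ∞ →
      IsMultiplier (fun Θ => ENNReal.ofReal (v Θ))
        (fun Z Y => ((∫ t in (0 : ℝ)..1, (1 - t) * h (Z + t • Y) : ℝ) : ℂ))
        (C * modNorm (fun z => v z.2) ∞ 1 χ Φ) := by
  obtain ⟨ρ, hρ, hρ1⟩ := exists_cutoff ι
  obtain ⟨C, hC, hCA⟩ := exists_localized_bound hv χ hχ ρ hρ
  set F : ℝ≥0∞ := ‖(fourierConst ι : ℂ) ^ 2‖ₑ with hF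
  refine ⟨ENNReal.ofReal c * (F * ENNReal.ofReal c * C), ENNReal.mul_lt_top ENNReal.ofReal_lt_top
    (ENNReal.mul_lt_top (ENNReal.mul_lt_top enorm_lt_top ENNReal.ofReal_lt_top) hC),
    fun Φ h hh hΦ hfin => ?_⟩
  obtain ⟨A, hAm, hA, hAi⟩ := hCA Φ h hΦ
  have hAi' := hAi.trans_lt (ENNReal.mul_lt_top hC hfin)
  have hint := integrable_fourInt_localized hv hdil hh hρ hA hAi'
  have hFc : ∀ Z, Continuous (fourInt fun Y => (h (Z + Y) : ℂ) * ρ Y) := fun Z =>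
    continuous_fourInt (integrable_localized hh hρ Z)
  set μ : Measure (ℝ × EuclideanSpace ℝ ι) :=
    (volume.restrict (Set.Ioc (0 : ℝ) 1)).prod volume with hμ
  -- The indicator makes the bounds for the coefficients hold at every `t`, not merely on the
  -- interval that carries the measure.
  set r : ℝ × EuclideanSpace ℝ ι → ℝ≥0∞ := fun p =>
    (Set.Ioc (0 : ℝ) 1).indicator 1 p.1 * (F * (A p.2 / ENNReal.ofReal (v p.2))) with hr
  have hvm := measurable_ofReal_weight hv
  have hrm : Measurable r := by
    have h1 : Measurable ((Set.Ioc (0 : ℝ) 1).indicator (1 : ℝ → ℝ≥0∞)) :=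
      measurable_one.indicator measurableSet_Ioc
    have h2 : Measurable fun η => F * (A η / ENNReal.ofReal (v η)) := (hAm.div hvm).const_mul _
    exact (h1.comp measurable_fst).mul (h2.comp measurable_snd)
  have hv0 : ∀ η, ENNReal.ofReal (v η) ≠ 0 := fun η => by simpa using hv.pos η
  have hrv : ∫⁻ p, r p * ENNReal.ofReal (v (p.1 • p.2)) ∂μ ≤
      F * ENNReal.ofReal c * C * modNorm (fun z => v z.2) ∞ 1 χ Φ := by
    have h1 : ∀ p : ℝ × EuclideanSpace ℝ ι, r p * ENNReal.ofReal (v (p.1 • p.2)) ≤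
        1 * (F * ENNReal.ofReal c * A p.2) := by
      intro p
      by_cases hp : p.1 ∈ Set.Ioc (0 : ℝ) 1
      · have h2 : ENNReal.ofReal (v (p.1 • p.2)) ≤ ENNReal.ofReal c * ENNReal.ofReal (v p.2) := by
          rw [← ENNReal.ofReal_mul hc]
          exact ENNReal.ofReal_le_ofReal (hdil p.1 ⟨hp.1.le, hp.2⟩ p.2)
        simp only [hr, Set.indicator_of_mem hp, Pi.one_apply, one_mul]
        calc _ ≤ F * (A p.2 / ENNReal.ofReal (v p.2)) *
              (ENNReal.ofReal c * ENNReal.ofReal (v p.2)) := by gcongr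
          _ = F * ENNReal.ofReal c * (A p.2 / ENNReal.ofReal (v p.2) * ENNReal.ofReal (v p.2)) := by
              ring
          _ = _ := by rw [ENNReal.div_mul_cancel (hv0 _) ENNReal.ofReal_ne_top]
      · simp [hr, Set.indicator_of_notMem hp]
    refine (lintegral_mono h1).trans ?_
    rw [hμ, lintegral_prod_mul (f := fun _ => 1) (g := fun η => F * ENNReal.ofReal c * A η)
      aemeasurable_const (hAm.const_mul _).aemeasurable, lintegral_const_mul _ hAm]
    simp only [lintegral_const, MeasurableSet.univ, Measure.restrict_apply, Set.univ_inter,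
      Real.volume_Ioc, sub_zero, ENNReal.ofReal_one, mul_one, one_mul]
    calc _ ≤ F * ENNReal.ofReal c * (C * modNorm (fun z => v z.2) ∞ 1 χ Φ) := by gcongr
      _ = _ := by ring
  have hri : ∫⁻ p, r p ∂μ < ∞ := by
    have h1 : ∀ p, r p ≤ ENNReal.ofReal (v 0 / c)⁻¹ * (r p * ENNReal.ofReal (v (p.1 • p.2))) :=
      fun p => le_of_mul_weight_le hv hdil le_rfl
    refine (lintegral_mono h1).trans_lt ?_
    rw [lintegral_const_mul' _ _ ENNReal.ofReal_ne_top]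
    refine ENNReal.mul_lt_top ENNReal.ofReal_lt_top (hrv.trans_lt ?_)
    exact ENNReal.mul_lt_top (ENNReal.mul_lt_top (ENNReal.mul_lt_top enorm_lt_top
      ENNReal.ofReal_lt_top) hC) hfin
  set b : EuclideanSpace ℝ ι → ℝ × EuclideanSpace ℝ ι → ℂ := fun Z p =>
    ((Set.Ioc (0 : ℝ) 1).indicator (fun t => 1 - t) p.1 : ℝ) *
      ((fourierConst ι : ℂ) ^ 2 * fourInt (fun Y => (h (Z + Y) : ℂ) * ρ Y) p.2) with hb
  have hbm : ∀ Z, Measurable (b Z) := by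
    intro Z
    have h1 : Measurable ((Set.Ioc (0 : ℝ) 1).indicator (fun t : ℝ => 1 - t)) :=
      (measurable_const.sub measurable_id).indicator measurableSet_Ioc
    have h2 : Measurable fun η =>
        (fourierConst ι : ℂ) ^ 2 * fourInt (fun Y => (h (Z + Y) : ℂ) * ρ Y) η :=
      (continuous_const.mul (hFc Z)).measurable
    exact (Complex.measurable_ofReal.comp (h1.comp measurable_fst)).mul (h2.comp measurable_snd)
  have hbr : ∀ Z p, ‖b Z p‖ₑ ≤ r p := by
    intro Z p
    simp only [hb, hr, enorm_mul]
    gcongr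
    · by_cases hp : p.1 ∈ Set.Ioc (0 : ℝ) 1
      · rw [Set.indicator_of_mem hp, Set.indicator_of_mem hp, Pi.one_apply,
          enorm_ofReal (by linarith [hp.2])]
        exact ENNReal.ofReal_le_one.2 (by linarith [hp.1])
      · simp [Set.indicator_of_notMem hp]
    · rw [ENNReal.le_div_iff_mul_le (.inl (hv0 _)) (.inl ENNReal.ofReal_ne_top)]
      exact hA Z p.2
  have hmul := isMultiplier_of_integral (P := ℝ × EuclideanSpace ℝ ι) (μ := μ)
    (V := fun Θ => ENNReal.ofReal (v Θ))
    (ψ := fun Z Y => ((∫ t in (0 : ℝ)..1, (1 - t) * h (Z + t • Y) : ℝ) : ℂ))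
    hvm (ofReal_submultiplicative hv hc hsub)
    (fun Z => by
      refine Complex.continuous_ofReal.comp
        (intervalIntegral.continuous_parametric_intervalIntegral_of_continuous' ?_ 0 1)
      simp only [Function.uncurry_def]
      fun_prop)
    b (fun Z => (hbm Z).aestronglyMeasurable) r hrm hbr hri (fun p => p.1 • p.2) (by fun_prop)
    (fun Z Y hY => by
      have hint2 : Integrable (fun p => b Z p * expInner (-(p.1 • p.2)) Y) μ := by
        refine Integrable.mul_bdd (c := 1) ⟨(hbm Z).aestronglyMeasurable,
          (lintegral_mono (hbr Z)).trans_lt hri⟩ ?_ (Filter.Eventually.of_forall fun p =>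
            (norm_expInner _ _).le)
        exact Measurable.aestronglyMeasurable (by fun_prop)
      rw [hμ] at hint2 ⊢
      rw [integral_prod _ hint2, intervalIntegral.integral_of_le zero_le_one,
        ← integral_complex_ofReal]
      refine setIntegral_congr_fun measurableSet_Ioc fun t ht => ?_
      have h1 : ‖t • Y‖ ≤ 1 := by
        rw [norm_smul, Real.norm_of_nonneg ht.1.le]
        exact mul_le_one₀ ht.2 (norm_nonneg _) hY
      simp only [hb, Set.indicator_of_mem ht]
      rw [Complex.ofReal_mul, localized_inversion hh hρ hρ1 (hint Z) h1, ← integral_const_mul]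
      congr 1
      funext η
      have h2 : expInner (-(t • η)) Y = expInner (-η) (t • Y) := by
        simp only [expInner, inner_neg_right, inner_smul_left, inner_smul_right]
        rfl
      rw [h2]
      ring)
  refine hmul.mono ?_
  rw [mul_assoc]
  gcongr

end Phase

/-! ### Taylor's formula and the exponential of the remainder -/

section Taylor

variable {ι : Type} [Fintype ι]

theorem map_eq_sum_single [DecidableEq ι] {F : Type*} [NormedAddCommGroup F] [NormedSpace ℝ F]
    (L : EuclideanSpace ℝ ι →L[ℝ] F) (Y : EuclideanSpace ℝ ι) :
    L Y = ∑ i, Y i • L (EuclideanSpace.single i 1) := by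
  conv_lhs => rw [← (EuclideanSpace.basisFun ι ℝ).sum_repr Y]
  simp [map_sum]

variable {φ : EuclideanSpace ℝ ι → ℝ}

theorem contDiff_fderiv_apply (hφ : ContDiff ℝ 2 φ) (Y : EuclideanSpace ℝ ι) :
    ContDiff ℝ 1 fun X => fderiv ℝ φ X Y :=
  (hφ.fderiv_right (m := 1) (by norm_num)).clm_apply contDiff_const

theorem continuous_secondPartial [DecidableEq ι] (hφ : ContDiff ℝ 2 φ) (i j : ι) :
    Continuous (secondPartial φ i j) :=
  ((contDiff_fderiv_apply hφ _).continuous_fderiv (by norm_num)).clm_apply continuous_const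

/-- The remainder of the first order Taylor expansion of `φ` at `Z`. -/
def taylorRem (φ : EuclideanSpace ℝ ι → ℝ) (Z Y : EuclideanSpace ℝ ι) : ℝ :=
  φ (Z + Y) - φ Z - fderiv ℝ φ Z Y

theorem taylorRem_eq_sum [DecidableEq ι] (hφ : ContDiff ℝ 2 φ) (Z Y : EuclideanSpace ℝ ι) :
    taylorRem φ Z Y = ∑ i, ∑ j, Y i * Y j *
      ∫ t in (0 : ℝ)..1, (1 - t) * secondPartial φ i j (Z + t • Y) := by
  set D : ℝ → ℝ := fun t => fderiv ℝ φ (Z + t • Y) Y with hD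
  set D' : ℝ → ℝ := fun t => ∑ i, ∑ j, Y i * Y j * secondPartial φ i j (Z + t • Y) with hD'
  have hline : ∀ t, HasDerivAt (fun t : ℝ => Z + t • Y) Y t := fun t => by
    simpa using ((hasDerivAt_id t).smul_const Y).const_add Z
  have h1 : ∀ t, HasDerivAt (fun t : ℝ => φ (Z + t • Y)) (D t) t := fun t =>
    ((hφ.differentiable (by norm_num)) (Z + t • Y)).hasFDerivAt.comp_hasDerivAt t (hline t)
  have h2 : ∀ t, HasDerivAt D (D' t) t := fun t => by
    have h3 := ((contDiff_fderiv_apply hφ Y).differentiable (by norm_num)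
      (Z + t • Y)).hasFDerivAt.comp_hasDerivAt t (hline t)
    have h4 : fderiv ℝ (fun X => fderiv ℝ φ X Y) (Z + t • Y) Y = D' t := by
      have h5 : (fun X => fderiv ℝ φ X Y) =
          fun X => ∑ j, Y j • fderiv ℝ φ X (EuclideanSpace.single j 1) :=
        funext fun X => map_eq_sum_single _ Y
      rw [map_eq_sum_single _ Y]
      simp only [hD', smul_eq_mul]
      refine Finset.sum_congr rfl fun i _ => ?_
      rw [h5, fderiv_fun_sum (A := fun j X => Y j • fderiv ℝ φ X (EuclideanSpace.single j 1))
        fun j _ => ((contDiff_fderiv_apply hφ _).differentiable (by norm_num) _).const_smul (Y j)]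
      rw [sum_apply, Finset.mul_sum]
      refine Finset.sum_congr rfl fun j _ => ?_
      rw [fderiv_fun_const_smul ((contDiff_fderiv_apply hφ _).differentiable (by norm_num) _)]
      simp only [smul_apply, smul_eq_mul, secondPartial]
      ring
    rw [← h4]
    exact h3
  have hsc := fun i j => continuous_secondPartial hφ i j
  have hD'c : Continuous D' := by
    simp only [hD']
    fun_prop
  -- The antiderivative produced by integrating by parts: its increment over `[0, 1]` is precisely
  -- the Taylor remainder.
  have h3 : ∀ t, HasDerivAt (fun t => φ (Z + t • Y) + (1 - t) * D t) ((1 - t) * D' t) t := by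
    intro t
    have h4 := (h1 t).add ((((hasDerivAt_id t).const_sub 1)).mul (h2 t))
    exact h4.congr_deriv (by simp)
  have h4 := intervalIntegral.integral_eq_sub_of_hasDerivAt (a := 0) (b := 1) (fun t _ => h3 t)
    (((continuous_const.sub continuous_id).mul hD'c).intervalIntegrable _ _)
  have h5 : taylorRem φ Z Y = ∫ t in (0 : ℝ)..1, (1 - t) * D' t := by
    rw [h4]
    simp [taylorRem, hD]
    ring
  rw [h5]
  simp only [hD', Finset.mul_sum]
  rw [intervalIntegral.integral_finsetSum fun i _ =>
    Continuous.intervalIntegrable (by fun_prop) _ _]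
  refine Finset.sum_congr rfl fun i _ => ?_
  rw [intervalIntegral.integral_finsetSum fun j _ =>
    Continuous.intervalIntegrable (by fun_prop) _ _]
  refine Finset.sum_congr rfl fun j _ => ?_
  rw [← intervalIntegral.integral_const_mul]
  exact intervalIntegral.integral_congr fun t _ => by ring

variable {N : ℕ} {v : EuclideanSpace ℝ ι → ℝ} {c : ℝ}

/-- Each term of the remainder is a smooth multiplier `i Y_i Y_j`, independent of the phase, times
an averaged second derivative, which costs one factor of the Hessian norm. Hence the bound for the
remainder is linear in that norm and the one for its exponential is exponential, with `C`
independent of `φ`. -/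
theorem exists_isMultiplier_phase [DecidableEq ι] (hv : IsContModerate N v) (hc : 0 ≤ c)
    (hsub : ∀ x y, v (x + y) ≤ c * v x * v y)
    (hdil : ∀ t ∈ Set.Icc (0 : ℝ) 1, ∀ Ξ, v (t • Ξ) ≤ c * v Ξ) (χ : 𝓢(EuclideanSpace ℝ ι, ℂ))
    (hχ : χ ≠ 0) :
    ∃ C : ℝ, 0 ≤ C ∧ ∀ (φ : EuclideanSpace ℝ ι → ℝ) (Φ : ι → ι → 𝓢'(EuclideanSpace ℝ ι, ℂ)),
      ContDiff ℝ 2 φ → (∀ i j, IsGivenBy (Φ i j) (secondPartial φ i j)) →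
      hessNorm (fun z => v z.2) χ Φ < ∞ →
      IsMultiplier (fun Θ => ENNReal.ofReal (v Θ))
        (fun Z Y => Complex.exp (Complex.I * taylorRem φ Z Y))
        (ENNReal.ofReal (Real.exp (C * (hessNorm (fun z => v z.2) χ Φ).toReal))) := by
  have hs : ∀ i j : ι, ContDiff ℝ (⊤ : ℕ∞) fun Y : EuclideanSpace ℝ ι =>
      Complex.I * ((Y i * Y j : ℝ) : ℂ) := by
    intro i j
    refine contDiff_const.mul (Complex.ofRealCLM.contDiff.comp ?_)
    exact (EuclideanSpace.proj (𝕜 := ℝ) i).contDiff.mul (EuclideanSpace.proj (𝕜 := ℝ) j).contDiff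
  choose B hB hBm using fun i j => exists_isMultiplier_smooth hv hc hsub (hs i j)
  obtain ⟨C, hC, hCm⟩ := exists_isMultiplier_average hv hc hsub hdil χ hχ
  have hfin : ∑ i, ∑ j, B i j * C < ∞ :=
    ENNReal.sum_lt_top.2 fun i _ => ENNReal.sum_lt_top.2 fun j _ => ENNReal.mul_lt_top (hB i j) hC
  refine ⟨(∑ i, ∑ j, B i j * C).toReal, ENNReal.toReal_nonneg, fun φ Φ hφ hΦ hΦv => ?_⟩
  have hle : ∀ i j, modNorm (fun z => v z.2) ∞ 1 χ (Φ i j) ≤ hessNorm (fun z => v z.2) χ Φ :=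
    fun i j => le_iSup_of_le i (le_iSup (fun j => modNorm (fun z => v z.2) ∞ 1 χ (Φ i j)) j)
  have hVm := measurable_ofReal_weight hv
  have h1 : IsMultiplier (fun Θ => ENNReal.ofReal (v Θ))
      (fun Z Y => Complex.I * taylorRem φ Z Y)
      ((∑ i, ∑ j, B i j * C) * hessNorm (fun z => v z.2) χ Φ) := by
    have h2 := IsMultiplier.sum hVm Finset.univ fun i _ => IsMultiplier.sum hVm Finset.univ
      fun j _ => ((hBm i j).mul (hCm (Φ i j) _ (continuous_secondPartial hφ i j) (hΦ i j)
        ((hle i j).trans_lt hΦv))).mono (B' := B i j * C * hessNorm (fun z => v z.2) χ Φ)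
        (by rw [mul_assoc]; gcongr; exact hle i j)
    simp only [← Finset.sum_mul] at h2
    simp only [Finset.sum_mul]
    simp only [Finset.sum_mul] at h2
    convert h2 using 3 with Z Y
    rw [taylorRem_eq_sum hφ]
    push_cast
    simp only [Finset.mul_sum, mul_assoc]
  have h3 := h1.exp hVm (ENNReal.mul_ne_top hfin.ne hΦv.ne)
  rwa [ENNReal.toReal_mul] at h3

end Taylor

/-! ### Global injectivity and change of variables -/

section Hadamard

/-- A Lipschitz map with local inverses of uniform size is injective: the straight line between two
points of a fibre is deformed in small steps to a single point. -/
theorem injective_of_uniform_local_inverse {E : Type*} [NormedAddCommGroup E] [NormedSpace ℝ E]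
    {F : E → E} {B r k : ℝ} (hr : 0 < r) (hk : 0 < k) (hB : ∀ x y, ‖F x - F y‖ ≤ B * ‖x - y‖)
    (hinj : ∀ x, ∀ y ∈ Metric.closedBall x r, ∀ z ∈ Metric.closedBall x r,
      ‖y - z‖ ≤ k * ‖F y - F z‖)
    (hsurj : ∀ x q, ‖q - F x‖ ≤ r / k → ∃ y ∈ Metric.closedBall x r, F y = q) :
    Function.Injective F := by
  intro x₀ x₁ h01
  set c : ℝ → E := fun s => x₀ + s • (x₁ - x₀) with hc
  set p := F x₀ with hp
  set L := ‖x₁ - x₀‖ with hL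
  -- Two grid steps of size `ε` lift to a displacement of at most `2 * k * ε = r`, so that adjacent
  -- lifts stay in a common ball.
  set ε := r / (2 * k) with hε
  have hε0 : 0 < ε := by positivity
  have hkε : 2 * (k * ε) = r := by rw [hε]; field_simp
  have hεr : ε ≤ r / k := by
    rw [hε]
    gcongr
    linarith
  -- The mesh is fine enough for neighbouring points of the grid to be `ε`-close in the image, and
  -- for neighbouring points of the initial segment to be `r`-close.
  obtain ⟨n, hn⟩ := exists_nat_gt (max (|B| * L / ε) (L / r))
  have hn0 : (0 : ℝ) < n := lt_of_le_of_lt (by positivity) hn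
  have hn1 : |B| * L / n ≤ ε := by
    rw [div_le_iff₀ hn0]
    have := (le_max_left _ _).trans hn.le
    rw [div_le_iff₀ hε0] at this
    linarith
  have hn2 : L / n ≤ r := by
    rw [div_le_iff₀ hn0]
    have := (le_max_right _ _).trans hn.le
    rw [div_le_iff₀ hr] at this
    linarith
  -- A discrete homotopy: row `0` is the image of the segment from `x₀` to `x₁`, row `n` is
  -- constantly `p`, and the columns `0` and `n` are constantly `p` because `F x₀ = F x₁ = p`.
  set H : ℕ → ℕ → E := fun i j => F (c (j / n)) + ((i : ℝ) / n) • (p - F (c (j / n))) with hH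
  have hcj : ∀ j : ℕ, ‖c ((j + 1 : ℕ) / n) - c (j / n)‖ = L / n := by
    intro j
    have : c ((j + 1 : ℕ) / n) - c (j / n) = (1 / (n : ℝ)) • (x₁ - x₀) := by
      simp only [hc]
      rw [add_sub_add_left_eq_sub, ← sub_smul]
      congr 1
      push_cast
      ring
    rw [this, norm_smul, Real.norm_of_nonneg (by positivity), ← hL]
    ring
  have hHj : ∀ i j : ℕ, i ≤ n → ‖H i (j + 1) - H i j‖ ≤ ε := by
    intro i j hi
    have h1 : H i (j + 1) - H i j =
        (1 - (i : ℝ) / n) • (F (c ((j + 1 : ℕ) / n)) - F (c (j / n))) := by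
      simp only [hH]
      module
    have h2 : (i : ℝ) / n ≤ 1 := by
      rw [div_le_one hn0]
      exact_mod_cast hi
    have h3 : 0 ≤ (i : ℝ) / n := by positivity
    rw [h1, norm_smul, Real.norm_of_nonneg (by linarith)]
    calc _ ≤ 1 * (|B| * (L / n)) := by
          gcongr
          · linarith
          · refine (hB _ _).trans ?_
            rw [hcj]
            gcongr
            exact le_abs_self B
      _ ≤ ε := by rw [one_mul, ← mul_div_assoc]; exact hn1
  have hHi : ∀ i j : ℕ, j ≤ n → ‖H (i + 1) j - H i j‖ ≤ ε := by
    intro i j hj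
    have h1 : H (i + 1) j - H i j = (1 / (n : ℝ)) • (p - F (c (j / n))) := by
      simp only [hH]
      push_cast
      module
    have h2 : (j : ℝ) / n ≤ 1 := by
      rw [div_le_one hn0]
      exact_mod_cast hj
    have h3 : ‖p - F (c (j / n))‖ ≤ |B| * L := by
      refine (hB _ _).trans ?_
      have : x₀ - c (j / n) = -((j : ℝ) / n) • (x₁ - x₀) := by simp only [hc]; module
      rw [this, norm_smul, norm_neg, Real.norm_of_nonneg (by positivity)]
      calc _ ≤ |B| * (1 * L) := by
            gcongr
            exact le_abs_self B
        _ = _ := by ring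
    rw [h1, norm_smul, Real.norm_of_nonneg (by positivity)]
    calc _ ≤ 1 / n * (|B| * L) := by gcongr
      _ ≤ ε := by rw [one_div_mul_eq_div]; exact hn1
  choose! G hG hFG using hsurj
  -- The lift of `H`, starting from the segment itself and continued along each column by local
  -- inverses.
  set g : ℕ → ℕ → E := fun i j => Nat.rec (c (j / n)) (fun i x => G x (H (i + 1) j)) i with hg
  have hg0 : ∀ j, g 0 j = c (j / n) := fun j => rfl
  have hgs : ∀ i j, g (i + 1) j = G (g i j) (H (i + 1) j) := fun i j => rfl
  have hFg : ∀ i j, j ≤ n → F (g i j) = H i j := by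
    intro i j hj
    induction i with
    | zero => simp [hg0, hH]
    | succ i ih =>
      rw [hgs]
      exact hFG _ _ (by rw [ih]; exact (hHi i j hj).trans hεr)
  have hgi : ∀ i j, j ≤ n → ‖g (i + 1) j - g i j‖ ≤ k * ‖H (i + 1) j - H i j‖ := by
    intro i j hj
    rw [← hFg _ j hj, ← hFg _ j hj]
    refine hinj (g i j) _ ?_ _ (Metric.mem_closedBall_self hr.le)
    rw [hgs]
    exact hG _ _ (by rw [hFg i j hj]; exact (hHi i j hj).trans hεr)
  have hgj : ∀ i j, i ≤ n → j + 1 ≤ n → ‖g i (j + 1) - g i j‖ ≤ k * ‖H i (j + 1) - H i j‖ := by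
    intro i j hi hj
    have hj' : j ≤ n := by omega
    induction i with
    | zero =>
      rw [← hFg 0 (j + 1) hj, ← hFg 0 j hj']
      refine hinj (g 0 j) _ ?_ _ (Metric.mem_closedBall_self hr.le)
      rw [mem_closedBall_iff_norm, hg0, hg0, hcj]
      exact hn2
    | succ i ih =>
      have h1 := ih (by omega)
      have h2 := hgi i j hj'
      have h3 := hgi i (j + 1) hj
      have e1 := mul_le_mul_of_nonneg_left (hHj i j (by omega)) hk.le
      have e2 := mul_le_mul_of_nonneg_left (hHi i j hj') hk.le
      have e3 := mul_le_mul_of_nonneg_left (hHi i (j + 1) hj) hk.le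
      rw [← hFg (i + 1) (j + 1) hj, ← hFg (i + 1) j hj']
      -- Coherence between columns: both new points lie within `r` of `g i j`, one being reached by
      -- two steps and the other by one. Quantitative injectivity in this ball carries the closeness
      -- of the images over to the lifts.
      refine hinj (g i j) _ ?_ _ ?_
      · rw [mem_closedBall_iff_norm]
        have h4 := norm_sub_le_norm_sub_add_norm_sub (g (i + 1) (j + 1)) (g i (j + 1)) (g i j)
        linarith
      · rw [mem_closedBall_iff_norm]
        have := mul_pos hk hε0
        linarith
  have hn' : (n : ℝ) / n = 1 := div_self hn0.ne'
  -- Where `H` is stationary so is its lift. The top row joins the two end columns, which stay at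
  -- `x₀` and `x₁`; hence the two points coincide.
  have hconst : ∀ j, j ≤ n → g n j = g n 0 := by
    intro j hj
    induction j with
    | zero => rfl
    | succ j ih =>
      rw [← ih (by omega), ← sub_eq_zero, ← norm_le_zero_iff]
      refine (hgj n j le_rfl hj).trans ?_
      simp [hH, hn']
  have hend : ∀ j, j ≤ n → F (c (j / n)) = p → ∀ i, g i j = c (j / n) := by
    intro j hj hcp i
    induction i with
    | zero => rfl
    | succ i ih =>
      rw [← ih, ← sub_eq_zero, ← norm_le_zero_iff]
      refine (hgi i j hj).trans ?_
      simp [hH, hcp]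
  have h5 : c ((n : ℕ) / n) = x₁ := by simp [hc, hn']
  have h6 : c ((0 : ℕ) / n) = x₀ := by simp [hc]
  have h7 := hend n le_rfl (by rw [h5, ← h01]) n
  have h8 := hend 0 n.zero_le (by rw [h6]) n
  rw [h5, hconst n le_rfl, h8, h6] at h7
  exact h7

variable {E : Type*} [NormedAddCommGroup E] [NormedSpace ℝ E] [FiniteDimensional ℝ E]

/-- The linear maps with norm at most `B` and determinant bounded below form a compact set, so `‖L
v‖` has a positive minimum over these maps and the unit sphere. The value of `k` is immaterial: it
serves for injectivity and enters no final constant. -/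
theorem exists_lower_bound_of_det (E : Type*) [NormedAddCommGroup E] [NormedSpace ℝ E]
    [FiniteDimensional ℝ E] (B : ℝ) {d : ℝ} (hd : 0 < d) :
    ∃ k : ℝ, 0 < k ∧ ∀ L : E →L[ℝ] E, ‖L‖ ≤ B → d ≤ |L.det| → ∀ v, ‖v‖ ≤ k * ‖L v‖ := by
  have : ProperSpace E := FiniteDimensional.proper_real E
  have : ProperSpace (E →L[ℝ] E) := FiniteDimensional.proper_real _
  set S : Set ((E →L[ℝ] E) × E) :=
    (Metric.closedBall 0 B ∩ {L | d ≤ |L.det|}) ×ˢ Metric.sphere (0 : E) 1 with hS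
  have hSc : IsCompact S := by
    refine IsCompact.prod ((isCompact_closedBall _ _).inter_right ?_) (isCompact_sphere _ _)
    exact isClosed_le continuous_const ContinuousLinearMap.continuous_det.abs
  have hcont : Continuous fun p : (E →L[ℝ] E) × E => ‖p.1 p.2‖ := by fun_prop
  obtain ⟨e, he, hmin⟩ : ∃ e : ℝ, 0 < e ∧ ∀ p ∈ S, e ≤ ‖p.1 p.2‖ := by
    rcases S.eq_empty_or_nonempty with h0 | h0
    · exact ⟨1, one_pos, by simp [h0]⟩
    · obtain ⟨p, hp, hpm⟩ := hSc.exists_isMinOn h0 hcont.continuousOn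
      refine ⟨‖p.1 p.2‖, norm_pos_iff.2 fun h1 => ?_, fun q hq => hpm hq⟩
      have hdet : LinearMap.det (p.1 : E →ₗ[ℝ] E) ≠ 0 := by
        have h2 : d ≤ |p.1.det| := hp.1.2
        intro h3
        have h4 : p.1.det = 0 := h3
        rw [h4, abs_zero] at h2
        linarith
      have hinj : Function.Injective (p.1 : E →ₗ[ℝ] E) :=
        LinearMap.ker_eq_bot.1 (by
          by_contra h5
          exact hdet (LinearMap.det_eq_zero_iff_ker_ne_bot.2 h5))
      have h6 : p.2 = 0 := hinj (by simpa using h1)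
      have h7 : ‖p.2‖ = 1 := by simpa using hp.2
      rw [h6, norm_zero] at h7
      exact zero_ne_one h7
  refine ⟨e⁻¹, inv_pos.2 he, fun L hL hLd v => ?_⟩
  rcases eq_or_ne v 0 with rfl | hv
  · simp
  · have hv' := norm_pos_iff.2 hv
    have h1 := hmin (L, ‖v‖⁻¹ • v) ⟨⟨by simpa using hL, hLd⟩, by
      simp [norm_smul, hv'.ne']⟩
    simp only [map_smul, norm_smul, norm_inv, norm_norm] at h1
    rw [inv_mul_eq_div, le_div_iff₀ hv'] at h1
    rw [inv_mul_eq_div, le_div_iff₀ he]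
    linarith

/-- Uniform continuity of the derivative gives one radius `r` at which `F` differs from its
linearization by at most half of what the bound `k` on the inverses tolerates. Therefore `F` is
injective on every ball of radius `r` with constant `2 * k`, and the image contains the ball of
radius `r / (2 * k)` around the image of the centre. -/
theorem injective_of_det {F : E → E} {F' : E → E →L[ℝ] E} (hF : ∀ x, HasFDerivAt F (F' x) x)
    (hF' : UniformContinuous F') {B d : ℝ} (hB : ∀ x, ‖F' x‖ ≤ B) (hd : 0 < d)
    (hdet : ∀ x, d ≤ |(F' x).det|) : Function.Injective F := by
  have : CompleteSpace E := FiniteDimensional.complete ℝ E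
  obtain ⟨k, hk, hkL⟩ := exists_lower_bound_of_det E B hd
  obtain ⟨r, hr, hrF⟩ := Metric.uniformContinuous_iff_le.1 hF' (1 / (2 * k)) (by positivity)
  have happ : ∀ x, ∀ y ∈ Metric.closedBall x r, ∀ z ∈ Metric.closedBall x r,
      ‖F y - F z - F' x (y - z)‖ ≤ 1 / (2 * k) * ‖y - z‖ := by
    intro x y hy z hz
    refine (convex_closedBall x r).norm_image_sub_le_of_norm_hasFDerivWithin_le'
      (fun w _ => (hF w).hasFDerivWithinAt) (fun w hw => ?_) hz hy
    rw [← dist_eq_norm]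
    exact hrF hw
  refine injective_of_uniform_local_inverse (B := B) (r := r) (k := 2 * k) hr (by positivity)
    (fun x y => convex_univ.norm_image_sub_le_of_norm_hasFDerivWithin_le
      (fun w _ => (hF w).hasFDerivWithinAt) (fun w _ => hB w) (Set.mem_univ y) (Set.mem_univ x))
    (fun x y hy z hz => ?_) fun x q hq => ?_
  · have h1 := hkL _ (hB x) (hdet x) (y - z)
    have h2 := happ x y hy z hz
    have h3 : ‖F' x (y - z)‖ ≤ ‖F y - F z‖ + 1 / (2 * k) * ‖y - z‖ := by
      have := norm_sub_norm_le (F' x (y - z)) (F y - F z)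
      rw [norm_sub_rev (F' x (y - z))] at this
      linarith
    have h4 : ‖y - z‖ ≤ k * (‖F y - F z‖ + 1 / (2 * k) * ‖y - z‖) := h1.trans (by gcongr)
    have h5 : k * (‖F y - F z‖ + 1 / (2 * k) * ‖y - z‖) = k * ‖F y - F z‖ + ‖y - z‖ / 2 := by
      field_simp
    linarith
  · have hinj : Function.Injective (F' x : E →ₗ[ℝ] E) := by
      rw [← LinearMap.ker_eq_bot, LinearMap.ker_eq_bot']
      intro v hv
      have h1 := hkL _ (hB x) (hdet x) v
      have h2 : F' x v = 0 := hv
      rw [h2, norm_zero, mul_zero] at h1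
      exact norm_le_zero_iff.1 h1
    have hs := LinearMap.injective_iff_surjective.1 hinj
    choose R hR using hs
    let N : (F' x).NonlinearRightInverse :=
      { toFun := R
        nnnorm := k.toNNReal
        bound' := fun y => by
          rw [Real.coe_toNNReal _ hk.le]
          have h1 := hkL _ (hB x) (hdet x) (R y)
          have h2 : F' x (R y) = y := hR y
          rwa [h2] at h1
        right_inv' := hR }
    have ha : ApproximatesLinearOn F (F' x) (Metric.closedBall x r) (1 / (2 * k)).toNNReal := by
      intro y hy z hz
      rw [Real.coe_toNNReal _ (by positivity)]
      exact happ x y hy z hz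
    have h3 := ha.surjOn_closedBall_of_nonlinearRightInverse N hr.le le_rfl
    have h4 : (((N.nnnorm : ℝ)⁻¹ - ((1 / (2 * k)).toNNReal : ℝ)) * r) = r / (2 * k) := by
      have : N.nnnorm = k.toNNReal := rfl
      rw [this, Real.coe_toNNReal _ hk.le, Real.coe_toNNReal _ (by positivity)]
      field_simp
      ring
    rw [h4] at h3
    obtain ⟨y, hy, hyq⟩ := h3 (mem_closedBall_iff_norm.2 hq)
    exact ⟨y, hy, hyq⟩

/-- Change of variables for an injective map. The bounds on the derivative are used only
qualitatively, for injectivity, so the constant is exactly `d⁻¹`. -/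
theorem lintegral_comp_le_of_det [MeasurableSpace E] [BorelSpace E] (μ : Measure E)
    [μ.IsAddHaarMeasure] {F : E → E} {F' : E → E →L[ℝ] E} (hF : ∀ x, HasFDerivAt F (F' x) x)
    (hF' : UniformContinuous F') {B d : ℝ} (hB : ∀ x, ‖F' x‖ ≤ B) (hd : 0 < d)
    (hdet : ∀ x, d ≤ |(F' x).det|) (h : E → ℝ≥0∞) :
    ∫⁻ x, h (F x) ∂μ ≤ ENNReal.ofReal d⁻¹ * ∫⁻ x, h x ∂μ := by
  have h1 := lintegral_image_eq_lintegral_abs_det_fderiv_mul μ MeasurableSet.univ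
    (fun x _ => (hF x).hasFDerivWithinAt) (injective_of_det hF hF' hB hd hdet).injOn h
  rw [setLIntegral_univ] at h1
  have hd0 : ENNReal.ofReal d ≠ 0 := by simpa using hd
  have h2 : ENNReal.ofReal d * ∫⁻ x, h (F x) ∂μ ≤ ∫⁻ x, h x ∂μ := by
    rw [← lintegral_const_mul' _ _ ENNReal.ofReal_ne_top]
    refine le_trans ?_ (h1.symm.le.trans (setLIntegral_le_lintegral _ _))
    exact lintegral_mono fun x => by
      gcongr
      exact hdet x
  rw [ENNReal.ofReal_inv_of_pos hd, mul_comm, ← div_eq_mul_inv,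
    ENNReal.le_div_iff_mul_le (.inl hd0) (.inl ENNReal.ofReal_ne_top), mul_comm]
  exact h2

end Hadamard

/-! ### Splittings of the coordinates and the substitution by partial gradients -/

section Split

variable {α β ι : Type} [Fintype α] [Fintype β] [Fintype ι]

/-- The coordinates of a vector with the indices `f a`. -/
def pull (f : α → ι) : EuclideanSpace ℝ ι →L[ℝ] EuclideanSpace ℝ α :=
  LinearMap.toContinuousLinearMap
    { toFun := fun Z => WithLp.toLp 2 fun a => Z (f a)
      map_add' := fun _ _ => rfl
      map_smul' := fun _ _ => rfl }

@[simp]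
theorem pull_apply (f : α → ι) (Z : EuclideanSpace ℝ ι) (a : α) : pull f Z a = Z (f a) := rfl

/-- Extension by zero in the first set of coordinates of a splitting. -/
def inR (e : α ⊕ β ≃ ι) : EuclideanSpace ℝ β →L[ℝ] EuclideanSpace ℝ ι :=
  LinearMap.toContinuousLinearMap
    { toFun := fun b => WithLp.toLp 2 fun i => Sum.elim 0 b (e.symm i)
      map_add' := fun x y => by
        ext i
        rcases h : e.symm i with a | b <;> simp [h]
      map_smul' := fun c x => by
        ext i
        rcases h : e.symm i with a | b <;> simp [h] }

/-- Extension by zero in the second set of coordinates of a splitting. -/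
def inL (e : α ⊕ β ≃ ι) : EuclideanSpace ℝ α →L[ℝ] EuclideanSpace ℝ ι :=
  LinearMap.toContinuousLinearMap
    { toFun := fun b => WithLp.toLp 2 fun i => Sum.elim b 0 (e.symm i)
      map_add' := fun x y => by
        ext i
        rcases h : e.symm i with a | b <;> simp [h]
      map_smul' := fun c x => by
        ext i
        rcases h : e.symm i with a | b <;> simp [h] }

variable (e : α ⊕ β ≃ ι)

theorem inR_apply (b : EuclideanSpace ℝ β) (i : ι) : inR e b i =
    Sum.elim (0 : α → ℝ) b (e.symm i) := rfl

theorem inL_apply (a : EuclideanSpace ℝ α) (i : ι) : inL e a i =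
    Sum.elim a (0 : β → ℝ) (e.symm i) := rfl

@[simp]
theorem pull_inl_inR (b : EuclideanSpace ℝ β) : pull (fun k => e (Sum.inl k)) (inR e b) = 0 := by
  ext k; simp [inR_apply]

@[simp]
theorem pull_inl_inL (a : EuclideanSpace ℝ α) : pull (fun k => e (Sum.inl k)) (inL e a) = a := by
  ext k; simp [inL_apply]

theorem inL_pull_add_inR_pull (Z : EuclideanSpace ℝ ι) :
    inL e (pull (fun k => e (Sum.inl k)) Z) + inR e (pull (fun k => e (Sum.inr k)) Z) = Z := by
  ext i
  obtain ⟨j, rfl⟩ := e.surjective i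
  rcases j with j | j <;> simp [inL_apply, inR_apply]

theorem inR_single [DecidableEq β] [DecidableEq ι] (b : β) :
    inR e (EuclideanSpace.single b 1) = EuclideanSpace.single (e (Sum.inr b)) 1 := by
  ext i
  obtain ⟨j, rfl⟩ := e.surjective i
  rcases j with j | j <;> simp [inR_apply, Pi.single_apply]

/-- The splitting of the coordinates as a measurable equivalence. -/
def splitEquiv : EuclideanSpace ℝ α × EuclideanSpace ℝ β ≃ᵐ EuclideanSpace ℝ ι :=
  ((MeasurableEquiv.toLp 2 (α → ℝ)).symm.prodCongr (MeasurableEquiv.toLp 2 (β → ℝ)).symm).trans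
    ((MeasurableEquiv.sumPiEquivProdPi (fun _ : α ⊕ β => ℝ)).symm.trans
      ((MeasurableEquiv.arrowCongr' e (MeasurableEquiv.refl ℝ)).trans
        (MeasurableEquiv.toLp 2 (ι → ℝ))))

theorem splitEquiv_apply (p : EuclideanSpace ℝ α × EuclideanSpace ℝ β) :
    splitEquiv e p = inL e p.1 + inR e p.2 := by
  ext i
  obtain ⟨j, rfl⟩ := e.surjective i
  have h : splitEquiv e p (e j) = Sum.elim p.1 p.2 (e.symm (e j)) := by
    change (Equiv.sumPiEquivProdPi (fun _ : α ⊕ β => ℝ)).symm (p.1.ofLp, p.2.ofLp)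
      (e.symm (e j)) = _
    rcases e.symm (e j) with k | k <;> rfl
  rw [h]
  rcases j with j | j <;> simp [inL_apply, inR_apply]

theorem measurePreserving_splitEquiv : MeasurePreserving (splitEquiv e) := by
  refine MeasurePreserving.trans (μb := volume) (e := (MeasurableEquiv.toLp 2 (α → ℝ)).symm.prodCongr
    (MeasurableEquiv.toLp 2 (β → ℝ)).symm) ?_ (MeasurePreserving.trans (μb := volume)
    (volume_measurePreserving_sumPiEquivProdPi_symm _) (MeasurePreserving.trans (μb := volume)
    (volume_preserving_arrowCongr' _ _ (MeasurePreserving.id _)) (PiLp.volume_preserving_toLp ι)))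
  exact (PiLp.volume_preserving_ofLp α).prod (PiLp.volume_preserving_ofLp β)

theorem lintegral_eq_lintegral_split {f : EuclideanSpace ℝ ι → ℝ≥0∞} (hf : Measurable f) :
    ∫⁻ Z, f Z = ∫⁻ a, ∫⁻ b, f (inL e a + inR e b) := by
  rw [← (measurePreserving_splitEquiv e).lintegral_comp hf, Measure.volume_eq_prod,
    lintegral_prod (fun p => f (splitEquiv e p))
      (hf.comp (splitEquiv e).measurable).aemeasurable]
  simp only [splitEquiv_apply]

theorem integral_eq_integral_split {f : EuclideanSpace ℝ ι → ℂ} (hf : Integrable f) :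
    ∫ Z, f Z = ∫ b, ∫ a, f (inL e a + inR e b) := by
  have h := (measurePreserving_splitEquiv e).integrable_comp_of_integrable hf
  rw [← (measurePreserving_splitEquiv e).integral_comp', Measure.volume_eq_prod,
    integral_prod_symm (fun p => f (splitEquiv e p)) h]
  simp only [splitEquiv_apply]

variable {e}

theorem gradient_apply [DecidableEq ι] (φ : EuclideanSpace ℝ ι → ℝ) (X : EuclideanSpace ℝ ι)
    (i : ι) : gradient φ X i = fderiv ℝ φ X (EuclideanSpace.single i 1) := by
  rw [← toDual_gradient (𝕜 := ℝ), InnerProductSpace.toDual_apply_apply,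
    EuclideanSpace.inner_single_right]
  simp

theorem continuous_gradient {φ : EuclideanSpace ℝ ι → ℝ} (hφ : ContDiff ℝ 2 φ) :
    Continuous (gradient φ) :=
  (InnerProductSpace.toDual ℝ _).symm.continuous.comp (hφ.continuous_fderiv (by norm_num))

/-- The change of variables `b ↦ φ'_{e'}(x₀ + b)`. -/
theorem lintegral_comp_gradient_le [DecidableEq β] [DecidableEq ι] (e e' : α ⊕ β ≃ ι)
    {φ : EuclideanSpace ℝ ι → ℝ} (hφ : ContDiff ℝ 2 φ)
    (hb : ∀ i j, ∃ B, ∀ X, |secondPartial φ i j X| ≤ B)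
    (huc : ∀ i j, UniformContinuous (secondPartial φ i j)) {d : ℝ} (hd : 0 < d)
    (hdet : ∀ X, d ≤ |(Matrix.of fun a b : β =>
      secondPartial φ (e (Sum.inr b)) (e' (Sum.inr a)) X).det|) (x₀ : EuclideanSpace ℝ ι)
    (h : EuclideanSpace ℝ β → ℝ≥0∞) :
    ∫⁻ b, h (pull (fun k => e' (Sum.inr k)) (gradient φ (x₀ + inR e b))) ≤
      ENNReal.ofReal d⁻¹ * ∫⁻ b, h b := by
  set E : β → β → EuclideanSpace ℝ β →L[ℝ] EuclideanSpace ℝ β := fun a b =>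
    (EuclideanSpace.proj (𝕜 := ℝ) b).smulRight (EuclideanSpace.single a (1 : ℝ)) with hE
  set F' : EuclideanSpace ℝ β → EuclideanSpace ℝ β →L[ℝ] EuclideanSpace ℝ β := fun W =>
    ∑ a, ∑ b, secondPartial φ (e (Sum.inr b)) (e' (Sum.inr a)) (x₀ + inR e W) • E a b with hF'
  choose B hB using hb
  have happ : ∀ W v a, F' W v a = ∑ b, v b *
      secondPartial φ (e (Sum.inr b)) (e' (Sum.inr a)) (x₀ + inR e W) := by
    intro W v a
    simp only [hF', hE, sum_apply, smul_apply, ContinuousLinearMap.smulRight_apply,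
      EuclideanSpace.coe_proj, WithLp.ofLp_sum, Finset.sum_apply, WithLp.ofLp_smul, Pi.smul_apply,
      smul_eq_mul, PiLp.single_apply]
    rw [Finset.sum_eq_single a]
    · refine Finset.sum_congr rfl fun b _ => ?_
      simp
      ring
    · intro a' _ ha'
      simp [Ne.symm ha']
    · simp
  have hderiv : ∀ W, HasFDerivAt
      (fun W => pull (fun k => e' (Sum.inr k)) (gradient φ (x₀ + inR e W))) (F' W) W := by
    intro W
    rw [← hasFDerivWithinAt_univ, hasFDerivWithinAt_euclidean]
    intro a
    rw [hasFDerivWithinAt_univ]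
    simp only [pull_apply, gradient_apply]
    have h1 : HasFDerivAt (fun W => x₀ + inR e W) (inR e) W := (inR e).hasFDerivAt.const_add x₀
    have h2 := (((contDiff_fderiv_apply hφ (EuclideanSpace.single (e' (Sum.inr a)) 1)).differentiable
      (by norm_num)) (x₀ + inR e W)).hasFDerivAt.comp W h1
    refine h2.congr_fderiv ?_
    ext v
    change fderiv ℝ (fun X => fderiv ℝ φ X (EuclideanSpace.single (e' (Sum.inr a)) 1))
      (x₀ + inR e W) (inR e v) = F' W v a
    rw [happ]
    refine (map_eq_sum_single ((fderiv ℝ (fun X => fderiv ℝ φ X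
      (EuclideanSpace.single (e' (Sum.inr a)) 1)) (x₀ + inR e W)).comp (inR e)) v).trans ?_
    refine Finset.sum_congr rfl fun b _ => ?_
    rw [ContinuousLinearMap.comp_apply, inR_single]
    rfl
  have hF'uc : UniformContinuous F' := by
    refine Finset.uniformContinuous_sum _ fun a _ => Finset.uniformContinuous_sum _ fun b _ => ?_
    have h1 : UniformContinuous fun W : EuclideanSpace ℝ β => x₀ + inR e W :=
      uniformContinuous_const.add (inR e).uniformContinuous
    have h2 := (huc (e (Sum.inr b)) (e' (Sum.inr a))).comp h1
    exact ((ContinuousLinearMap.id ℝ ℝ).smulRight (E a b)).uniformContinuous.comp h2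
  have hF'b : ∀ W, ‖F' W‖ ≤ ∑ a, ∑ b, B (e (Sum.inr b)) (e' (Sum.inr a)) * ‖E a b‖ := by
    intro W
    refine norm_sum_le_of_le _ fun a _ => norm_sum_le_of_le _ fun b _ => ?_
    rw [norm_smul]
    gcongr
    exact hB _ _ _
  have hF'd : ∀ W, d ≤ |(F' W).det| := by
    intro W
    have h1 : (F' W).det = (Matrix.of fun a b : β =>
        secondPartial φ (e (Sum.inr b)) (e' (Sum.inr a)) (x₀ + inR e W)).det := by
      change LinearMap.det (F' W : EuclideanSpace ℝ β →ₗ[ℝ] EuclideanSpace ℝ β) = _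
      rw [← LinearMap.det_toMatrix (EuclideanSpace.basisFun β ℝ).toBasis]
      congr 1
      ext a b
      rw [LinearMap.toMatrix_apply]
      simp [happ]
    rw [h1]
    exact hdet _
  exact lintegral_comp_le_of_det volume hderiv hF'uc hF'b hd hF'd h

/-- The integral over `η` exhausts the first group of frequencies of `e'`, leaving a function of the
second group of components of `θ - φ'(Z)`. Of the position, the first group of `e` is integrated by
decay. The second group is substituted by the remaining gradient components, for which the
determinant is the Jacobian. -/
theorem lintegral_decay_mul_comp_gradient_le [DecidableEq β] [DecidableEq ι] (e e' : α ⊕ β ≃ ι)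
    {φ : EuclideanSpace ℝ ι → ℝ} (hφ : ContDiff ℝ 2 φ)
    (hb : ∀ i j, ∃ B, ∀ X, |secondPartial φ i j X| ≤ B)
    (huc : ∀ i j, UniformContinuous (secondPartial φ i j)) {d : ℝ} (hd : 0 < d)
    (hdet : ∀ X, d ≤ |(Matrix.of fun a b : β =>
      secondPartial φ (e (Sum.inr b)) (e' (Sum.inr a)) X).det|)
    {h : EuclideanSpace ℝ ι → ℝ≥0∞} (hh : Measurable h) (M : ℕ) (θ : EuclideanSpace ℝ ι)
    (u : EuclideanSpace ℝ α) :
    ∫⁻ η, ∫⁻ Z, ENNReal.ofReal (decay M (pull (fun k => e (Sum.inl k)) Z - u)) *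
        h (θ + inL e' η - gradient φ Z) ≤
      (∫⁻ a : EuclideanSpace ℝ α, ENNReal.ofReal (decay M a)) *
        (ENNReal.ofReal d⁻¹ * ∫⁻ Z, h Z) := by
  have hg := continuous_gradient hφ
  have hdm : Measurable fun a : EuclideanSpace ℝ α => ENNReal.ofReal (decay M a) :=
    (continuous_decay M).measurable.ennreal_ofReal
  -- The marginal of `h` in the frequencies complementary to those swept out by `η`; its total
  -- integral is that of `h`.
  set H : EuclideanSpace ℝ β → ℝ≥0∞ := fun τ => ∫⁻ η, h (inL e' η + inR e' τ) with hH
  have hHm : Measurable H := by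
    have h1 : Measurable fun p : EuclideanSpace ℝ β × EuclideanSpace ℝ α =>
        h (inL e' p.2 + inR e' p.1) := hh.comp (by fun_prop)
    exact h1.lintegral_prod_right'
  have hHi : ∫⁻ τ, H τ = ∫⁻ Z, h Z := by
    rw [lintegral_eq_lintegral_split e' hh, hH]
    exact lintegral_lintegral_swap (Measurable.aemeasurable (hh.comp (by fun_prop)))
  have hη : ∀ Z, ∫⁻ η, h (θ + inL e' η - gradient φ Z) =
      H (pull (fun k => e' (Sum.inr k)) θ - pull (fun k => e' (Sum.inr k)) (gradient φ Z)) := by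
    intro Z
    rw [hH, ← map_sub]
    simp only
    rw [← lintegral_add_right_eq_self
      (fun η => h (inL e' η + inR e' (pull (fun k => e' (Sum.inr k)) (θ - gradient φ Z))))
      (pull (fun k => e' (Sum.inl k)) (θ - gradient φ Z))]
    refine lintegral_congr fun η => ?_
    congr 1
    have h1 := inL_pull_add_inR_pull e' (θ - gradient φ Z)
    rw [map_add]
    generalize inL e' (pull (fun k => e' (Sum.inl k)) (θ - gradient φ Z)) = p at h1 ⊢
    rw [eq_sub_of_add_eq' h1]
    abel
  rw [lintegral_lintegral_swap]
  swap
  · refine Measurable.aemeasurable (Measurable.mul ?_ (hh.comp ?_))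
    · exact hdm.comp (by fun_prop)
    · exact Continuous.measurable (by fun_prop)
  simp only [lintegral_const_mul' _ _ ENNReal.ofReal_ne_top, hη]
  rw [lintegral_eq_lintegral_split e]
  swap
  · refine Measurable.mul (hdm.comp (by fun_prop)) (hHm.comp ?_)
    exact Continuous.measurable (by fun_prop)
  simp only [map_add, pull_inl_inL, pull_inl_inR, add_zero]
  have hin : ∀ a, ∫⁻ b, ENNReal.ofReal (decay M (a - u)) *
      H (pull (fun k => e' (Sum.inr k)) θ -
        pull (fun k => e' (Sum.inr k)) (gradient φ (inL e a + inR e b))) ≤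
      ENNReal.ofReal (decay M (a - u)) * (ENNReal.ofReal d⁻¹ * ∫⁻ Z, h Z) := by
    intro a
    rw [lintegral_const_mul' _ _ ENNReal.ofReal_ne_top, ← hHi,
      ← lintegral_sub_left_eq_self H (pull (fun k => e' (Sum.inr k)) θ)]
    gcongr
    exact lintegral_comp_gradient_le e e' hφ hb huc hd hdet (inL e a)
      (fun τ => H (pull (fun k => e' (Sum.inr k)) θ - τ))
  refine (lintegral_mono hin).trans ?_
  rw [lintegral_mul_const _ (show Measurable fun a => ENNReal.ofReal (decay M (a - u)) from
    hdm.comp (by fun_prop)), lintegral_sub_right_eq_self (fun a => ENNReal.ofReal (decay M a)) u]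

end Split

/-! ### Oscillatory integrals between three wave packets -/

section Kernel

variable {α σ ι : Type} [Fintype α] [Fintype σ] [Fintype ι]

theorem norm_apply_le_decay (M : ℕ) (f : 𝓢(EuclideanSpace ℝ ι, ℂ)) (x : EuclideanSpace ℝ ι) :
    ‖f x‖ ≤ 2 ^ M * schwartzNorm M f * decay M x := by
  have h := one_add_pow_mul_apply_le_schwartzNorm (K := M) le_rfl f x
  have h1 : (0 : ℝ) < (1 + ‖x‖) ^ M := by positivity
  rw [decay, ← div_eq_mul_inv, le_div_iff₀' h1]
  exact h

theorem eq_zero_of_schwartzNorm_eq_zero {M : ℕ} {f : 𝓢(EuclideanSpace ℝ ι, ℂ)}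
    (h : schwartzNorm M f = 0) (x : EuclideanSpace ℝ ι) : f x = 0 := by
  have := norm_apply_le_decay M f x
  rw [h, mul_zero, zero_mul] at this
  exact norm_le_zero_iff.1 this

theorem expInner_comp (A : EuclideanSpace ℝ ι →L[ℝ] EuclideanSpace ℝ σ)
    (ξ : EuclideanSpace ℝ σ) (Y : EuclideanSpace ℝ ι) :
    expInner ξ (A Y) = expInner (A.adjoint ξ) Y := by
  rw [expInner, expInner, ContinuousLinearMap.adjoint_inner_right]

variable (φ : EuclideanSpace ℝ ι → ℝ) (P Q : EuclideanSpace ℝ ι →L[ℝ] EuclideanSpace ℝ α)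
  (R : EuclideanSpace ℝ ι →L[ℝ] EuclideanSpace ℝ σ)

/-- The function `exp (i φ (Y)) f (Q Y) g (P Y)`, paired with a time-frequency shift of `κ` in the
variables `R Y`. -/
def kerFun (f g : 𝓢(EuclideanSpace ℝ α, ℂ)) (κ : 𝓢(EuclideanSpace ℝ σ, ℂ))
    (l : EuclideanSpace ℝ σ × EuclideanSpace ℝ σ) (Y : EuclideanSpace ℝ ι) : ℂ :=
  Complex.exp (Complex.I * φ Y) * f (Q Y) * g (P Y) * tfShift κ l.1 (-l.2) (R Y)

/-- The integral of `kerFun`. -/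
def kerInt (f g : 𝓢(EuclideanSpace ℝ α, ℂ)) (κ : 𝓢(EuclideanSpace ℝ σ, ℂ))
    (l : EuclideanSpace ℝ σ × EuclideanSpace ℝ σ) : ℂ :=
  ∫ Y, kerFun φ P Q R f g κ l Y

variable {φ P Q R}

theorem norm_exp_I_mul_ofReal (t : ℝ) : ‖Complex.exp (Complex.I * t)‖ = 1 := by
  rw [mul_comm, Complex.norm_exp_ofReal_mul_I]

theorem exp_phase_eq (Z Y : EuclideanSpace ℝ ι) : Complex.exp (Complex.I * φ (Z + Y)) =
    Complex.exp (Complex.I * φ Z) * Complex.exp (Complex.I * taylorRem φ Z Y) *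
      expInner (-gradient φ Z) Y := by
  have h : fderiv ℝ φ Z Y = inner ℝ Y (gradient φ Z) := by
    rw [← toDual_gradient (𝕜 := ℝ), InnerProductSpace.toDual_apply_apply, real_inner_comm]
  rw [expInner, ← Complex.exp_add, ← Complex.exp_add, inner_neg_right, ← h, taylorRem]
  congr 1
  push_cast
  ring

theorem continuous_kerFun (hφ : Continuous φ) (f g : 𝓢(EuclideanSpace ℝ α, ℂ))
    (κ : 𝓢(EuclideanSpace ℝ σ, ℂ)) (l : EuclideanSpace ℝ σ × EuclideanSpace ℝ σ) :
    Continuous (kerFun φ P Q R f g κ l) := by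
  have h1 := f.continuous
  have h2 := g.continuous
  have h3 := (tfShift κ l.1 (-l.2)).continuous
  unfold kerFun
  fun_prop

/-- The coordinates `Q Y` and `R Y` together control all of `Y`, so the decay of `f` and `κ`
suffices for integrability and `g` only has to be bounded. -/
theorem norm_kerFun_le (hR : ∀ Y, ‖Y‖ ≤ ‖Q Y‖ + ‖R Y‖) (M : ℕ)
    (f g : 𝓢(EuclideanSpace ℝ α, ℂ)) (κ : 𝓢(EuclideanSpace ℝ σ, ℂ))
    (l : EuclideanSpace ℝ σ × EuclideanSpace ℝ σ) (Y : EuclideanSpace ℝ ι) :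
    ‖kerFun φ P Q R f g κ l Y‖ ≤ 2 ^ M * schwartzNorm M f * ‖g (P Y)‖ *
      (2 ^ M * schwartzNorm M (tfShift κ l.1 (-l.2))) * decay M Y := by
  have h1 := norm_apply_le_decay M f (Q Y)
  have h2 := norm_apply_le_decay M (tfShift κ l.1 (-l.2)) (R Y)
  have h3 := schwartzNorm_nonneg M f
  have h4 := schwartzNorm_nonneg M (tfShift κ l.1 (-l.2))
  have h5 : decay M (Q Y) * decay M (R Y) ≤ decay M Y := by
    unfold decay
    rw [← mul_inv, ← mul_pow]
    gcongr
    nlinarith [hR Y, norm_nonneg (Q Y), norm_nonneg (R Y)]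
  rw [kerFun, norm_mul, norm_mul, norm_mul, norm_exp_I_mul_ofReal, one_mul]
  calc _ ≤ 2 ^ M * schwartzNorm M f * decay M (Q Y) * ‖g (P Y)‖ *
        (2 ^ M * schwartzNorm M (tfShift κ l.1 (-l.2)) * decay M (R Y)) := by
        gcongr
        have := (decay_pos M (Q Y)).le
        positivity
    _ = 2 ^ M * schwartzNorm M f * ‖g (P Y)‖ *
        (2 ^ M * schwartzNorm M (tfShift κ l.1 (-l.2))) * (decay M (Q Y) * decay M (R Y)) := by ring
    _ ≤ _ := by gcongr

theorem integrable_kerFun (hφ : Continuous φ) (hR : ∀ Y, ‖Y‖ ≤ ‖Q Y‖ + ‖R Y‖)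
    (f g : 𝓢(EuclideanSpace ℝ α, ℂ)) (κ : 𝓢(EuclideanSpace ℝ σ, ℂ))
    (l : EuclideanSpace ℝ σ × EuclideanSpace ℝ σ) : Integrable (kerFun φ P Q R f g κ l) := by
  set M := Fintype.card ι + 1
  refine Integrable.mono' ((integrable_decay (ι := ι) (Nat.lt_succ_self _)).const_mul
    (2 ^ M * schwartzNorm M f * (2 ^ 0 * schwartzNorm 0 g) *
      (2 ^ M * schwartzNorm M (tfShift κ l.1 (-l.2)))))
    (continuous_kerFun hφ f g κ l).aestronglyMeasurable (Filter.Eventually.of_forall fun Y => ?_)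
  refine (norm_kerFun_le hR M f g κ l Y).trans ?_
  have h1 := norm_apply_le_decay 0 g (P Y)
  have h3 := schwartzNorm_nonneg M f
  have h4 := schwartzNorm_nonneg M (tfShift κ l.1 (-l.2))
  have h5 := (decay_pos M Y).le
  simp only [decay, pow_zero, inv_one, mul_one] at h1
  gcongr
  simpa using h1

/-- A continuous partition of unity: the translates of `ρ` integrate to one. The pieces are all of
the same shape, which permits estimates uniform in the centre `Z`. -/
theorem integral_eq_integral_localized {G : EuclideanSpace ℝ ι → ℂ} (hG : Integrable G)
    (ρ : 𝓢(EuclideanSpace ℝ ι, ℂ)) (hρ : ∫ Y, ρ Y = 1) :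
    ∫ Z, G Z = ∫ Z, ∫ Y, G (Z + Y) * ρ Y := by
  have h1 : Integrable (fun p : EuclideanSpace ℝ ι × EuclideanSpace ℝ ι =>
      ρ (-p.2) * G (p.1 - p.2)) (volume.prod volume) :=
    Integrable.convolution_integrand (μ := (volume : Measure (EuclideanSpace ℝ ι)))
      (ν := volume) (ContinuousLinearMap.mul ℂ ℂ) ρ.integrable.comp_neg hG
  have h2 : ∀ Z, ∫ Y, G (Z + Y) * ρ Y = ∫ t, ρ (-t) * G (Z - t) := fun Z => by
    rw [← integral_neg_eq_self]
    simp only [sub_eq_add_neg, mul_comm]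
  simp only [h2]
  rw [integral_integral_swap h1]
  have h3 : ∀ t, ∫ Z, ρ (-t) * G (Z - t) = ρ (-t) * ∫ Z, G Z := fun t => by
    rw [integral_const_mul, integral_sub_right_eq_self G t]
  simp only [h3]
  rw [integral_mul_const, integral_neg_eq_self (fun t => ρ t), hρ, one_mul]

/-- The frequency of the localized oscillating integrand. -/
def kerFreq (φ : EuclideanSpace ℝ ι → ℝ) (P Q : EuclideanSpace ℝ ι →L[ℝ] EuclideanSpace ℝ α)
    (R : EuclideanSpace ℝ ι →L[ℝ] EuclideanSpace ℝ σ)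
    (z w : EuclideanSpace ℝ α × EuclideanSpace ℝ α)
    (l : EuclideanSpace ℝ σ × EuclideanSpace ℝ σ) (Z : EuclideanSpace ℝ ι) :
    EuclideanSpace ℝ ι :=
  P.adjoint w.2 - Q.adjoint z.2 - R.adjoint l.2 - gradient φ Z

/-- The localization of the amplitude of the oscillating integrand. -/
def kerAmp (P Q : EuclideanSpace ℝ ι →L[ℝ] EuclideanSpace ℝ α)
    (R : EuclideanSpace ℝ ι →L[ℝ] EuclideanSpace ℝ σ) (ρ : 𝓢(EuclideanSpace ℝ ι, ℂ))
    (γ g : 𝓢(EuclideanSpace ℝ α, ℂ)) (κ : 𝓢(EuclideanSpace ℝ σ, ℂ)) (s t : EuclideanSpace ℝ α)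
    (r : EuclideanSpace ℝ σ) : 𝓢(EuclideanSpace ℝ ι, ℂ) :=
  mulComp (mulComp (mulComp ρ γ Q s) g P t) κ R r

/-- Three applications of `schwartzNorm_mulComp_le`, each losing `M` orders of regularity and
gaining decay in one of the three offsets between `Z` and the centres of the wave packets. -/
theorem exists_schwartzNorm_kerAmp_le (P Q : EuclideanSpace ℝ ι →L[ℝ] EuclideanSpace ℝ α)
    (R : EuclideanSpace ℝ ι →L[ℝ] EuclideanSpace ℝ σ) (ρ : 𝓢(EuclideanSpace ℝ ι, ℂ)) (K M : ℕ) :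
    ∃ (K' : ℕ) (C : ℝ), 0 < C ∧ ∀ γ g κ s t r,
      schwartzNorm K (kerAmp P Q R ρ γ g κ s t r) ≤
        C * (schwartzNorm K' γ * schwartzNorm K' g * schwartzNorm K' κ) *
          (decay M s * decay M t * decay M r) := by
  have hstep : ∀ {τ : Type} [Fintype τ] (A : EuclideanSpace ℝ ι →L[ℝ] EuclideanSpace ℝ τ) (K : ℕ),
      ∃ C : ℝ, 0 < C ∧ ∀ (ρ : 𝓢(EuclideanSpace ℝ ι, ℂ)) (g : 𝓢(EuclideanSpace ℝ τ, ℂ)) s,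
        schwartzNorm K (mulComp ρ g A s) ≤
          C * (schwartzNorm (K + M) ρ * schwartzNorm (K + M) g) * decay M s := by
    intro τ _ A K
    obtain ⟨C, hC, h⟩ := schwartzNorm_mulComp_le A K M
    refine ⟨C, hC, fun ρ g s => ?_⟩
    have h1 : (0 : ℝ) < (1 + ‖s‖) ^ M := by positivity
    rw [decay, ← div_eq_mul_inv, le_div_iff₀' h1]
    exact h ρ g s
  obtain ⟨C₁, hC₁, h₁⟩ := hstep R K
  obtain ⟨C₂, hC₂, h₂⟩ := hstep P (K + M)
  obtain ⟨C₃, hC₃, h₃⟩ := hstep Q (K + M + M)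
  refine ⟨K + M + M + M, C₁ * C₂ * C₃ * (schwartzNorm (K + M + M + M) ρ + 1), ?_, ?_⟩
  · have := schwartzNorm_nonneg (K + M + M + M) ρ
    positivity
  intro γ g κ s t r
  have hρ := schwartzNorm_nonneg (K + M + M + M) ρ
  have hγ := schwartzNorm_nonneg (K + M + M + M) γ
  have hg := schwartzNorm_nonneg (K + M + M + M) g
  have hκ := schwartzNorm_nonneg (K + M + M + M) κ
  have hg0 := schwartzNorm_nonneg (K + M + M) g
  have hκ0 := schwartzNorm_nonneg (K + M) κ
  have ds := (decay_pos M s).le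
  have dt := (decay_pos M t).le
  have dr := (decay_pos M r).le
  have hg' : schwartzNorm (K + M + M) g ≤ schwartzNorm (K + M + M + M) g :=
    schwartzNorm_mono (by omega) g
  have hκ' : schwartzNorm (K + M) κ ≤ schwartzNorm (K + M + M + M) κ :=
    schwartzNorm_mono (by omega) κ
  calc _ ≤ C₁ * (schwartzNorm (K + M) (mulComp (mulComp ρ γ Q s) g P t) *
        schwartzNorm (K + M) κ) * decay M r := h₁ _ κ r
    _ ≤ C₁ * (C₂ * (C₃ * (schwartzNorm (K + M + M + M) ρ * schwartzNorm (K + M + M + M) γ) *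
        decay M s * schwartzNorm (K + M + M) g) * decay M t * schwartzNorm (K + M) κ) *
        decay M r := by
        gcongr
        refine (h₂ _ g t).trans ?_
        gcongr
        exact h₃ ρ γ s
    _ ≤ C₁ * (C₂ * (C₃ * ((schwartzNorm (K + M + M + M) ρ + 1) *
        schwartzNorm (K + M + M + M) γ) * decay M s * schwartzNorm (K + M + M + M) g) *
        decay M t * schwartzNorm (K + M + M + M) κ) * decay M r := by
        gcongr
        linarith
    _ = _ := by ring

/-- Everything linear in `Y` in the exponent is collected into one character of frequency `kerFreq`.
What does not depend on `Y` has modulus one, and only the Taylor remainder stays in the amplitude.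
-/
theorem kerFun_mul_eq (γ g : 𝓢(EuclideanSpace ℝ α, ℂ)) (κ : 𝓢(EuclideanSpace ℝ σ, ℂ))
    (ρ : 𝓢(EuclideanSpace ℝ ι, ℂ)) (z w : EuclideanSpace ℝ α × EuclideanSpace ℝ α)
    (l : EuclideanSpace ℝ σ × EuclideanSpace ℝ σ) (Z Y : EuclideanSpace ℝ ι) :
    kerFun φ P Q R (tfShift γ z.1 (-z.2)) (tfShift g w.1 w.2) κ l (Z + Y) * ρ Y =
      Complex.exp (Complex.I * φ Z) * expInner (-z.2) (Q Z) * expInner w.2 (P Z) *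
        expInner (-l.2) (R Z) * (Complex.exp (Complex.I * taylorRem φ Z Y) *
          kerAmp P Q R ρ γ g κ (Q Z - z.1) (P Z - w.1) (R Z - l.1) Y *
            expInner (kerFreq φ P Q R z w l Z) Y) := by
  have h1 : expInner (kerFreq φ P Q R z w l Z) Y = expInner w.2 (P Y) * expInner (-z.2) (Q Y) *
      expInner (-l.2) (R Y) * expInner (-gradient φ Z) Y := by
    rw [expInner_comp, expInner_comp, expInner_comp, ← expInner_add_left, ← expInner_add_left,
      ← expInner_add_left, kerFreq, map_neg, map_neg]
    simp only [sub_eq_add_neg]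
  rw [h1, kerFun, exp_phase_eq, kerAmp, mulComp_apply, mulComp_apply, mulComp_apply,
    tfShift_apply, tfShift_apply, tfShift_apply, map_add, map_add, map_add, expInner_add_right,
    expInner_add_right, expInner_add_right]
  have e1 : Q Y + (Q Z - z.1) = Q Z + Q Y - z.1 := by abel
  have e2 : P Y + (P Z - w.1) = P Z + P Y - w.1 := by abel
  have e3 : R Y + (R Z - l.1) = R Z + R Y - l.1 := by abel
  rw [e1, e2, e3]
  ring

theorem exists_unit_mollifier (ι : Type) [Fintype ι] : ∃ ρ : 𝓢(EuclideanSpace ℝ ι, ℂ),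
    (∀ Y, 1 < ‖Y‖ → ρ Y = 0) ∧ ∫ Y, ρ Y = 1 := by
  let f : ContDiffBump (0 : EuclideanSpace ℝ ι) := ⟨1 / 2, 1, by norm_num, by norm_num⟩
  have h1 : HasCompactSupport (fun Y => ((f.normed volume Y : ℝ) : ℂ)) :=
    HasCompactSupport.comp_left (g := Complex.ofReal) f.hasCompactSupport_normed
      Complex.ofReal_zero
  have h2 : ContDiff ℝ (⊤ : ℕ∞) (fun Y => ((f.normed volume Y : ℝ) : ℂ)) :=
    Complex.ofRealCLM.contDiff.comp f.contDiff_normed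
  refine ⟨h1.toSchwartzMap h2, fun Y hY => ?_, ?_⟩
  · have h3 : f.normed volume Y = 0 := by
      have h4 : Y ∉ Function.support (f.normed volume) := by
        rw [f.support_normed_eq]
        have : f.rOut = 1 := rfl
        simp [this, hY.le]
      simpa using h4
    change ((f.normed volume Y : ℝ) : ℂ) = 0
    rw [h3, Complex.ofReal_zero]
  · change ∫ Y, ((f.normed volume Y : ℝ) : ℂ) = 1
    rw [integral_complex_ofReal, f.integral_normed, Complex.ofReal_one]

/-- The estimate of the kernels of the operators between two atoms, where `b` is a majorant of the
Fourier transforms of localizations of `exp (i φ)`. -/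
theorem exists_kerInt_bound (P Q : EuclideanSpace ℝ ι →L[ℝ] EuclideanSpace ℝ α)
    (R : EuclideanSpace ℝ ι →L[ℝ] EuclideanSpace ℝ σ) (hR : ∀ Y, ‖Y‖ ≤ ‖Q Y‖ + ‖R Y‖) (N M : ℕ) :
    ∃ (K : ℕ) (C : ℝ), 0 < C ∧ ∀ (φ : EuclideanSpace ℝ ι → ℝ) (b : EuclideanSpace ℝ ι → ℝ≥0∞),
      ContDiff ℝ 2 φ →
      (∀ (Z : EuclideanSpace ℝ ι) (h : EuclideanSpace ℝ ι → ℂ), Continuous h →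
        (∀ Y, 1 < ‖Y‖ → h Y = 0) → (∀ Θ, ‖fourInt h Θ‖ₑ ≤ ENNReal.ofReal (decay N Θ)) →
        ∀ Θ, ‖fourInt (fun Y => Complex.exp (Complex.I * taylorRem φ Z Y) * h Y) Θ‖ₑ ≤ b Θ) →
      ∀ γ g κ z w l,
        ‖kerInt φ P Q R (tfShift γ z.1 (-z.2)) (tfShift g w.1 w.2) κ l‖ₑ ≤
          ENNReal.ofReal (C * (schwartzNorm K γ * schwartzNorm K g * schwartzNorm K κ)) *
            ∫⁻ Z, ENNReal.ofReal (decay M (Q Z - z.1) * decay M (P Z - w.1) * decay M (R Z - l.1)) *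
              b (kerFreq φ P Q R z w l Z) := by
  obtain ⟨ρ, hρ0, hρ1⟩ := exists_unit_mollifier ι
  obtain ⟨K₀, C₀, hC₀, h₀⟩ := fourInt_decay ι N
  obtain ⟨K, C, hC, hK⟩ := exists_schwartzNorm_kerAmp_le P Q R ρ K₀ M
  refine ⟨K, C₀ * C, by positivity, fun φ b hφ hb γ g κ z w l => ?_⟩
  set t := schwartzNorm K γ * schwartzNorm K g * schwartzNorm K κ with ht
  have hγ := schwartzNorm_nonneg K γ
  have hg := schwartzNorm_nonneg K g
  have hκ := schwartzNorm_nonneg K κ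
  have ht0 : 0 ≤ t := by positivity
  -- The amplitude is normalized below by dividing by a multiple of `t`. If `t = 0`, one of the
  -- three functions vanishes identically and so does the integral.
  rcases ht0.eq_or_lt with h0 | h0
  · have hz : ∀ Y, kerFun φ P Q R (tfShift γ z.1 (-z.2)) (tfShift g w.1 w.2) κ l Y = 0 := by
      intro Y
      simp only [kerFun, tfShift_apply]
      rcases mul_eq_zero.1 (ht ▸ h0.symm) with h1 | h1
      · rcases mul_eq_zero.1 h1 with h2 | h2
        · simp [eq_zero_of_schwartzNorm_eq_zero h2]
        · simp [eq_zero_of_schwartzNorm_eq_zero h2]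
      · simp [eq_zero_of_schwartzNorm_eq_zero h1]
    simp [kerInt, hz]
  rw [kerInt, integral_eq_integral_localized (integrable_kerFun hφ.continuous hR _ _ κ l) ρ hρ1]
  refine (enorm_integral_le_lintegral_enorm _).trans ?_
  rw [← lintegral_const_mul' _ _ ENNReal.ofReal_ne_top]
  refine lintegral_mono fun Z => ?_
  simp only [kerFun_mul_eq]
  set A := kerAmp P Q R ρ γ g κ (Q Z - z.1) (P Z - w.1) (R Z - l.1) with hA
  set D := decay M (Q Z - z.1) * decay M (P Z - w.1) * decay M (R Z - l.1) with hD
  have hD0 : 0 < D := mul_pos (mul_pos (decay_pos _ _) (decay_pos _ _)) (decay_pos _ _)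
  -- After division by `s` the Fourier transform of the amplitude lies below `decay N`, the single
  -- function for which `b` is a majorant; multiplying back restores the decay `D`.
  set s : ℝ := C₀ * C * t * D with hs
  have hs0 : 0 < s := by positivity
  have hA0 : ∀ Y, 1 < ‖Y‖ → A Y = 0 := fun Y hY => by
    rw [hA, kerAmp, mulComp_apply, mulComp_apply, mulComp_apply, hρ0 Y hY]
    simp
  have hfour : ∀ (F : EuclideanSpace ℝ ι → ℂ) Θ,
      fourInt (fun Y => (s⁻¹ : ℂ) * F Y) Θ = (s⁻¹ : ℂ) * fourInt F Θ := fun F Θ => by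
    simp only [fourInt, mul_assoc, integral_const_mul]
  have hsn : ‖(s⁻¹ : ℂ)‖ₑ = (ENNReal.ofReal s)⁻¹ := by
    rw [← ENNReal.ofReal_inv_of_pos hs0, ← Complex.ofReal_inv, enorm_ofReal (by positivity)]
  have h1 := hb Z (fun Y => (s⁻¹ : ℂ) * A Y) (continuous_const.mul A.continuous)
    (fun Y hY => by simp [hA0 Y hY]) (fun Θ => by
      rw [hfour, ← ofReal_norm]
      refine ENNReal.ofReal_le_ofReal ?_
      rw [norm_mul, norm_inv, Complex.norm_real, Real.norm_of_nonneg hs0.le, inv_mul_le_iff₀ hs0]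
      refine (h₀ A Θ).trans ?_
      have := (decay_pos N Θ).le
      calc _ ≤ C₀ * (C * t * D) * decay N Θ := by gcongr; exact hK γ g κ _ _ _
        _ = _ := by rw [hs]; ring) (kerFreq φ P Q R z w l Z)
  have h2 : (fun Y => Complex.exp (Complex.I * taylorRem φ Z Y) * ((s⁻¹ : ℂ) * A Y)) =
      fun Y => (s⁻¹ : ℂ) * (Complex.exp (Complex.I * taylorRem φ Z Y) * A Y) := by
    funext Y; ring
  rw [h2, hfour, enorm_mul, hsn] at h1
  have hsne : ENNReal.ofReal s ≠ 0 := by simpa using hs0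
  rw [integral_const_mul, enorm_mul]
  have h3 : ‖Complex.exp (Complex.I * φ Z) * expInner (-z.2) (Q Z) * expInner w.2 (P Z) *
      expInner (-l.2) (R Z)‖ₑ = 1 := by
    rw [← ofReal_norm, norm_mul, norm_mul, norm_mul, norm_exp_I_mul_ofReal, norm_expInner,
      norm_expInner, norm_expInner]
    simp
  rw [h3, one_mul, ← mul_assoc, ← ENNReal.ofReal_mul (by positivity)]
  change ‖fourInt (fun Y => Complex.exp (Complex.I * taylorRem φ Z Y) * A Y)
    (kerFreq φ P Q R z w l Z)‖ₑ ≤ ENNReal.ofReal s * _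
  rwa [mul_comm, ← div_eq_mul_inv, ENNReal.div_le_iff hsne ENNReal.ofReal_ne_top, mul_comm] at h1

end Kernel

/-! ### The dominating kernel and its Schur bounds -/

section Schur

variable {α β σ ι : Type} [Fintype α] [Fintype β] [Fintype σ] [Fintype ι]

theorem IsContModerate.mono {E : Type*} [NormedAddCommGroup E] {N N' : ℕ} {w : E → ℝ}
    (hw : IsContModerate N w) (h : N ≤ N') : IsContModerate N' w :=
  ⟨hw.pos, hw.continuous, fun x y => (hw.add_le x y).trans (by
    have := (hw.pos x).le
    gcongr
    linarith [norm_nonneg y])⟩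

theorem IsContModerate.le_fst {E F : Type*} [NormedAddCommGroup E] [NormedAddCommGroup F] {N : ℕ}
    {w : E × F → ℝ} (hw : IsContModerate N w) (x x' : E) (y : F) :
    w (x, y) ≤ w (x', y) * (1 + ‖x - x'‖) ^ N := by
  simpa using hw.le_sub (x, y) (x', y)

/-- Makes `kerFreq` explicit: a frequency belonging to some of the coordinates is extended by zero
to the others. -/
theorem adjoint_pull_inl (e : α ⊕ β ≃ ι) :
    (pull (fun k => e (Sum.inl k))).adjoint = inL e := by
  symm
  rw [ContinuousLinearMap.eq_adjoint_iff]
  intro x y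
  simp only [PiLp.inner_apply]
  rw [← e.sum_comp, Fintype.sum_sum_type]
  simp [inL_apply]

variable (φ : EuclideanSpace ℝ ι → ℝ) (P Q : EuclideanSpace ℝ ι →L[ℝ] EuclideanSpace ℝ α)
  (R : EuclideanSpace ℝ ι →L[ℝ] EuclideanSpace ℝ σ)

/-- The kernel which dominates the operator between weighted atoms. -/
def schurKer (A : EuclideanSpace ℝ σ → ℝ≥0∞) (h : EuclideanSpace ℝ ι → ℝ≥0∞) (M : ℕ)
    (z w : EuclideanSpace ℝ α × EuclideanSpace ℝ α) : ℝ≥0∞ :=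
  ∫⁻ l, A l * ∫⁻ Z, ENNReal.ofReal (decay M (Q Z - z.1) * decay M (P Z - w.1)) *
    h (kerFreq φ P Q R z w (0, l) Z)

variable {φ P Q R} {A : EuclideanSpace ℝ σ → ℝ≥0∞} {h : EuclideanSpace ℝ ι → ℝ≥0∞}

theorem continuous_kerFreq (hφ : ContDiff ℝ 2 φ) {T : Type*} [TopologicalSpace T]
    {z w : T → EuclideanSpace ℝ α × EuclideanSpace ℝ α}
    {l : T → EuclideanSpace ℝ σ × EuclideanSpace ℝ σ} {Z : T → EuclideanSpace ℝ ι}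
    (hz : Continuous z) (hw : Continuous w) (hl : Continuous l) (hZ : Continuous Z) :
    Continuous fun t => kerFreq φ P Q R (z t) (w t) (l t) (Z t) := by
  have hg := continuous_gradient hφ
  unfold kerFreq
  fun_prop

theorem measurable_schurKer (hφ : ContDiff ℝ 2 φ) (hA : Measurable A) (hh : Measurable h)
    (M : ℕ) : Measurable fun p : (EuclideanSpace ℝ α × EuclideanSpace ℝ α) ×
      (EuclideanSpace ℝ α × EuclideanSpace ℝ α) => schurKer φ P Q R A h M p.1 p.2 := by
  have hd := continuous_decay (E := EuclideanSpace ℝ α) M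
  have h1 : Measurable fun q : (((EuclideanSpace ℝ α × EuclideanSpace ℝ α) ×
      (EuclideanSpace ℝ α × EuclideanSpace ℝ α)) × EuclideanSpace ℝ σ) × EuclideanSpace ℝ ι =>
      ENNReal.ofReal (decay M (Q q.2 - q.1.1.1.1) * decay M (P q.2 - q.1.1.2.1)) *
        h (kerFreq φ P Q R q.1.1.1 q.1.1.2 (0, q.1.2) q.2) := by
    refine Measurable.mul ?_ (hh.comp (continuous_kerFreq hφ ?_ ?_ ?_ ?_).measurable)
    · exact Measurable.ennreal_ofReal (Continuous.measurable (by fun_prop))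
    all_goals fun_prop
  have h2 : Measurable fun q : ((EuclideanSpace ℝ α × EuclideanSpace ℝ α) ×
      (EuclideanSpace ℝ α × EuclideanSpace ℝ α)) × EuclideanSpace ℝ σ =>
      A q.2 * ∫⁻ Z, ENNReal.ofReal (decay M (Q Z - q.1.1.1) * decay M (P Z - q.1.2.1)) *
        h (kerFreq φ P Q R q.1.1 q.1.2 (0, q.2) Z) :=
    (hA.comp measurable_snd).mul h1.lintegral_prod_right'
  exact h2.lintegral_prod_right'

/-- The weights are compared only at the positions `Q Z`, `P Z` and `R Z`. Moving them from there to
the centres of the atoms costs `N` powers in each offset, which are taken from the decay of order `N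
+ M`. The factor `V` goes to the majorant `b`, whose weighted integral is under control. -/
theorem kernel_le {N M : ℕ}
    {w₁ w₂ : EuclideanSpace ℝ α × EuclideanSpace ℝ α → ℝ}
    {w : EuclideanSpace ℝ σ × EuclideanSpace ℝ σ → ℝ} (hw₁ : IsContModerate N w₁)
    (hw₂ : IsContModerate N w₂) (hw : IsContModerate N w) {V : EuclideanSpace ℝ ι → ℝ}
    (hV : ∀ Θ, 0 ≤ V Θ) {c : ℝ} (hc : 0 ≤ c)
    (hW : ∀ z y l Z, w₂ (P Z, y.2) ≤
      c * w₁ (Q Z, z.2) * w (R Z, l.2) * V (kerFreq φ P Q R z y l Z))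
    (b : EuclideanSpace ℝ ι → ℝ≥0∞) {F : EuclideanSpace ℝ σ × EuclideanSpace ℝ σ → ℝ≥0∞}
    (hF : ∀ l, F l * ENNReal.ofReal (w l) ≤ A l.2)
    (z y : EuclideanSpace ℝ α × EuclideanSpace ℝ α) (l : EuclideanSpace ℝ σ × EuclideanSpace ℝ σ)
    (Z : EuclideanSpace ℝ ι) :
    F l * (ENNReal.ofReal (decay (N + M) (Q Z - z.1) * decay (N + M) (P Z - y.1) *
        decay (N + M) (R Z - l.1)) * b (kerFreq φ P Q R z y l Z)) * ENNReal.ofReal (w₂ y) ≤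
      ENNReal.ofReal (c * w₁ z) * (A l.2 * (ENNReal.ofReal (decay M (R Z - l.1)) *
        (ENNReal.ofReal (decay M (Q Z - z.1) * decay M (P Z - y.1)) *
          (b (kerFreq φ P Q R z y l Z) * ENNReal.ofReal (V (kerFreq φ P Q R z y l Z)))))) := by
  set Θ := kerFreq φ P Q R z y l Z with hΘ
  have hVΘ := hV Θ
  have p₁ := (hw₁.pos z).le
  have p₁' := (hw₁.pos (Q Z, z.2)).le
  have p := (hw.pos l).le
  have p' := (hw.pos (R Z, l.2)).le
  have d₁ := (decay_pos (N + M) (Q Z - z.1)).le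
  have d₂ := (decay_pos (N + M) (P Z - y.1)).le
  have d₃ := (decay_pos (N + M) (R Z - l.1)).le
  have e₁ : w₁ (Q Z, z.2) ≤ w₁ z * (1 + ‖Q Z - z.1‖) ^ N := hw₁.le_fst _ _ _
  have e₂ : w₂ y ≤ w₂ (P Z, y.2) * (1 + ‖P Z - y.1‖) ^ N := by
    rw [norm_sub_rev]; exact hw₂.le_fst _ _ _
  have e₃ : w (R Z, l.2) ≤ w l * (1 + ‖R Z - l.1‖) ^ N := hw.le_fst _ _ _
  have hr : decay (N + M) (Q Z - z.1) * decay (N + M) (P Z - y.1) *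
      decay (N + M) (R Z - l.1) * w₂ y ≤ c * w₁ z * w l * V Θ *
      (decay M (Q Z - z.1) * decay M (P Z - y.1) * decay M (R Z - l.1)) := by
    calc _ ≤ decay (N + M) (Q Z - z.1) * decay (N + M) (P Z - y.1) *
          decay (N + M) (R Z - l.1) * ((c * (w₁ z * (1 + ‖Q Z - z.1‖) ^ N) *
            (w l * (1 + ‖R Z - l.1‖) ^ N) * V Θ) * (1 + ‖P Z - y.1‖) ^ N) := by
          gcongr
          refine e₂.trans ?_
          gcongr
          refine (hW z y l Z).trans ?_
          gcongr
      _ = c * w₁ z * w l * V Θ * (((1 + ‖Q Z - z.1‖) ^ N * decay (N + M) (Q Z - z.1)) *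
          ((1 + ‖P Z - y.1‖) ^ N * decay (N + M) (P Z - y.1)) *
          ((1 + ‖R Z - l.1‖) ^ N * decay (N + M) (R Z - l.1))) := by ring
      _ = _ := by simp only [one_add_norm_pow_mul_decay]
  set D := decay M (Q Z - z.1) * decay M (P Z - y.1) * decay M (R Z - l.1) with hD
  have hD0 : 0 ≤ D := (mul_pos (mul_pos (decay_pos _ _) (decay_pos _ _)) (decay_pos _ _)).le
  calc _ = F l * b Θ * ENNReal.ofReal (decay (N + M) (Q Z - z.1) * decay (N + M) (P Z - y.1) *
        decay (N + M) (R Z - l.1) * w₂ y) := by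
        rw [ENNReal.ofReal_mul (p := decay (N + M) (Q Z - z.1) * decay (N + M) (P Z - y.1) *
          decay (N + M) (R Z - l.1)) (by positivity)]
        ring
    _ ≤ F l * b Θ * ENNReal.ofReal (c * w₁ z * w l * V Θ * D) := by gcongr
    _ = ENNReal.ofReal (c * w₁ z) * ((F l * ENNReal.ofReal (w l)) *
        (ENNReal.ofReal D * (b Θ * ENNReal.ofReal (V Θ)))) := by
        rw [ENNReal.ofReal_mul (p := c * w₁ z * w l * V Θ) (by positivity),
          ENNReal.ofReal_mul (p := c * w₁ z * w l) (by positivity),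
          ENNReal.ofReal_mul (p := c * w₁ z) (by positivity)]
        ring
    _ ≤ ENNReal.ofReal (c * w₁ z) * (A l.2 *
        (ENNReal.ofReal D * (b Θ * ENNReal.ofReal (V Θ)))) := by
        gcongr
        exact hF l
    _ = _ := by
        have d₁ := (decay_pos M (Q Z - z.1)).le
        have d₂ := (decay_pos M (P Z - y.1)).le
        rw [hD, ENNReal.ofReal_mul (p := decay M (Q Z - z.1) * decay M (P Z - y.1)) (by positivity)]
        ring

/-- The position of the symbol atom occurs only in one decay factor and integrates to a constant.
Therefore only its frequency remains in `schurKer`, with the position set to `0`. -/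
theorem lintegral_mul_lintegral_decay (R : EuclideanSpace ℝ ι →L[ℝ] EuclideanSpace ℝ σ) {M : ℕ}
    (hM : Fintype.card σ < M) (hA : Measurable A) {k : EuclideanSpace ℝ σ → EuclideanSpace ℝ ι → ℝ≥0∞}
    (hk : Measurable (Function.uncurry k)) :
    ∫⁻ l : EuclideanSpace ℝ σ × EuclideanSpace ℝ σ,
      A l.2 * ∫⁻ Z, ENNReal.ofReal (decay M (R Z - l.1)) * k l.2 Z =
    (∫⁻ x : EuclideanSpace ℝ σ, ENNReal.ofReal (decay M x)) * ∫⁻ l, A l * ∫⁻ Z, k l Z := by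
  have hd : Measurable fun x : EuclideanSpace ℝ σ => ENNReal.ofReal (decay M x) :=
    (continuous_decay M).measurable.ennreal_ofReal
  have hm : Measurable fun q : (EuclideanSpace ℝ σ × EuclideanSpace ℝ σ) × EuclideanSpace ℝ ι =>
      ENNReal.ofReal (decay M (R q.2 - q.1.1)) * k q.1.2 q.2 :=
    (hd.comp (by fun_prop)).mul (hk.comp (f := fun q : (EuclideanSpace ℝ σ ×
      EuclideanSpace ℝ σ) × EuclideanSpace ℝ ι => (q.1.2, q.2)) (by fun_prop))
  have hm1 : Measurable fun l : EuclideanSpace ℝ σ × EuclideanSpace ℝ σ =>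
      A l.2 * ∫⁻ Z, ENNReal.ofReal (decay M (R Z - l.1)) * k l.2 Z :=
    (hA.comp measurable_snd).mul hm.lintegral_prod_right'
  rw [Measure.volume_eq_prod, lintegral_prod_symm _ hm1.aemeasurable,
    ← lintegral_const_mul' _ _ (lintegral_decay_lt_top hM).ne]
  refine lintegral_congr fun l₂ => ?_
  have hm' : Measurable fun q : EuclideanSpace ℝ σ × EuclideanSpace ℝ ι =>
      ENNReal.ofReal (decay M (R q.2 - q.1)) * k l₂ q.2 :=
    hm.comp (f := fun q : EuclideanSpace ℝ σ × EuclideanSpace ℝ ι => ((q.1, l₂), q.2))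
      (by fun_prop)
  have hm2 : Measurable fun x => ∫⁻ Z, ENNReal.ofReal (decay M (R Z - x)) * k l₂ Z :=
    hm'.lintegral_prod_right'
  simp only
  rw [lintegral_const_mul _ hm2, lintegral_lintegral_swap hm'.aemeasurable, mul_left_comm]
  congr 1
  rw [← lintegral_const_mul' _ _ (lintegral_decay_lt_top hM).ne]
  refine lintegral_congr fun Z => ?_
  rw [← lintegral_sub_left_eq_self (fun x => ENNReal.ofReal (decay M x)) (R Z),
    ← lintegral_mul_const _ (show Measurable fun x => ENNReal.ofReal (decay M (R Z - x)) from
      hd.comp (by fun_prop))]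

theorem measurable_decay_mul_comp_kerFreq (hφ : ContDiff ℝ 2 φ) (hh : Measurable h) (M : ℕ)
    (z y : EuclideanSpace ℝ α × EuclideanSpace ℝ α) :
    Measurable (Function.uncurry fun (l : EuclideanSpace ℝ σ) (Z : EuclideanSpace ℝ ι) =>
      ENNReal.ofReal (decay M (Q Z - z.1) * decay M (P Z - y.1)) *
        h (kerFreq φ P Q R z y (0, l) Z)) := by
  have hd := continuous_decay (E := EuclideanSpace ℝ α) M
  refine Measurable.mul ?_ (hh.comp (continuous_kerFreq hφ ?_ ?_ ?_ ?_).measurable)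
  · exact Measurable.ennreal_ofReal (Continuous.measurable (by fun_prop))
  all_goals fun_prop

theorem lintegral_kernel_le (hφ : ContDiff ℝ 2 φ) {N M : ℕ} (hM : Fintype.card σ < M)
    {w₁ w₂ : EuclideanSpace ℝ α × EuclideanSpace ℝ α → ℝ}
    {w : EuclideanSpace ℝ σ × EuclideanSpace ℝ σ → ℝ} (hw₁ : IsContModerate N w₁)
    (hw₂ : IsContModerate N w₂) (hw : IsContModerate N w) {V : EuclideanSpace ℝ ι → ℝ}
    (hV : ∀ Θ, 0 ≤ V Θ) (hVm : Measurable V) {c : ℝ} (hc : 0 ≤ c)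
    (hW : ∀ z y l Z, w₂ (P Z, y.2) ≤
      c * w₁ (Q Z, z.2) * w (R Z, l.2) * V (kerFreq φ P Q R z y l Z))
    {b : EuclideanSpace ℝ ι → ℝ≥0∞} (hb : Measurable b) (hA : Measurable A)
    {F : EuclideanSpace ℝ σ × EuclideanSpace ℝ σ → ℝ≥0∞}
    (hF : ∀ l, F l * ENNReal.ofReal (w l) ≤ A l.2)
    (z y : EuclideanSpace ℝ α × EuclideanSpace ℝ α) :
    (∫⁻ l, F l * ∫⁻ Z, ENNReal.ofReal (decay (N + M) (Q Z - z.1) * decay (N + M) (P Z - y.1) *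
        decay (N + M) (R Z - l.1)) * b (kerFreq φ P Q R z y l Z)) * ENNReal.ofReal (w₂ y) ≤
      ENNReal.ofReal c * (∫⁻ x : EuclideanSpace ℝ σ, ENNReal.ofReal (decay M x)) *
        (ENNReal.ofReal (w₁ z) *
          schurKer φ P Q R A (fun Θ => b Θ * ENNReal.ofReal (V Θ)) M z y) := by
  have hhm : Measurable fun Θ => b Θ * ENNReal.ofReal (V Θ) := hb.mul hVm.ennreal_ofReal
  have hk := measurable_decay_mul_comp_kerFreq (P := P) (Q := Q) (R := R) hφ hhm M z y
  have h1 := lintegral_mul_lintegral_decay R hM hA hk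
  have h2 : ENNReal.ofReal c * (∫⁻ x : EuclideanSpace ℝ σ, ENNReal.ofReal (decay M x)) *
        (ENNReal.ofReal (w₁ z) *
          schurKer φ P Q R A (fun Θ => b Θ * ENNReal.ofReal (V Θ)) M z y) =
      ENNReal.ofReal (c * w₁ z) * ((∫⁻ x : EuclideanSpace ℝ σ, ENNReal.ofReal (decay M x)) *
        schurKer φ P Q R A (fun Θ => b Θ * ENNReal.ofReal (V Θ)) M z y) := by
    rw [ENNReal.ofReal_mul hc]
    ring
  rw [h2, schurKer, ← h1, ← lintegral_mul_const' _ _ ENNReal.ofReal_ne_top,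
    ← lintegral_const_mul' _ _ ENNReal.ofReal_ne_top]
  refine lintegral_mono fun l => ?_
  have hb' : Measurable fun Z => ENNReal.ofReal (decay (N + M) (Q Z - z.1) *
      decay (N + M) (P Z - y.1) * decay (N + M) (R Z - l.1)) *
      b (kerFreq φ P Q R z y l Z) := by
    have i₁ := continuous_decay (E := EuclideanSpace ℝ α) (N + M)
    have i₂ := continuous_decay (E := EuclideanSpace ℝ σ) (N + M)
    refine Measurable.mul ?_ (hb.comp (continuous_kerFreq hφ ?_ ?_ ?_ ?_).measurable)
    · exact Measurable.ennreal_ofReal (Continuous.measurable (by fun_prop))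
    all_goals fun_prop
  have hI : Measurable fun Z => ENNReal.ofReal (decay M (R Z - l.1)) *
      (ENNReal.ofReal (decay M (Q Z - z.1) * decay M (P Z - y.1)) *
        (b (kerFreq φ P Q R z y (0, l.2) Z) *
          ENNReal.ofReal (V (kerFreq φ P Q R z y (0, l.2) Z)))) := by
    have i₂ := continuous_decay (E := EuclideanSpace ℝ σ) M
    refine Measurable.mul ?_ (hk.comp (f := fun Z => (l.2, Z)) (by fun_prop))
    exact Measurable.ennreal_ofReal (Continuous.measurable (by fun_prop))
  rw [← lintegral_const_mul _ hb', ← lintegral_mul_const' _ _ ENNReal.ofReal_ne_top,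
    ← lintegral_const_mul _ hI, ← lintegral_const_mul' _ _ ENNReal.ofReal_ne_top]
  exact lintegral_mono fun Z => kernel_le hw₁ hw₂ hw hV hc hW b hF z y l Z

/-- Schur bounds, with `P` and `Q` the projections in two splittings of the variables. -/
theorem lintegral_schurKer_le [DecidableEq β] [DecidableEq ι] (e e' : α ⊕ β ≃ ι)
    (hφ : ContDiff ℝ 2 φ) (hb : ∀ i j, ∃ B, ∀ X, |secondPartial φ i j X| ≤ B)
    (huc : ∀ i j, UniformContinuous (secondPartial φ i j)) {d : ℝ} (hd : 0 < d)
    (hdet : ∀ X, d ≤ |(Matrix.of fun a b : β =>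
      secondPartial φ (e (Sum.inr b)) (e' (Sum.inr a)) X).det|)
    (hA : Measurable A) (hh : Measurable h) {M : ℕ} (hM : Fintype.card α < M)
    (y : EuclideanSpace ℝ α × EuclideanSpace ℝ α) :
    ∫⁻ z, schurKer φ (pull fun k => e (Sum.inl k)) (pull fun k => e' (Sum.inl k)) R A h M z y ≤
      (∫⁻ a : EuclideanSpace ℝ α, ENNReal.ofReal (decay M a)) ^ 2 *
        (ENNReal.ofReal d⁻¹ * (∫⁻ Z, h Z) * ∫⁻ l, A l) := by
  have hd' := continuous_decay (E := EuclideanSpace ℝ α) M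
  set P := pull (fun k => e (Sum.inl k)) with hP
  set Q := pull (fun k => e' (Sum.inl k)) with hQ
  have hmA : Measurable fun q : (EuclideanSpace ℝ α × EuclideanSpace ℝ α) × EuclideanSpace ℝ σ =>
      ∫⁻ Z, ENNReal.ofReal (decay M (Q Z - q.1.1) * decay M (P Z - y.1)) *
        h (kerFreq φ P Q R q.1 y (0, q.2) Z) := by
    have h1 : Measurable fun p : ((EuclideanSpace ℝ α × EuclideanSpace ℝ α) ×
        EuclideanSpace ℝ σ) × EuclideanSpace ℝ ι =>
        ENNReal.ofReal (decay M (Q p.2 - p.1.1.1) * decay M (P p.2 - y.1)) *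
          h (kerFreq φ P Q R p.1.1 y (0, p.1.2) p.2) := by
      refine Measurable.mul ?_ (hh.comp (continuous_kerFreq hφ ?_ ?_ ?_ ?_).measurable)
      · exact Measurable.ennreal_ofReal (Continuous.measurable (by fun_prop))
      all_goals fun_prop
    exact h1.lintegral_prod_right'
  simp only [schurKer]
  rw [lintegral_lintegral_swap ((hA.comp measurable_snd).mul hmA).aemeasurable]
  have hl : ∀ l : EuclideanSpace ℝ σ, ∫⁻ z : EuclideanSpace ℝ α × EuclideanSpace ℝ α,
      A l * ∫⁻ Z, ENNReal.ofReal (decay M (Q Z - z.1) * decay M (P Z - y.1)) *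
        h (kerFreq φ P Q R z y (0, l) Z) ≤
      (∫⁻ a : EuclideanSpace ℝ α, ENNReal.ofReal (decay M a)) ^ 2 *
        (ENNReal.ofReal d⁻¹ * ∫⁻ Z, h Z) * A l := by
    intro l
    have hmA' : Measurable fun z : EuclideanSpace ℝ α × EuclideanSpace ℝ α =>
        ∫⁻ Z, ENNReal.ofReal (decay M (Q Z - z.1) * decay M (P Z - y.1)) *
          h (kerFreq φ P Q R z y (0, l) Z) :=
      hmA.comp (f := fun z => (z, l)) (by fun_prop)
    rw [lintegral_const_mul _ hmA', mul_comm]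
    gcongr
    -- The position `z₁` occurs only in the decay of `Q Z - z₁`. The frequency `z₂` translates the
    -- argument of `h` along the first group of `e'`, the situation of
    -- `lintegral_decay_mul_comp_gradient_le`.
    rw [Measure.volume_eq_prod, lintegral_prod_symm _ hmA'.aemeasurable]
    have hin : ∀ z₂ : EuclideanSpace ℝ α, ∫⁻ z₁, ∫⁻ Z, ENNReal.ofReal (decay M (Q Z - z₁) *
        decay M (P Z - y.1)) * h (kerFreq φ P Q R (z₁, z₂) y (0, l) Z) =
        (∫⁻ a : EuclideanSpace ℝ α, ENNReal.ofReal (decay M a)) *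
          ∫⁻ Z, ENNReal.ofReal (decay M (P Z - y.1)) *
            h ((P.adjoint y.2 - R.adjoint l) + inL e' (-z₂) - gradient φ Z) := by
      intro z₂
      have hm : Measurable fun q : EuclideanSpace ℝ α × EuclideanSpace ℝ ι =>
          ENNReal.ofReal (decay M (Q q.2 - q.1) * decay M (P q.2 - y.1)) *
            h (kerFreq φ P Q R (q.1, z₂) y (0, l) q.2) := by
        refine Measurable.mul ?_ (hh.comp (continuous_kerFreq hφ ?_ ?_ ?_ ?_).measurable)
        · exact Measurable.ennreal_ofReal (Continuous.measurable (by fun_prop))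
        all_goals fun_prop
      rw [lintegral_lintegral_swap hm.aemeasurable,
        ← lintegral_const_mul' _ _ (lintegral_decay_lt_top hM).ne]
      refine lintegral_congr fun Z => ?_
      have hf : kerFreq φ P Q R (0, z₂) y (0, l) Z =
          (P.adjoint y.2 - R.adjoint l) + inL e' (-z₂) - gradient φ Z := by
        rw [kerFreq, hQ, adjoint_pull_inl e', map_neg]
        abel
      rw [← lintegral_sub_left_eq_self (fun x => ENNReal.ofReal (decay M x)) (Q Z),
        ← lintegral_mul_const _ (Measurable.ennreal_ofReal (Continuous.measurable (by fun_prop))),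
        ← hf]
      refine lintegral_congr fun z₁ => ?_
      rw [ENNReal.ofReal_mul (decay_pos _ _).le, mul_assoc]
      rfl
    simp only [hin]
    rw [lintegral_const_mul' _ _ (lintegral_decay_lt_top hM).ne, sq, mul_assoc]
    gcongr
    rw [lintegral_neg_eq_self (fun η => ∫⁻ Z, ENNReal.ofReal (decay M (P Z - y.1)) *
      h ((P.adjoint y.2 - R.adjoint l) + inL e' η - gradient φ Z))]
    exact lintegral_decay_mul_comp_gradient_le e e' hφ hb huc hd hdet hh M _ _
  refine (lintegral_mono hl).trans ?_
  rw [lintegral_const_mul _ hA, mul_assoc, mul_assoc]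

/-- Passing to the transposed operator exchanges the two atoms and the projections `P` and `Q`; the
frequencies change sign because they enter `kerFreq` with opposite signs. -/
theorem schurKer_swap (M : ℕ) (z y : EuclideanSpace ℝ α × EuclideanSpace ℝ α) :
    schurKer φ P Q R A h M z y = schurKer φ Q P R A h M (y.1, -y.2) (z.1, -z.2) := by
  have hf : ∀ l Z, kerFreq φ P Q R z y (0, l) Z =
      kerFreq φ Q P R (y.1, -y.2) (z.1, -z.2) (0, l) Z := fun l Z => by
    simp only [kerFreq, map_neg]
    abel
  simp only [schurKer, hf]
  refine lintegral_congr fun l => ?_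
  congr 1
  refine lintegral_congr fun Z => ?_
  rw [mul_comm (decay M (Q Z - z.1))]

/-- Reduced to the other Schur bound by transposition, since reflection of frequencies preserves the
measure. -/
theorem lintegral_schurKer_right_le [DecidableEq β] [DecidableEq ι] (e e' : α ⊕ β ≃ ι)
    (hφ : ContDiff ℝ 2 φ) (hb : ∀ i j, ∃ B, ∀ X, |secondPartial φ i j X| ≤ B)
    (huc : ∀ i j, UniformContinuous (secondPartial φ i j)) {d : ℝ} (hd : 0 < d)
    (hdet : ∀ X, d ≤ |(Matrix.of fun a b : β =>
      secondPartial φ (e' (Sum.inr b)) (e (Sum.inr a)) X).det|)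
    (hA : Measurable A) (hh : Measurable h) {M : ℕ} (hM : Fintype.card α < M)
    (z : EuclideanSpace ℝ α × EuclideanSpace ℝ α) :
    ∫⁻ y, schurKer φ (pull fun k => e (Sum.inl k)) (pull fun k => e' (Sum.inl k)) R A h M z y ≤
      (∫⁻ a : EuclideanSpace ℝ α, ENNReal.ofReal (decay M a)) ^ 2 *
        (ENNReal.ofReal d⁻¹ * (∫⁻ Z, h Z) * ∫⁻ l, A l) := by
  have hmp : MeasurePreserving (fun y : EuclideanSpace ℝ α × EuclideanSpace ℝ α => (y.1, -y.2)) :=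
    (MeasurePreserving.id volume).prod (Measure.measurePreserving_neg volume)
  have h1 := lintegral_schurKer_le (R := R) e' e hφ hb huc hd hdet hA hh hM (z.1, -z.2)
  have hm : Measurable fun y : EuclideanSpace ℝ α × EuclideanSpace ℝ α =>
      schurKer φ (pull fun k => e' (Sum.inl k)) (pull fun k => e (Sum.inl k)) R A h M y
        (z.1, -z.2) :=
    (measurable_schurKer hφ hA hh M).comp (f := fun y => (y, (z.1, -z.2))) (by fun_prop)
  rw [← hmp.lintegral_comp hm] at h1
  simp only [schurKer_swap (P := pull fun k => e (Sum.inl k))]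
  exact h1

end Schur

/-! ### Schur's test -/

section SchurTest

/-- Schur's test. -/
theorem schur_test {X : Type*} [MeasurableSpace X] {μ : Measure X} [SFinite μ] {L : X → X → ℝ≥0∞}
    (hL : Measurable (Function.uncurry L)) {S : ℝ≥0∞} (h1 : ∀ w, ∫⁻ z, L z w ∂μ ≤ S)
    (h2 : ∀ z, ∫⁻ w, L z w ∂μ ≤ S) {f : X → ℝ≥0∞} (hf : Measurable f) {p : ℝ} (hp : 1 < p) :
    ∫⁻ w, (∫⁻ z, f z * L z w ∂μ) ^ p ∂μ ≤ S ^ p * ∫⁻ z, f z ^ p ∂μ := by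
  obtain ⟨q, hpq⟩ : ∃ q, p.HolderConjugate q := ⟨_, Real.HolderConjugate.conjExponent hp⟩
  have hp0 : 0 < p := hpq.pos
  have hq0 : 0 < q := hpq.symm.pos
  have hLw : ∀ w, Measurable fun z => L z w := fun w =>
    hL.comp (measurable_id.prodMk measurable_const)
  have hLz : ∀ z, Measurable fun w => L z w := fun z =>
    hL.comp (measurable_const.prodMk measurable_id)
  have hpt : ∀ w, (∫⁻ z, f z * L z w ∂μ) ^ p ≤ (∫⁻ z, f z ^ p * L z w ∂μ) * S ^ (p - 1) := by
    intro w
    -- Hölder's inequality for the splitting of `L` into its powers `1 / p` and `1 / q`; one Schur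
    -- bound controls the second factor, the other is used after exchanging the integrals.
    have h3 := ENNReal.lintegral_mul_le_Lp_mul_Lq μ hpq
      (f := fun z => f z * L z w ^ (1 / p)) (g := fun z => L z w ^ (1 / q))
      (hf.mul ((hLw w).pow_const _)).aemeasurable ((hLw w).pow_const _).aemeasurable
    have e1 : ∀ z, f z * L z w ^ (1 / p) * L z w ^ (1 / q) = f z * L z w := fun z => by
      rw [mul_assoc, ← ENNReal.rpow_add_of_nonneg _ _ (by positivity) (by positivity)]
      have : 1 / p + 1 / q = 1 := by simpa using hpq.inv_add_inv_eq_one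
      rw [this, ENNReal.rpow_one]
    have e2 : ∀ z, (f z * L z w ^ (1 / p)) ^ p = f z ^ p * L z w := fun z => by
      rw [ENNReal.mul_rpow_of_nonneg _ _ hp0.le, ← ENNReal.rpow_mul, one_div_mul_cancel hp0.ne',
        ENNReal.rpow_one]
    have e3 : ∀ z, (L z w ^ (1 / q)) ^ q = L z w := fun z => by
      rw [← ENNReal.rpow_mul, one_div_mul_cancel hq0.ne', ENNReal.rpow_one]
    simp only [Pi.mul_apply, e1, e2, e3] at h3
    calc _ ≤ ((∫⁻ z, f z ^ p * L z w ∂μ) ^ (1 / p) * (∫⁻ z, L z w ∂μ) ^ (1 / q)) ^ p := by gcongr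
      _ = (∫⁻ z, f z ^ p * L z w ∂μ) * (∫⁻ z, L z w ∂μ) ^ (p - 1) := by
          rw [ENNReal.mul_rpow_of_nonneg _ _ hp0.le, ← ENNReal.rpow_mul, ← ENNReal.rpow_mul,
            one_div_mul_cancel hp0.ne', ENNReal.rpow_one]
          congr 2
          rw [one_div_mul_eq_div, hpq.div_conj_eq_sub_one]
      _ ≤ _ := by
          gcongr
          exact h1 w
  have hm : Measurable fun q : X × X => f q.2 ^ p * L q.2 q.1 :=
    ((hf.comp measurable_snd).pow_const _).mul (hL.comp measurable_swap)
  calc _ ≤ ∫⁻ w, (∫⁻ z, f z ^ p * L z w ∂μ) * S ^ (p - 1) ∂μ := lintegral_mono hpt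
    _ = (∫⁻ w, (∫⁻ z, f z ^ p * L z w ∂μ) ∂μ) * S ^ (p - 1) :=
        lintegral_mul_const _ hm.lintegral_prod_right'
    _ = (∫⁻ z, (∫⁻ w, f z ^ p * L z w ∂μ) ∂μ) * S ^ (p - 1) := by
        rw [lintegral_lintegral_swap hm.aemeasurable]
    _ ≤ (∫⁻ z, f z ^ p * S ∂μ) * S ^ (p - 1) := by
        gcongr with z
        rw [lintegral_const_mul _ (hLz z)]
        gcongr
        exact h2 z
    _ = _ := by
        rw [lintegral_mul_const _ (hf.pow_const _), mul_assoc, mul_comm]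
        congr 1
        nth_rw 1 [← ENNReal.rpow_one S]
        rw [← ENNReal.rpow_add_of_nonneg _ _ zero_le_one (by linarith), add_sub_cancel]

end SchurTest

/-! ### Operators defined by forms dominated by Schur kernels -/

section Operator

variable {α : Type} [Fintype α]

/-- With equal exponents the iterated norm is, by Tonelli's theorem, a weighted `L^p` norm on phase
space, where Schur's test applies. -/
theorem modNorm_eq_lintegral {w : EuclideanSpace ℝ α × EuclideanSpace ℝ α → ℝ} {N : ℕ}
    (hw : IsContModerate N w) {p : ℝ≥0∞} (hp0 : p ≠ 0) (hp : p ≠ ∞)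
    (χ : 𝓢(EuclideanSpace ℝ α, ℂ)) (f : 𝓢'(EuclideanSpace ℝ α, ℂ)) :
    modNorm w p p χ f = (∫⁻ z : EuclideanSpace ℝ α × EuclideanSpace ℝ α,
      (‖stft χ f z.1 z.2‖ₑ * ENNReal.ofReal (w z)) ^ p.toReal) ^ (1 / p.toReal) := by
  have hpos : 0 < p.toReal := ENNReal.toReal_pos hp0 hp
  have hm : Measurable fun z : EuclideanSpace ℝ α × EuclideanSpace ℝ α =>
      (‖stft χ f z.1 z.2‖ₑ * ENNReal.ofReal (w z)) ^ p.toReal :=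
    ((continuous_stft χ f).measurable.enorm.mul
      hw.continuous.measurable.ennreal_ofReal).pow_const _
  have hwe : ∀ z, ‖((w z : ℝ) : ℂ)‖ₑ = ENNReal.ofReal (w z) := fun z =>
    enorm_ofReal (hw.pos z).le
  rw [modNorm, eLpNorm_eq_lintegral_rpow_enorm_toReal hp0 hp]
  simp only [eLpNorm_eq_lintegral_rpow_enorm_toReal hp0 hp, enorm_eq_self, ← ENNReal.rpow_mul,
    one_div_mul_cancel hpos.ne', ENNReal.rpow_one, enorm_mul, hwe]
  rw [Measure.volume_eq_prod, lintegral_prod_symm _ hm.aemeasurable]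

theorem tfShift_tfShift_neg (g : 𝓢(EuclideanSpace ℝ α, ℂ)) (x ξ : EuclideanSpace ℝ α) :
    tfShift (expInner (-ξ) x • tfShift g (-x) (-ξ)) x ξ = g := by
  ext y
  rw [tfShift_apply, smul_apply, tfShift_apply, smul_eq_mul, sub_neg_eq_add,
    sub_add_cancel, ← mul_assoc (expInner (-ξ) x), ← expInner_add_right, add_sub_cancel,
    ← mul_assoc, mul_comm (expInner ξ y), expInner_neg_mul_self, one_mul]

/-- A sesquilinear form which is dominated, between atoms, by a kernel satisfying the conditions of
Schur's test. -/
structure IsSchurForm (γ : 𝓢(EuclideanSpace ℝ α, ℂ))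
    (w₁ w₂ : EuclideanSpace ℝ α × EuclideanSpace ℝ α → ℝ)
    (D : 𝓢(EuclideanSpace ℝ α, ℂ) → 𝓢(EuclideanSpace ℝ α, ℂ) → ℝ≥0∞) (K : ℕ) (c : ℝ) (S : ℝ≥0∞)
    (L : EuclideanSpace ℝ α × EuclideanSpace ℝ α →
      EuclideanSpace ℝ α × EuclideanSpace ℝ α → ℝ≥0∞) : Prop where
  measurable_kernel : Measurable (Function.uncurry L)
  left_le : ∀ w, ∫⁻ z, L z w ≤ S
  right_le : ∀ z, ∫⁻ w, L z w ≤ S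
  bound : ∀ g z w, D (tfShift γ z.1 (-z.2)) (tfShift g w.1 w.2) * ENNReal.ofReal (w₂ w) ≤
    ENNReal.ofReal (c * schwartzNorm K g) * (ENNReal.ofReal (w₁ z) * L z w)

variable {γ χ : 𝓢(EuclideanSpace ℝ α, ℂ)}
  {w₁ w₂ : EuclideanSpace ℝ α × EuclideanSpace ℝ α → ℝ} {N₁ N₂ : ℕ}
  {D : 𝓢(EuclideanSpace ℝ α, ℂ) → 𝓢(EuclideanSpace ℝ α, ℂ) → ℝ≥0∞} {K : ℕ} {c : ℝ} {S : ℝ≥0∞}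
  {L : EuclideanSpace ℝ α × EuclideanSpace ℝ α →
    EuclideanSpace ℝ α × EuclideanSpace ℝ α → ℝ≥0∞}

/-- Every Schwartz function `g` is an atom centred at any prescribed `w`: shift it back by `w` and
use the result as a window. The seminorm of this window depends on `w`, hence so does `c'`. Thus a
single point `w` with good kernel values controls all `g`. -/
theorem IsSchurForm.le_of_point (h : IsSchurForm γ w₁ w₂ D K c S L) (hw₂ : IsContModerate N₂ w₂)
    (hc : 0 ≤ c) (w : EuclideanSpace ℝ α × EuclideanSpace ℝ α) : ∃ c' : ℝ, 0 ≤ c' ∧ ∀ g z,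
      D (tfShift γ z.1 (-z.2)) g ≤ ENNReal.ofReal (c' * schwartzNorm K g) *
        (ENNReal.ofReal (w₁ z) * L z w) := by
  have hp := hw₂.pos w
  refine ⟨(w₂ w)⁻¹ * (c * (4 ^ K * ((1 + ‖-w.1‖) ^ K * (1 + ‖-w.2‖) ^ K))), by positivity,
    fun g z => ?_⟩
  have h1 := h.bound (expInner (-w.2) w.1 • tfShift g (-w.1) (-w.2)) z w
  rw [tfShift_tfShift_neg, map_smul_eq_mul, norm_expInner, one_mul] at h1
  have hne : ENNReal.ofReal (w₂ w) ≠ 0 := by simpa using hp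
  rw [← ENNReal.le_div_iff_mul_le (.inl hne) (.inl ENNReal.ofReal_ne_top)] at h1
  refine h1.trans ?_
  have hg := schwartzNorm_nonneg K g
  rw [div_eq_mul_inv, ← ENNReal.ofReal_inv_of_pos hp, mul_comm, ← mul_assoc,
    ← ENNReal.ofReal_mul (by positivity)]
  refine mul_le_mul_left (ENNReal.ofReal_le_ofReal ?_) _
  rw [mul_assoc, mul_assoc c]
  gcongr
  exact schwartzNorm_tfShift_le K g (-w.1) (-w.2)

theorem IsSchurForm.lt_top (h : IsSchurForm γ w₁ w₂ D K c S L) (hw₂ : IsContModerate N₂ w₂)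
    (hc : 0 ≤ c) (hS : S ≠ ∞) (g : 𝓢(EuclideanSpace ℝ α, ℂ))
    (z : EuclideanSpace ℝ α × EuclideanSpace ℝ α) : D (tfShift γ z.1 (-z.2)) g < ∞ := by
  have hm : Measurable fun w => L z w :=
    h.measurable_kernel.comp (measurable_const.prodMk measurable_id)
  obtain ⟨w, hw⟩ := (ae_lt_top hm ((h.right_le z).trans_lt hS.lt_top).ne).exists
  obtain ⟨c', hc', hb⟩ := h.le_of_point hw₂ hc w
  exact (hb g z).trans_lt (ENNReal.mul_lt_top ENNReal.ofReal_lt_top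
    (ENNReal.mul_lt_top ENNReal.ofReal_lt_top hw))

variable {p : ℝ≥0∞}

theorem IsSchurForm.lintegral_rpow_le (h : IsSchurForm γ w₁ w₂ D K c S L)
    (hw₁ : IsContModerate N₁ w₁) (hp1 : 1 < p) (hp : p ≠ ∞) (f : 𝓢'(EuclideanSpace ℝ α, ℂ)) :
    (∫⁻ w, (∫⁻ z : EuclideanSpace ℝ α × EuclideanSpace ℝ α, ‖stft χ f z.1 z.2‖ₑ *
      ENNReal.ofReal (w₁ z) * L z w) ^ p.toReal) ^ (1 / p.toReal) ≤ S * modNorm w₁ p p χ f := by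
  have hp0 : p ≠ 0 := (zero_lt_one.trans hp1).ne'
  have hpr : 1 < p.toReal := by
    rw [← ENNReal.toReal_one]; exact (ENNReal.toReal_lt_toReal ENNReal.one_ne_top hp).2 hp1
  have h1 := schur_test (μ := volume) h.measurable_kernel h.left_le h.right_le
    (f := fun z : EuclideanSpace ℝ α × EuclideanSpace ℝ α =>
      ‖stft χ f z.1 z.2‖ₑ * ENNReal.ofReal (w₁ z))
    ((continuous_stft χ f).measurable.enorm.mul hw₁.continuous.measurable.ennreal_ofReal) hpr
  rw [modNorm_eq_lintegral hw₁ hp0 hp]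
  have h2 : S = (S ^ p.toReal) ^ (1 / p.toReal) := by
    rw [← ENNReal.rpow_mul, mul_one_div_cancel (by linarith), ENNReal.rpow_one]
  conv_rhs => rw [h2]
  rw [← ENNReal.mul_rpow_of_nonneg _ _ (by positivity)]
  gcongr

/-- By Schur's test the weighted integral of `V_χ f` against the kernel is an `L^p` function of `w`,
hence finite at some `w`, and `IsSchurForm.le_of_point` applies there. The bound by one Schwartz
seminorm of `g` gives both absolute convergence and continuity of the resulting functional. -/
theorem IsSchurForm.exists_lintegral_le (h : IsSchurForm γ w₁ w₂ D K c S L)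
    (hw₁ : IsContModerate N₁ w₁) (hw₂ : IsContModerate N₂ w₂)
    (hc : 0 ≤ c) (hS : S ≠ ∞) (hp1 : 1 < p) (hp : p ≠ ∞) {f : 𝓢'(EuclideanSpace ℝ α, ℂ)}
    (hf : modNorm w₁ p p χ f < ∞) : ∃ C : ℝ, 0 ≤ C ∧ ∀ g,
      ∫⁻ z : EuclideanSpace ℝ α × EuclideanSpace ℝ α, ‖stft χ f z.1 z.2‖ₑ *
        D (tfShift γ z.1 (-z.2)) g ≤ ENNReal.ofReal (C * schwartzNorm K g) := by
  have hp0 : p ≠ 0 := (zero_lt_one.trans hp1).ne'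
  have hpos : 0 < p.toReal := ENNReal.toReal_pos hp0 hp
  set F : EuclideanSpace ℝ α × EuclideanSpace ℝ α → ℝ≥0∞ := fun w =>
    ∫⁻ z : EuclideanSpace ℝ α × EuclideanSpace ℝ α, ‖stft χ f z.1 z.2‖ₑ *
      ENNReal.ofReal (w₁ z) * L z w with hF
  have hst := (continuous_stft χ f).measurable.enorm
  have hFm : Measurable F := by
    have h1 : Measurable fun q : (EuclideanSpace ℝ α × EuclideanSpace ℝ α) ×
        (EuclideanSpace ℝ α × EuclideanSpace ℝ α) =>
        ‖stft χ f q.2.1 q.2.2‖ₑ * ENNReal.ofReal (w₁ q.2) * L q.2 q.1 :=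
      ((hst.mul hw₁.continuous.measurable.ennreal_ofReal).comp measurable_snd).mul
        (h.measurable_kernel.comp measurable_swap)
    exact h1.lintegral_prod_right'
  have h1 := (h.lintegral_rpow_le (χ := χ) hw₁ hp1 hp f).trans_lt
    (ENNReal.mul_lt_top hS.lt_top hf)
  have h2 : ∫⁻ w, F w ^ p.toReal < ∞ :=
    (ENNReal.rpow_lt_top_iff_of_pos (by positivity)).1 h1
  obtain ⟨w, hw⟩ := (ae_lt_top (hFm.pow_const _) h2.ne).exists
  have hw' : F w < ∞ := (ENNReal.rpow_lt_top_iff_of_pos hpos).1 hw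
  obtain ⟨c', hc', hb⟩ := h.le_of_point hw₂ hc w
  refine ⟨c' * (F w).toReal, by positivity, fun g => ?_⟩
  have hg := schwartzNorm_nonneg K g
  calc _ ≤ ∫⁻ z : EuclideanSpace ℝ α × EuclideanSpace ℝ α,
        ENNReal.ofReal (c' * schwartzNorm K g) *
          (‖stft χ f z.1 z.2‖ₑ * ENNReal.ofReal (w₁ z) * L z w) := by
        refine lintegral_mono fun z => ?_
        calc _ ≤ ‖stft χ f z.1 z.2‖ₑ * (ENNReal.ofReal (c' * schwartzNorm K g) *
              (ENNReal.ofReal (w₁ z) * L z w)) := by gcongr; exact hb g z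
          _ = _ := by ring
    _ = ENNReal.ofReal (c' * schwartzNorm K g) * F w :=
        lintegral_const_mul' _ _ ENNReal.ofReal_ne_top
    _ = ENNReal.ofReal (c' * schwartzNorm K g) * ENNReal.ofReal (F w).toReal := by
        rw [ENNReal.ofReal_toReal hw'.ne]
    _ = _ := by
        rw [← ENNReal.ofReal_mul (by positivity)]
        congr 1
        ring

variable {B : 𝓢(EuclideanSpace ℝ α, ℂ) → 𝓢(EuclideanSpace ℝ α, ℂ) → ℂ}

/-- The operator defined by a form dominated by a Schur kernel, through the expansion into
atoms. -/
theorem IsSchurForm.exists_distribution (h : IsSchurForm γ w₁ w₂ D K c S L)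
    (hw₁ : IsContModerate N₁ w₁) (hw₂ : IsContModerate N₂ w₂)
    (hc : 0 ≤ c) (hS : S ≠ ∞) (hp1 : 1 < p) (hp : p ≠ ∞)
    (hBD : ∀ f g, ‖B f g‖ₑ ≤ D f g)
    (hBm : ∀ g, AEStronglyMeasurable fun z : EuclideanSpace ℝ α × EuclideanSpace ℝ α =>
      B (tfShift γ z.1 (-z.2)) g)
    (hBadd : ∀ f g g', D f g < ∞ → D f g' < ∞ → B f (g + g') = B f g + B f g')
    (hBsmul : ∀ f (r : ℂ) g, B f (r • g) = r * B f g)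
    {f : 𝓢'(EuclideanSpace ℝ α, ℂ)} (hf : modNorm w₁ p p χ f < ∞) :
    ∃ u : 𝓢'(EuclideanSpace ℝ α, ℂ), ∀ g,
      Integrable (fun z : EuclideanSpace ℝ α × EuclideanSpace ℝ α =>
        (fourierConst α : ℂ) * stft χ f z.1 z.2 * B (tfShift γ z.1 (-z.2)) g) ∧
      u g = ∫ z : EuclideanSpace ℝ α × EuclideanSpace ℝ α,
        (fourierConst α : ℂ) * stft χ f z.1 z.2 * B (tfShift γ z.1 (-z.2)) g := by
  obtain ⟨C, hC, hCb⟩ := h.exists_lintegral_le (χ := χ) hw₁ hw₂ hc hS hp1 hp hf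
  have hle : ∀ g, ∫⁻ z : EuclideanSpace ℝ α × EuclideanSpace ℝ α,
      ‖(fourierConst α : ℂ) * stft χ f z.1 z.2 * B (tfShift γ z.1 (-z.2)) g‖ₑ ≤
      ENNReal.ofReal (fourierConst α * C * schwartzNorm K g) := by
    intro g
    have hfc := (fourierConst_pos α).le
    rw [mul_assoc, ENNReal.ofReal_mul hfc]
    calc _ ≤ ∫⁻ z : EuclideanSpace ℝ α × EuclideanSpace ℝ α, ENNReal.ofReal (fourierConst α) *
          (‖stft χ f z.1 z.2‖ₑ * D (tfShift γ z.1 (-z.2)) g) := by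
          refine lintegral_mono fun z => ?_
          rw [enorm_mul, enorm_mul, enorm_ofReal hfc, mul_assoc]
          gcongr
          exact hBD _ g
      _ ≤ _ := by
          rw [lintegral_const_mul' _ _ ENNReal.ofReal_ne_top]
          gcongr
          exact hCb g
  have hint : ∀ g, Integrable (fun z : EuclideanSpace ℝ α × EuclideanSpace ℝ α =>
      (fourierConst α : ℂ) * stft χ f z.1 z.2 * B (tfShift γ z.1 (-z.2)) g) := fun g =>
    ⟨((continuous_const.mul (continuous_stft χ f)).aestronglyMeasurable).mul (hBm g),
      (hle g).trans_lt ENNReal.ofReal_lt_top⟩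
  -- Additivity of the form needs finiteness of `D`, which holds for atoms in the first argument at
  -- every `z`, not just almost every one.
  let u₀ : 𝓢(EuclideanSpace ℝ α, ℂ) →ₗ[ℂ] ℂ :=
    { toFun := fun g => ∫ z : EuclideanSpace ℝ α × EuclideanSpace ℝ α,
        (fourierConst α : ℂ) * stft χ f z.1 z.2 * B (tfShift γ z.1 (-z.2)) g
      map_add' := fun g g' => by
        rw [← integral_add (hint g) (hint g')]
        congr 1
        funext z
        rw [hBadd _ _ _ (h.lt_top hw₂ hc hS g z) (h.lt_top hw₂ hc hS g' z), mul_add]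
      map_smul' := fun r g => by
        rw [RingHom.id_apply, smul_eq_mul, ← integral_const_mul]
        congr 1
        funext z
        rw [hBsmul]
        ring }
  have hu₀ : Continuous u₀ := by
    have hb : ∀ g, ‖u₀ g‖ ≤ fourierConst α * C * schwartzNorm K g := fun g => by
      have hfc := (fourierConst_pos α).le
      have hg := schwartzNorm_nonneg K g
      have h1 := (enorm_integral_le_lintegral_enorm _).trans (hle g)
      rwa [← ofReal_norm, ENNReal.ofReal_le_ofReal_iff (by positivity)] at h1
    refine continuous_of_continuousAt_zero u₀ ?_
    rw [ContinuousAt, map_zero]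
    refine squeeze_zero_norm hb ?_
    have h1 := ((continuous_schwartzNorm (E := EuclideanSpace ℝ α) K).const_mul
      (fourierConst α * C)).tendsto 0
    simpa using h1
  refine ⟨ContinuousLinearMap.toPointwiseConvergenceCLM _ _ _ _ ⟨u₀, hu₀⟩, fun g => ⟨hint g, rfl⟩⟩

end Operator

/-! ### Bounds on modulation spaces -/

section OperatorBound

variable {α : Type} [Fintype α] {γ χ : 𝓢(EuclideanSpace ℝ α, ℂ)}
  {w₁ w₂ : EuclideanSpace ℝ α × EuclideanSpace ℝ α → ℝ} {N₁ N₂ : ℕ}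
  {D : 𝓢(EuclideanSpace ℝ α, ℂ) → 𝓢(EuclideanSpace ℝ α, ℂ) → ℝ≥0∞} {K : ℕ} {c : ℝ} {S : ℝ≥0∞}
  {L : EuclideanSpace ℝ α × EuclideanSpace ℝ α →
    EuclideanSpace ℝ α × EuclideanSpace ℝ α → ℝ≥0∞} {p : ℝ≥0∞}

theorem stft_add (f g : 𝓢'(EuclideanSpace ℝ α, ℂ)) (x ξ : EuclideanSpace ℝ α) :
    stft χ (f + g) x ξ = stft χ f x ξ + stft χ g x ξ :=
  mul_add _ _ _

theorem stft_smul (r : ℂ) (f : 𝓢'(EuclideanSpace ℝ α, ℂ)) (x ξ : EuclideanSpace ℝ α) :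
    stft χ (r • f) x ξ = r * stft χ f x ξ :=
  mul_left_comm _ _ _

theorem modNorm_lt_top_iff (hw₁ : IsContModerate N₁ w₁) (hp0 : p ≠ 0) (hp : p ≠ ∞)
    (f : 𝓢'(EuclideanSpace ℝ α, ℂ)) : modNorm w₁ p p χ f < ∞ ↔
      ∫⁻ z : EuclideanSpace ℝ α × EuclideanSpace ℝ α,
        (‖stft χ f z.1 z.2‖ₑ * ENNReal.ofReal (w₁ z)) ^ p.toReal < ∞ := by
  have hpos : 0 < p.toReal := ENNReal.toReal_pos hp0 hp
  rw [modNorm_eq_lintegral hw₁ hp0 hp, ENNReal.rpow_lt_top_iff_of_pos (by positivity)]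

theorem modNorm_add_lt_top (hw₁ : IsContModerate N₁ w₁) (hp1 : 1 ≤ p) (hp : p ≠ ∞)
    {f g : 𝓢'(EuclideanSpace ℝ α, ℂ)} (hf : modNorm w₁ p p χ f < ∞)
    (hg : modNorm w₁ p p χ g < ∞) : modNorm w₁ p p χ (f + g) < ∞ := by
  have hp0 : p ≠ 0 := (zero_lt_one.trans_le hp1).ne'
  have hpr : 1 ≤ p.toReal := by
    rw [← ENNReal.toReal_one]; exact (ENNReal.toReal_le_toReal ENNReal.one_ne_top hp).2 hp1
  rw [modNorm_lt_top_iff hw₁ hp0 hp] at *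
  refine lt_of_le_of_lt (lintegral_mono fun z => ?_)
    (ENNReal.lintegral_rpow_add_lt_top_of_lintegral_rpow_lt_top
      (((continuous_stft χ f).measurable.enorm.mul
        hw₁.continuous.measurable.ennreal_ofReal)).aemeasurable hf hg hpr)
  refine ENNReal.rpow_le_rpow ?_ (by linarith)
  calc _ ≤ (‖stft χ f z.1 z.2‖ₑ + ‖stft χ g z.1 z.2‖ₑ) * ENNReal.ofReal (w₁ z) := by
        rw [stft_add]
        gcongr
        exact enorm_add_le _ _
    _ = _ := add_mul _ _ _

theorem modNorm_smul_lt_top (hw₁ : IsContModerate N₁ w₁) (hp0 : p ≠ 0) (hp : p ≠ ∞) (r : ℂ)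
    {f : 𝓢'(EuclideanSpace ℝ α, ℂ)} (hf : modNorm w₁ p p χ f < ∞) :
    modNorm w₁ p p χ (r • f) < ∞ := by
  rw [modNorm_lt_top_iff hw₁ hp0 hp] at *
  have hr : ‖r‖ₑ ^ p.toReal ≠ ∞ := ENNReal.rpow_ne_top_of_nonneg ENNReal.toReal_nonneg enorm_ne_top
  simp only [stft_smul, enorm_mul, mul_assoc, ENNReal.mul_rpow_of_nonneg _ _ ENNReal.toReal_nonneg]
  rw [lintegral_const_mul' _ _ hr]
  simp only [ENNReal.mul_rpow_of_nonneg _ _ ENNReal.toReal_nonneg] at hf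
  exact ENNReal.mul_lt_top hr.lt_top hf

/-- The decay of `tfPair` beats the moderate weight. The `p`-th power of a decay function is bounded
by the function itself, since its values are at most one and `p ≥ 1`. -/
theorem modNorm_coe_lt_top (hw₁ : IsContModerate N₁ w₁) (hp1 : 1 ≤ p) (hp : p ≠ ∞)
    (f : 𝓢(EuclideanSpace ℝ α, ℂ)) : modNorm w₁ p p χ (f : 𝓢'(EuclideanSpace ℝ α, ℂ)) < ∞ := by
  have hp0 : p ≠ 0 := (zero_lt_one.trans_le hp1).ne'
  have hpr : 1 ≤ p.toReal := by
    rw [← ENNReal.toReal_one]; exact (ENNReal.toReal_le_toReal ENNReal.one_ne_top hp).2 hp1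
  rw [modNorm_lt_top_iff hw₁ hp0 hp]
  obtain ⟨K, C, hC, hb⟩ := tfPair_decay α (N₁ + (Fintype.card α + 1))
  have hfc := (fourierConst_pos α).le
  set c : ℝ := fourierConst α * (C * (schwartzNorm K f * schwartzNorm K χ)) * w₁ 0
  have hf := schwartzNorm_nonneg K f
  have hχ := schwartzNorm_nonneg K χ
  have hw0 := (hw₁.pos 0).le
  have hc : 0 ≤ c := by positivity
  have hpt : ∀ z : EuclideanSpace ℝ α × EuclideanSpace ℝ α,
      (‖stft χ (f : 𝓢'(EuclideanSpace ℝ α, ℂ)) z.1 z.2‖ₑ * ENNReal.ofReal (w₁ z)) ^ p.toReal ≤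
      ENNReal.ofReal c ^ p.toReal * (ENNReal.ofReal (decay (Fintype.card α + 1) z.1) *
        ENNReal.ofReal (decay (Fintype.card α + 1) z.2)) := by
    rintro ⟨u, η⟩
    have h1 : ‖stft χ (f : 𝓢'(EuclideanSpace ℝ α, ℂ)) u η‖ * w₁ (u, η) ≤
        c * (decay (Fintype.card α + 1) u * decay (Fintype.card α + 1) η) := by
      rw [stft_coe, norm_mul, Complex.norm_real, Real.norm_of_nonneg hfc]
      have h2 : w₁ (u, η) ≤ w₁ 0 * ((1 + ‖u‖) ^ N₁ * (1 + ‖η‖) ^ N₁) := by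
        have := hw₁.add_le 0 (u, η)
        rw [zero_add] at this
        exact this.trans (mul_le_mul_of_nonneg_left (one_add_norm_prod_pow_le _ _ _) hw0)
      calc _ ≤ fourierConst α * (C * (schwartzNorm K f * schwartzNorm K χ) *
            (decay (N₁ + (Fintype.card α + 1)) u * decay (N₁ + (Fintype.card α + 1)) η)) *
            (w₁ 0 * ((1 + ‖u‖) ^ N₁ * (1 + ‖η‖) ^ N₁)) := by
            have := (hw₁.pos (u, η)).le
            have h3 := hb f χ u η
            have h4 := h3.trans' (norm_nonneg _)
            gcongr
        _ = c * (((1 + ‖u‖) ^ N₁ * decay (N₁ + (Fintype.card α + 1)) u) *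
              ((1 + ‖η‖) ^ N₁ * decay (N₁ + (Fintype.card α + 1)) η)) := by
            simp only [c]; ring
        _ = _ := by rw [one_add_norm_pow_mul_decay, one_add_norm_pow_mul_decay]
    have h4 : ‖stft χ (f : 𝓢'(EuclideanSpace ℝ α, ℂ)) u η‖ₑ * ENNReal.ofReal (w₁ (u, η)) ≤
        ENNReal.ofReal c * (ENNReal.ofReal (decay (Fintype.card α + 1) u) *
          ENNReal.ofReal (decay (Fintype.card α + 1) η)) := by
      rw [← ofReal_norm, ← ENNReal.ofReal_mul (norm_nonneg _), ← ENNReal.ofReal_mul (decay_pos _ _).le,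
        ← ENNReal.ofReal_mul hc]
      exact ENNReal.ofReal_le_ofReal h1
    refine (ENNReal.rpow_le_rpow h4 ENNReal.toReal_nonneg).trans ?_
    rw [ENNReal.mul_rpow_of_nonneg _ _ ENNReal.toReal_nonneg]
    refine mul_le_mul_right ?_ _
    refine ENNReal.rpow_le_self_of_le_one (mul_le_one' ?_ ?_) hpr <;>
      exact ENNReal.ofReal_le_one.2 (decay_le_one _ _)
  refine (lintegral_mono hpt).trans_lt ?_
  have hm : Measurable fun u : EuclideanSpace ℝ α =>
      ENNReal.ofReal (decay (Fintype.card α + 1) u) :=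
    (continuous_decay _).measurable.ennreal_ofReal
  have hd := lintegral_decay_lt_top (ι := α) (Nat.lt_succ_self (Fintype.card α))
  rw [lintegral_const_mul' _ _ (ENNReal.rpow_ne_top_of_nonneg ENNReal.toReal_nonneg
    ENNReal.ofReal_ne_top), Measure.volume_eq_prod,
    lintegral_prod_mul hm.aemeasurable hm.aemeasurable]
  exact ENNReal.mul_lt_top (ENNReal.rpow_lt_top_of_nonneg ENNReal.toReal_nonneg
    ENNReal.ofReal_ne_top) (ENNReal.mul_lt_top hd hd)

variable {B : 𝓢(EuclideanSpace ℝ α, ℂ) → 𝓢(EuclideanSpace ℝ α, ℂ) → ℂ}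

/-- Test the defining integral on the shifts of `χ`, which yields the short-time Fourier transform
of `u`. One factor `fourierConst` comes from this transform, the other from the expansion of `f`. -/
theorem IsSchurForm.modNorm_le (h : IsSchurForm γ w₁ w₂ D K c S L)
    (hw₁ : IsContModerate N₁ w₁) (hw₂ : IsContModerate N₂ w₂)
    (hp1 : 1 < p) (hp : p ≠ ∞) (hBD : ∀ f g, ‖B f g‖ₑ ≤ D f g)
    {f u : 𝓢'(EuclideanSpace ℝ α, ℂ)}
    (hu : ∀ g, u g = ∫ z : EuclideanSpace ℝ α × EuclideanSpace ℝ α,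
      (fourierConst α : ℂ) * stft χ f z.1 z.2 * B (tfShift γ z.1 (-z.2)) g) :
    modNorm w₂ p p χ u ≤ ENNReal.ofReal (fourierConst α ^ 2 * (c * schwartzNorm K χ)) * S *
      modNorm w₁ p p χ f := by
  have hp0 : p ≠ 0 := (zero_lt_one.trans hp1).ne'
  have hpos : 0 < p.toReal := ENNReal.toReal_pos hp0 hp
  have hfc := (fourierConst_pos α).le
  have hχ := schwartzNorm_nonneg K χ
  set k : ℝ≥0∞ := ENNReal.ofReal (fourierConst α ^ 2 * (c * schwartzNorm K χ)) with hk
  have hpt : ∀ w : EuclideanSpace ℝ α × EuclideanSpace ℝ α,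
      ‖stft χ u w.1 w.2‖ₑ * ENNReal.ofReal (w₂ w) ≤
        k * ∫⁻ z : EuclideanSpace ℝ α × EuclideanSpace ℝ α, ‖stft χ f z.1 z.2‖ₑ *
          ENNReal.ofReal (w₁ z) * L z w := by
    intro w
    have e : stft χ u w.1 w.2 = fourierConst α * u (tfShift χ w.1 w.2) := rfl
    rw [e, hu, enorm_mul, enorm_ofReal hfc]
    calc _ ≤ ENNReal.ofReal (fourierConst α) * (∫⁻ z : EuclideanSpace ℝ α × EuclideanSpace ℝ α,
          ENNReal.ofReal (fourierConst α) * (‖stft χ f z.1 z.2‖ₑ *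
            D (tfShift γ z.1 (-z.2)) (tfShift χ w.1 w.2))) * ENNReal.ofReal (w₂ w) := by
          gcongr
          refine (enorm_integral_le_lintegral_enorm _).trans (lintegral_mono fun z => ?_)
          rw [enorm_mul, enorm_mul, enorm_ofReal hfc, mul_assoc]
          gcongr
          exact hBD _ _
      _ = ∫⁻ z : EuclideanSpace ℝ α × EuclideanSpace ℝ α, ENNReal.ofReal (fourierConst α) *
            (ENNReal.ofReal (fourierConst α) * (‖stft χ f z.1 z.2‖ₑ *
            (D (tfShift γ z.1 (-z.2)) (tfShift χ w.1 w.2) * ENNReal.ofReal (w₂ w)))) := by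
          rw [← lintegral_const_mul' _ _ ENNReal.ofReal_ne_top,
            ← lintegral_mul_const' _ _ ENNReal.ofReal_ne_top]
          simp only [mul_assoc]
      _ ≤ ∫⁻ z : EuclideanSpace ℝ α × EuclideanSpace ℝ α, ENNReal.ofReal (fourierConst α) *
            (ENNReal.ofReal (fourierConst α) * (‖stft χ f z.1 z.2‖ₑ *
            (ENNReal.ofReal (c * schwartzNorm K χ) * (ENNReal.ofReal (w₁ z) * L z w)))) := by
          refine lintegral_mono fun z => ?_
          exact mul_le_mul_right (mul_le_mul_right (mul_le_mul_right (h.bound χ z w) _) _) _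
      _ = _ := by
          rw [hk, ← lintegral_const_mul' _ _ ENNReal.ofReal_ne_top]
          congr 1
          funext z
          rw [ENNReal.ofReal_mul (p := fourierConst α ^ 2) (by positivity), sq,
            ENNReal.ofReal_mul hfc]
          ring
  rw [modNorm_eq_lintegral hw₂ hp0 hp, mul_assoc]
  calc _ ≤ (∫⁻ w, (k * ∫⁻ z : EuclideanSpace ℝ α × EuclideanSpace ℝ α, ‖stft χ f z.1 z.2‖ₑ *
          ENNReal.ofReal (w₁ z) * L z w) ^ p.toReal) ^ (1 / p.toReal) := by
        refine ENNReal.rpow_le_rpow (lintegral_mono fun w => ?_) (by positivity)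
        exact ENNReal.rpow_le_rpow (hpt w) hpos.le
    _ = k * (∫⁻ w, (∫⁻ z : EuclideanSpace ℝ α × EuclideanSpace ℝ α, ‖stft χ f z.1 z.2‖ₑ *
          ENNReal.ofReal (w₁ z) * L z w) ^ p.toReal) ^ (1 / p.toReal) := by
        simp only [ENNReal.mul_rpow_of_nonneg _ _ hpos.le]
        rw [lintegral_const_mul' _ _ (ENNReal.rpow_ne_top_of_nonneg hpos.le ENNReal.ofReal_ne_top),
          ENNReal.mul_rpow_of_nonneg _ _ (by positivity), ← ENNReal.rpow_mul,
          mul_one_div_cancel hpos.ne', ENNReal.rpow_one]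
    _ ≤ _ := by
        gcongr
        exact h.lintegral_rpow_le hw₁ hp1 hp f

/-- Boundedness on modulation spaces of the operator defined by a form dominated by a Schur
kernel. -/
theorem IsSchurForm.exists_operator (h : IsSchurForm γ w₁ w₂ D K c S L)
    (hw₁ : IsContModerate N₁ w₁) (hw₂ : IsContModerate N₂ w₂)
    (hc : 0 ≤ c) (hS : S ≠ ∞) (hp1 : 1 < p) (hp : p ≠ ∞)
    (hBD : ∀ f g, ‖B f g‖ₑ ≤ D f g)
    (hBm : ∀ g, AEStronglyMeasurable fun z : EuclideanSpace ℝ α × EuclideanSpace ℝ α =>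
      B (tfShift γ z.1 (-z.2)) g)
    (hBadd : ∀ f g g', D f g < ∞ → D f g' < ∞ → B f (g + g') = B f g + B f g')
    (hBsmul : ∀ f (r : ℂ) g, B f (r • g) = r * B f g)
    (hrep : ∀ f g, ∫⁻ z : EuclideanSpace ℝ α × EuclideanSpace ℝ α,
      ‖tfPair f χ z.1 z.2‖ₑ * D (tfShift γ z.1 (-z.2)) g < ∞ → D f g < ∞ ∧
        B f g = ∫ z : EuclideanSpace ℝ α × EuclideanSpace ℝ α,
          (fourierConst α : ℂ) ^ 2 * tfPair f χ z.1 z.2 * B (tfShift γ z.1 (-z.2)) g) :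
    ∃ T : 𝓢'(EuclideanSpace ℝ α, ℂ) → 𝓢'(EuclideanSpace ℝ α, ℂ),
      (∀ f g : 𝓢(EuclideanSpace ℝ α, ℂ), D f g < ∞ ∧
        T (f : 𝓢'(EuclideanSpace ℝ α, ℂ)) g = B f g) ∧
      (∀ f g, modNorm w₁ p p χ f < ∞ → modNorm w₁ p p χ g < ∞ → T (f + g) = T f + T g) ∧
      (∀ (r : ℂ) f, modNorm w₁ p p χ f < ∞ → T (r • f) = r • T f) ∧
      ∀ f, modNorm w₁ p p χ f < ∞ → modNorm w₂ p p χ (T f) ≤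
        ENNReal.ofReal (fourierConst α ^ 2 * (c * schwartzNorm K χ)) * S *
          modNorm w₁ p p χ f := by
  have hp0 : p ≠ 0 := (zero_lt_one.trans hp1).ne'
  have hex : ∀ f : 𝓢'(EuclideanSpace ℝ α, ℂ), modNorm w₁ p p χ f < ∞ → _ := fun f hf =>
    h.exists_distribution (χ := χ) hw₁ hw₂ hc hS hp1 hp hBD hBm hBadd hBsmul hf
  -- Outside the modulation space the values of `T` are arbitrary; linearity and bounds are claimed
  -- only inside.
  choose! T hT using hex
  refine ⟨T, fun f g => ?_, fun f g hf hg => ?_, fun r f hf => ?_, fun f hf =>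
    h.modNorm_le hw₁ hw₂ hp1 hp hBD fun g => (hT f hf g).2⟩
  -- A Schwartz function belongs to the modulation space, so its expansion into atoms converges
  -- absolutely against `D`. The hypothesis `hrep` then identifies the expansion with the form
  -- itself.
  · have hf := modNorm_coe_lt_top (χ := χ) hw₁ hp1.le hp f
    obtain ⟨C, -, hC⟩ := h.exists_lintegral_le hw₁ hw₂ hc hS hp1 hp hf
    have hfc : ENNReal.ofReal (fourierConst α) ≠ 0 := by simpa using fourierConst_pos α
    have h1 := (hC g).trans_lt ENNReal.ofReal_lt_top
    simp only [stft_coe, enorm_mul, enorm_ofReal (fourierConst_pos α).le, mul_assoc] at h1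
    rw [lintegral_const_mul' _ _ ENNReal.ofReal_ne_top] at h1
    obtain ⟨h2, h3⟩ := hrep f g (ENNReal.lt_top_of_mul_ne_top_right h1.ne hfc)
    refine ⟨h2, ?_⟩
    rw [(hT _ hf g).2, h3]
    congr 1
    funext z
    rw [stft_coe]
    ring
  · ext k
    have e : (T f + T g) k = T f k + T g k := rfl
    rw [e, (hT f hf k).2, (hT g hg k).2, (hT _ (modNorm_add_lt_top hw₁ hp1.le hp hf hg) k).2,
      ← integral_add (hT f hf k).1 (hT g hg k).1]
    congr 1
    funext z
    rw [stft_add]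
    ring
  · ext k
    have e : (r • T f) k = r * T f k := rfl
    rw [e, (hT f hf k).2, (hT _ (modNorm_smul_lt_top hw₁ hp0 hp r hf) k).2, ← integral_const_mul]
    congr 1
    funext z
    rw [stft_smul]
    ring

end OperatorBound

/-! ### The form of a Fourier integral operator -/

section Form

variable {α σ ι : Type} [Fintype α] [Fintype σ] [Fintype ι]
  (φ : EuclideanSpace ℝ ι → ℝ) (P Q : EuclideanSpace ℝ ι →L[ℝ] EuclideanSpace ℝ α)
  (R : EuclideanSpace ℝ ι →L[ℝ] EuclideanSpace ℝ σ) (κ : 𝓢(EuclideanSpace ℝ σ, ℂ))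
  (s : EuclideanSpace ℝ σ × EuclideanSpace ℝ σ → ℂ)

/-- The form `(f, g) ↦ ⟨Op f, g⟩` defined by the short-time Fourier transform `s` of a symbol. -/
def opForm (f g : 𝓢(EuclideanSpace ℝ α, ℂ)) : ℂ := ∫ l, s l * kerInt φ P Q R f g κ l

/-- The integral of the modulus of the integrand of `opForm`. -/
def opFormAbs (f g : 𝓢(EuclideanSpace ℝ α, ℂ)) : ℝ≥0∞ :=
  ∫⁻ l, ‖s l * kerInt φ P Q R f g κ l‖ₑ

variable {φ P Q R κ s}

theorem enorm_opForm_le (f g : 𝓢(EuclideanSpace ℝ α, ℂ)) :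
    ‖opForm φ P Q R κ s f g‖ₑ ≤ opFormAbs φ P Q R κ s f g :=
  enorm_integral_le_lintegral_enorm _

theorem continuous_kerFun_param (hφ : Continuous φ) {T : Type*} [TopologicalSpace T]
    (f g : 𝓢(EuclideanSpace ℝ α, ℂ)) {x ξ : T → EuclideanSpace ℝ α}
    {l : T → EuclideanSpace ℝ σ × EuclideanSpace ℝ σ} {Y : T → EuclideanSpace ℝ ι}
    (hx : Continuous x) (hξ : Continuous ξ) (hl : Continuous l) (hY : Continuous Y) :
    Continuous fun t => kerFun φ P Q R (tfShift f (x t) (ξ t)) g κ (l t) (Y t) := by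
  have h1 := continuous_tfShift_apply f hx hξ (Q.continuous.comp hY)
  have h2 := continuous_tfShift_apply κ (continuous_fst.comp hl) (continuous_snd.comp hl).neg
    (R.continuous.comp hY)
  have h3 : Continuous fun t => Complex.exp (Complex.I * φ (Y t)) :=
    (continuous_const.mul (Complex.continuous_ofReal.comp (hφ.comp hY))).cexp
  exact ((h3.mul h1).mul (g.continuous.comp (P.continuous.comp hY))).mul h2

theorem stronglyMeasurable_kerInt_atom (hφ : Continuous φ) (γ g : 𝓢(EuclideanSpace ℝ α, ℂ)) :
    StronglyMeasurable fun q : (EuclideanSpace ℝ α × EuclideanSpace ℝ α) ×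
      (EuclideanSpace ℝ σ × EuclideanSpace ℝ σ) =>
      kerInt φ P Q R (tfShift γ q.1.1 (-q.1.2)) g κ q.2 := by
  have h := (continuous_kerFun_param (P := P) (Q := Q) (R := R) (κ := κ) hφ γ g
    (T := ((EuclideanSpace ℝ α × EuclideanSpace ℝ α) ×
      (EuclideanSpace ℝ σ × EuclideanSpace ℝ σ)) × EuclideanSpace ℝ ι)
    (x := fun t => t.1.1.1) (ξ := fun t => -t.1.1.2) (l := fun t => t.1.2) (Y := fun t => t.2)
    (by fun_prop) (by fun_prop) (by fun_prop) (by fun_prop)).stronglyMeasurable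
  exact h.integral_prod_right'

theorem tfShift_zero_zero (f : 𝓢(EuclideanSpace ℝ α, ℂ)) : tfShift f 0 0 = f := by
  ext y
  rw [tfShift_apply, expInner_zero_left, one_mul, sub_zero]

theorem stronglyMeasurable_kerInt (hφ : Continuous φ) (f g : 𝓢(EuclideanSpace ℝ α, ℂ)) :
    StronglyMeasurable (kerInt φ P Q R f g κ) := by
  have h := (stronglyMeasurable_kerInt_atom (P := P) (Q := Q) (R := R) (κ := κ) hφ f g).comp_measurable
    (measurable_prodMk_left (x := ((0 : EuclideanSpace ℝ α), (0 : EuclideanSpace ℝ α))))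
  simpa [Function.comp_def, tfShift_zero_zero] using h

theorem stronglyMeasurable_opForm_atom (hφ : Continuous φ) (hs : Continuous s)
    (γ g : 𝓢(EuclideanSpace ℝ α, ℂ)) :
    StronglyMeasurable fun z : EuclideanSpace ℝ α × EuclideanSpace ℝ α =>
      opForm φ P Q R κ s (tfShift γ z.1 (-z.2)) g := by
  have h1 : StronglyMeasurable fun q : (EuclideanSpace ℝ α × EuclideanSpace ℝ α) ×
      (EuclideanSpace ℝ σ × EuclideanSpace ℝ σ) =>
      s q.2 * kerInt φ P Q R (tfShift γ q.1.1 (-q.1.2)) g κ q.2 :=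
    (hs.comp continuous_snd).stronglyMeasurable.mul (stronglyMeasurable_kerInt_atom hφ γ g)
  exact h1.integral_prod_right'

theorem integrable_opForm (hφ : Continuous φ) (hs : Continuous s) {f g : 𝓢(EuclideanSpace ℝ α, ℂ)}
    (h : opFormAbs φ P Q R κ s f g < ∞) :
    Integrable fun l => s l * kerInt φ P Q R f g κ l :=
  ⟨(hs.stronglyMeasurable.mul (stronglyMeasurable_kerInt hφ f g)).aestronglyMeasurable, h⟩

theorem opForm_add (hφ : Continuous φ) (hR : ∀ Y, ‖Y‖ ≤ ‖Q Y‖ + ‖R Y‖) (hs : Continuous s)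
    {f g g' : 𝓢(EuclideanSpace ℝ α, ℂ)} (h : opFormAbs φ P Q R κ s f g < ∞)
    (h' : opFormAbs φ P Q R κ s f g' < ∞) :
    opForm φ P Q R κ s f (g + g') = opForm φ P Q R κ s f g + opForm φ P Q R κ s f g' := by
  rw [opForm, opForm, opForm, ← integral_add (integrable_opForm hφ hs h) (integrable_opForm hφ hs h')]
  congr 1
  funext l
  rw [← mul_add]
  simp only [kerInt]
  rw [← integral_add (integrable_kerFun hφ hR f g κ l) (integrable_kerFun hφ hR f g' κ l)]
  congr 2
  funext Y
  simp only [kerFun, add_apply]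
  ring

theorem opForm_smul (f : 𝓢(EuclideanSpace ℝ α, ℂ)) (r : ℂ) (g : 𝓢(EuclideanSpace ℝ α, ℂ)) :
    opForm φ P Q R κ s f (r • g) = r * opForm φ P Q R κ s f g := by
  rw [opForm, opForm, ← integral_const_mul]
  congr 1
  funext l
  rw [mul_left_comm]
  congr 1
  simp only [kerInt]
  rw [← integral_const_mul]
  congr 1
  funext Y
  simp only [kerFun, smul_apply, smul_eq_mul]
  ring

theorem integrable_tfPair_mul_pow (f χ : 𝓢(EuclideanSpace ℝ α, ℂ)) (M : ℕ) :
    Integrable fun z : EuclideanSpace ℝ α × EuclideanSpace ℝ α =>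
      ‖tfPair f χ z.1 z.2‖ * ((1 + ‖z.1‖) ^ M * (1 + ‖z.2‖) ^ M) := by
  obtain ⟨K, C, hC, hb⟩ := tfPair_decay α (M + (Fintype.card α + 1))
  have hd := integrable_decay (ι := α) (Nat.lt_succ_self (Fintype.card α))
  have h1 : Continuous fun z : EuclideanSpace ℝ α × EuclideanSpace ℝ α =>
      ‖tfPair f χ z.1 z.2‖ * ((1 + ‖z.1‖) ^ M * (1 + ‖z.2‖) ^ M) :=
    (continuous_tfPair f χ).norm.mul (by fun_prop)
  refine Integrable.mono' ((hd.mul_prod hd).const_mul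
    (C * (schwartzNorm K f * schwartzNorm K χ))) h1.aestronglyMeasurable
    (Filter.Eventually.of_forall fun z => ?_)
  rw [Real.norm_of_nonneg (by positivity)]
  calc _ ≤ C * (schwartzNorm K f * schwartzNorm K χ) *
        (decay (M + (Fintype.card α + 1)) z.1 * decay (M + (Fintype.card α + 1)) z.2) *
          ((1 + ‖z.1‖) ^ M * (1 + ‖z.2‖) ^ M) := by gcongr; exact hb f χ z.1 z.2
    _ = C * (schwartzNorm K f * schwartzNorm K χ) *
        (((1 + ‖z.1‖) ^ M * decay (M + (Fintype.card α + 1)) z.1) *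
          ((1 + ‖z.2‖) ^ M * decay (M + (Fintype.card α + 1)) z.2)) := by ring
    _ = _ := by rw [one_add_norm_pow_mul_decay, one_add_norm_pow_mul_decay]

theorem integrable_tfPair_mul_kerFun (hφ : Continuous φ) (hR : ∀ Y, ‖Y‖ ≤ ‖Q Y‖ + ‖R Y‖)
    (f χ γ g : 𝓢(EuclideanSpace ℝ α, ℂ)) (l : EuclideanSpace ℝ σ × EuclideanSpace ℝ σ) :
    Integrable (Function.uncurry fun (Y : EuclideanSpace ℝ ι)
      (z : EuclideanSpace ℝ α × EuclideanSpace ℝ α) =>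
      (fourierConst α : ℂ) ^ 2 * tfPair f χ z.1 z.2 *
        kerFun φ P Q R (tfShift γ z.1 (-z.2)) g κ l Y) (volume.prod volume) := by
  set M := Fintype.card ι + 1
  have hc : Continuous (Function.uncurry fun (Y : EuclideanSpace ℝ ι)
      (z : EuclideanSpace ℝ α × EuclideanSpace ℝ α) =>
      (fourierConst α : ℂ) ^ 2 * tfPair f χ z.1 z.2 *
        kerFun φ P Q R (tfShift γ z.1 (-z.2)) g κ l Y) :=
    (continuous_const.mul ((continuous_tfPair f χ).comp continuous_snd)).mul
      (continuous_kerFun_param hφ γ g (by fun_prop) (by fun_prop) continuous_const (by fun_prop))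
  set B : ℝ := fourierConst α ^ 2 * (2 ^ M * (4 ^ M * schwartzNorm M γ) *
    (2 ^ 0 * schwartzNorm 0 g) * (2 ^ M * schwartzNorm M (tfShift κ l.1 (-l.2))))
  refine Integrable.mono' (((integrable_decay (ι := ι) (Nat.lt_succ_self _)).mul_prod
    (integrable_tfPair_mul_pow f χ M)).const_mul B) hc.aestronglyMeasurable
    (Filter.Eventually.of_forall fun q => ?_)
  obtain ⟨Y, z⟩ := q
  have hg : ‖g (P Y)‖ ≤ 2 ^ 0 * schwartzNorm 0 g := by
    simpa [decay] using norm_apply_le_decay 0 g (P Y)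
  have hγ := schwartzNorm_tfShift_le M γ z.1 (-z.2)
  rw [norm_neg] at hγ
  have h3 := schwartzNorm_nonneg M (tfShift γ z.1 (-z.2))
  have h4 := schwartzNorm_nonneg M (tfShift κ l.1 (-l.2))
  have h5 := (decay_pos M Y).le
  have h6 := schwartzNorm_nonneg M γ
  simp only [Function.uncurry_apply_pair]
  rw [norm_mul, norm_mul, norm_pow, Complex.norm_real, Real.norm_of_nonneg (fourierConst_pos α).le]
  calc _ ≤ fourierConst α ^ 2 * ‖tfPair f χ z.1 z.2‖ *
        (2 ^ M * (4 ^ M * ((1 + ‖z.1‖) ^ M * (1 + ‖z.2‖) ^ M) * schwartzNorm M γ) *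
        (2 ^ 0 * schwartzNorm 0 g) * (2 ^ M * schwartzNorm M (tfShift κ l.1 (-l.2))) *
          decay M Y) := by
        gcongr
        refine (norm_kerFun_le hR M _ g κ l Y).trans ?_
        gcongr
    _ = _ := by simp only [B]; ring

/-- Fubini's theorem for the expansion of `f` into atoms. The seminorms of the shifted windows grow
polynomially in `z` and the coefficients decay rapidly. -/
theorem kerInt_eq_integral (hφ : Continuous φ) (hR : ∀ Y, ‖Y‖ ≤ ‖Q Y‖ + ‖R Y‖)
    (f χ γ g : 𝓢(EuclideanSpace ℝ α, ℂ)) (hγ : ∫ y, χ y * γ y = 1)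
    (l : EuclideanSpace ℝ σ × EuclideanSpace ℝ σ) :
    kerInt φ P Q R f g κ l = ∫ z : EuclideanSpace ℝ α × EuclideanSpace ℝ α,
      (fourierConst α : ℂ) ^ 2 * tfPair f χ z.1 z.2 *
        kerInt φ P Q R (tfShift γ z.1 (-z.2)) g κ l := by
  simp only [kerInt, ← integral_const_mul]
  rw [← integral_integral_swap (integrable_tfPair_mul_kerFun hφ hR f χ γ g l)]
  congr 1
  funext Y
  rw [kerFun, tfPair_inversion f χ γ hγ (Q Y), mul_assoc, mul_assoc, mul_left_comm, mul_comm (∫ z, _),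
    ← integral_const_mul]
  congr 1
  funext z
  rw [kerFun]
  ring

/-- Fubini's theorem in `l` and `z`. Absolute convergence for the atoms, weighted by the
coefficients of `f`, implies absolute convergence of the pairing for `f`; this is how the
convergence of the defining integral is obtained. -/
theorem opForm_eq_integral (hφ : Continuous φ) (hR : ∀ Y, ‖Y‖ ≤ ‖Q Y‖ + ‖R Y‖)
    (hs : Continuous s) (f χ γ g : 𝓢(EuclideanSpace ℝ α, ℂ)) (hγ : ∫ y, χ y * γ y = 1)
    (h : ∫⁻ z : EuclideanSpace ℝ α × EuclideanSpace ℝ α,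
      ‖tfPair f χ z.1 z.2‖ₑ * opFormAbs φ P Q R κ s (tfShift γ z.1 (-z.2)) g < ∞) :
    opFormAbs φ P Q R κ s f g < ∞ ∧ opForm φ P Q R κ s f g =
      ∫ z : EuclideanSpace ℝ α × EuclideanSpace ℝ α, (fourierConst α : ℂ) ^ 2 *
        tfPair f χ z.1 z.2 * opForm φ P Q R κ s (tfShift γ z.1 (-z.2)) g := by
  set G : (EuclideanSpace ℝ σ × EuclideanSpace ℝ σ) →
      (EuclideanSpace ℝ α × EuclideanSpace ℝ α) → ℂ := fun l z =>
    s l * ((fourierConst α : ℂ) ^ 2 * tfPair f χ z.1 z.2 *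
      kerInt φ P Q R (tfShift γ z.1 (-z.2)) g κ l) with hG
  have hGm : StronglyMeasurable (Function.uncurry G) := by
    have h1 := (stronglyMeasurable_kerInt_atom (P := P) (Q := Q) (R := R) (κ := κ) hφ γ
      g).comp_measurable (measurable_swap (α := EuclideanSpace ℝ σ × EuclideanSpace ℝ σ))
    exact (hs.comp continuous_fst).stronglyMeasurable.mul
      (((continuous_const.mul (continuous_tfPair f χ)).comp
        continuous_snd).stronglyMeasurable.mul h1)
  have hGi : Integrable (Function.uncurry G) (volume.prod volume) := by
    refine ⟨hGm.aestronglyMeasurable, ?_⟩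
    rw [hasFiniteIntegral_iff_enorm, lintegral_prod_symm _ hGm.enorm.aemeasurable]
    have h2 : ∀ z : EuclideanSpace ℝ α × EuclideanSpace ℝ α,
        ∫⁻ l, ‖Function.uncurry G (l, z)‖ₑ = ‖(fourierConst α : ℂ) ^ 2‖ₑ *
          (‖tfPair f χ z.1 z.2‖ₑ * opFormAbs φ P Q R κ s (tfShift γ z.1 (-z.2)) g) := fun z => by
      rw [opFormAbs, ← lintegral_const_mul' _ _ enorm_ne_top, ← lintegral_const_mul' _ _ enorm_ne_top]
      congr 1
      funext l
      simp only [hG, Function.uncurry_apply_pair, enorm_mul]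
      ring
    simp only [h2]
    rw [lintegral_const_mul' _ _ enorm_ne_top]
    exact ENNReal.mul_lt_top enorm_lt_top h
  have hker : ∀ l, s l * kerInt φ P Q R f g κ l = ∫ z, G l z := fun l => by
    rw [kerInt_eq_integral hφ hR f χ γ g hγ l, ← integral_const_mul]
  constructor
  · rw [opFormAbs]
    simp only [hker]
    have := hGi.integral_prod_left
    exact this.2
  · rw [opForm]
    simp only [hker]
    rw [integral_integral_swap hGi]
    congr 1
    funext z
    rw [opForm, ← integral_const_mul]
    congr 1
    funext l
    simp only [hG]
    ring

end Form

/-! ### The abstract boundedness theorem -/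

section Main

variable {α β σ ι : Type} [Fintype α] [Fintype β] [Fintype σ] [Fintype ι]

theorem modNorm_le_hessNorm (v : EuclideanSpace ℝ ι × EuclideanSpace ℝ ι → ℝ)
    (χ : 𝓢(EuclideanSpace ℝ ι, ℂ)) (Φ : ι → ι → 𝓢'(EuclideanSpace ℝ ι, ℂ)) (i j : ι) :
    modNorm v ∞ 1 χ (Φ i j) ≤ hessNorm v χ Φ :=
  le_iSup_of_le i (le_iSup (fun j => modNorm v ∞ 1 χ (Φ i j)) j)

/-- Collects the kernel estimates. `K` and `c'` do not depend on the phase or the symbol, which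
enter only through the integrals of `b` and `A` and through `d` in the Schur constant. -/
theorem isSchurForm_opForm [DecidableEq β] [DecidableEq ι] (e e' : α ⊕ β ≃ ι)
    (R : EuclideanSpace ℝ ι →L[ℝ] EuclideanSpace ℝ σ)
    (hR : ∀ Y, ‖Y‖ ≤ ‖pull (fun k => e' (Sum.inl k)) Y‖ + ‖R Y‖)
    {N M N' : ℕ} (hM : Fintype.card σ < M) (hM' : Fintype.card α < M)
    (γ : 𝓢(EuclideanSpace ℝ α, ℂ)) (κ : 𝓢(EuclideanSpace ℝ σ, ℂ))
    {w₁ w₂ : EuclideanSpace ℝ α × EuclideanSpace ℝ α → ℝ}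
    {w : EuclideanSpace ℝ σ × EuclideanSpace ℝ σ → ℝ} (hw₁ : IsContModerate N w₁)
    (hw₂ : IsContModerate N w₂) (hw : IsContModerate N w) {V : EuclideanSpace ℝ ι → ℝ}
    (hV : ∀ Θ, 0 ≤ V Θ) (hVm : Measurable V) {c : ℝ} (hc : 0 ≤ c) :
    ∃ (K : ℕ) (c' : ℝ), 0 ≤ c' ∧ ∀ (φ : EuclideanSpace ℝ ι → ℝ) (b : EuclideanSpace ℝ ι → ℝ≥0∞),
      ContDiff ℝ 2 φ → Measurable b →
      (∀ (Z : EuclideanSpace ℝ ι) (h : EuclideanSpace ℝ ι → ℂ), Continuous h →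
        (∀ Y, 1 < ‖Y‖ → h Y = 0) → (∀ Θ, ‖fourInt h Θ‖ₑ ≤ ENNReal.ofReal (decay N' Θ)) →
        ∀ Θ, ‖fourInt (fun Y => Complex.exp (Complex.I * taylorRem φ Z Y) * h Y) Θ‖ₑ ≤ b Θ) →
      (∀ i j, ∃ B, ∀ X, |secondPartial φ i j X| ≤ B) →
      (∀ i j, UniformContinuous (secondPartial φ i j)) → ∀ d : ℝ, 0 < d →
      (∀ X, d ≤ |(Matrix.of fun a b : β =>
        secondPartial φ (e (Sum.inr b)) (e' (Sum.inr a)) X).det|) →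
      (∀ X, d ≤ |(Matrix.of fun a b : β =>
        secondPartial φ (e' (Sum.inr b)) (e (Sum.inr a)) X).det|) →
      (∀ z y l Z, w₂ (pull (fun k => e (Sum.inl k)) Z, y.2) ≤
        c * w₁ (pull (fun k => e' (Sum.inl k)) Z, z.2) * w (R Z, l.2) *
          V (kerFreq φ (pull fun k => e (Sum.inl k)) (pull fun k => e' (Sum.inl k)) R z y l Z)) →
      ∀ (s : EuclideanSpace ℝ σ × EuclideanSpace ℝ σ → ℂ) (A : EuclideanSpace ℝ σ → ℝ≥0∞),
        Measurable A → (∀ l, ‖s l‖ₑ * ENNReal.ofReal (w l) ≤ A l.2) →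
        IsSchurForm γ w₁ w₂ (opFormAbs φ (pull fun k => e (Sum.inl k))
          (pull fun k => e' (Sum.inl k)) R κ s) K c'
          ((∫⁻ a : EuclideanSpace ℝ α, ENNReal.ofReal (decay M a)) ^ 2 *
            (ENNReal.ofReal d⁻¹ * (∫⁻ Θ, b Θ * ENNReal.ofReal (V Θ)) * ∫⁻ l, A l))
          (schurKer φ (pull fun k => e (Sum.inl k)) (pull fun k => e' (Sum.inl k)) R A
            (fun Θ => b Θ * ENNReal.ofReal (V Θ)) M) := by
  obtain ⟨K, C, hC, hker⟩ := exists_kerInt_bound (pull fun k => e (Sum.inl k))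
    (pull fun k => e' (Sum.inl k)) R hR N' (N + M)
  have hJ := lintegral_decay_lt_top (ι := σ) hM
  set J := ∫⁻ x : EuclideanSpace ℝ σ, ENNReal.ofReal (decay M x)
  have hsγ := schwartzNorm_nonneg K γ
  have hsκ := schwartzNorm_nonneg K κ
  refine ⟨K, C * (schwartzNorm K γ * schwartzNorm K κ) * (c * J.toReal), by positivity,
    fun φ b hφ hbm hb hbd huc d hd hdet hdet' hW s A hA hF => ?_⟩
  have hh : Measurable fun Θ => b Θ * ENNReal.ofReal (V Θ) := hbm.mul hVm.ennreal_ofReal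
  refine ⟨measurable_schurKer hφ hA hh M,
    fun y => lintegral_schurKer_le e e' hφ hbd huc hd hdet hA hh hM' y,
    fun z => lintegral_schurKer_right_le e e' hφ hbd huc hd hdet' hA hh hM' z, fun g z y => ?_⟩
  have hsg := schwartzNorm_nonneg K g
  have h1 := lintegral_kernel_le hφ hM hw₁ hw₂ hw hV hVm hc hW hbm hA hF z y
  set k : ℝ := C * (schwartzNorm K γ * schwartzNorm K g * schwartzNorm K κ) with hk
  have hk0 : 0 ≤ k := by positivity
  have h2 : opFormAbs φ (pull fun k => e (Sum.inl k)) (pull fun k => e' (Sum.inl k)) R κ s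
      (tfShift γ z.1 (-z.2)) (tfShift g y.1 y.2) ≤ ENNReal.ofReal k * ∫⁻ l, ‖s l‖ₑ * ∫⁻ Z,
        ENNReal.ofReal (decay (N + M) (pull (fun k => e' (Sum.inl k)) Z - z.1) *
          decay (N + M) (pull (fun k => e (Sum.inl k)) Z - y.1) * decay (N + M) (R Z - l.1)) *
            b (kerFreq φ (pull fun k => e (Sum.inl k)) (pull fun k => e' (Sum.inl k)) R z y l Z) := by
    rw [opFormAbs, ← lintegral_const_mul' _ _ ENNReal.ofReal_ne_top]
    refine lintegral_mono fun l => ?_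
    rw [enorm_mul, mul_left_comm]
    exact mul_le_mul_right (hker φ b hφ hb γ g κ z y l) _
  refine (mul_le_mul_left h2 _).trans ?_
  rw [mul_assoc]
  refine (mul_le_mul_right h1 _).trans_eq ?_
  have h3 : ENNReal.ofReal c * J = ENNReal.ofReal (c * J.toReal) := by
    rw [ENNReal.ofReal_mul hc, ENNReal.ofReal_toReal hJ.ne]
  change ENNReal.ofReal k * (ENNReal.ofReal c * J * _) = _
  rw [h3, ← mul_assoc, ← ENNReal.ofReal_mul hk0, hk]
  congr 2
  ring

/-- The Schur constant is a product: `d⁻¹` from the substitution, the symbol norm from the change of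
windows to `κ`, and the exponential of the Hessian norm from the majorant `b`. The factor `k`
carries the normalization that distinguishes the two types of operator. -/
theorem exists_bounded_operator [DecidableEq β] [DecidableEq ι] (e e' : α ⊕ β ≃ ι)
    (R : EuclideanSpace ℝ ι →L[ℝ] EuclideanSpace ℝ σ)
    (hR : ∀ Y, ‖Y‖ ≤ ‖pull (fun k => e' (Sum.inl k)) Y‖ + ‖R Y‖) {N N' : ℕ}
    {p : ℝ≥0∞} (hp1 : 1 < p) (hp : p ≠ ∞)
    {w₁ w₂ : EuclideanSpace ℝ α × EuclideanSpace ℝ α → ℝ}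
    {w : EuclideanSpace ℝ σ × EuclideanSpace ℝ σ → ℝ} (hw₁ : IsContModerate N w₁)
    (hw₂ : IsContModerate N w₂) (hw : IsContModerate N w) {V : EuclideanSpace ℝ ι → ℝ}
    (hV : IsContModerate N' V) {cV : ℝ} (hcV : 0 ≤ cV) (hsub : ∀ x y, V (x + y) ≤ cV * V x * V y)
    (hdil : ∀ t ∈ Set.Icc (0 : ℝ) 1, ∀ Ξ, V (t • Ξ) ≤ cV * V Ξ) {c : ℝ} (hc : 0 ≤ c)
    (χ : 𝓢(EuclideanSpace ℝ α, ℂ)) (hχ : χ ≠ 0) (χι : 𝓢(EuclideanSpace ℝ ι, ℂ)) (hχι : χι ≠ 0)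
    (χσ : 𝓢(EuclideanSpace ℝ σ, ℂ)) (hχσ : χσ ≠ 0) (κ : 𝓢(EuclideanSpace ℝ σ, ℂ)) (k : ℂ) :
    ∃ C : ℝ, 0 < C ∧ ∀ d : ℝ, 0 < d → ∀ (φ : EuclideanSpace ℝ ι → ℝ)
      (Φ : ι → ι → 𝓢'(EuclideanSpace ℝ ι, ℂ)), ContDiff ℝ 2 φ →
      (∀ i j, IsGivenBy (Φ i j) (secondPartial φ i j)) →
      hessNorm (fun z => V z.2) χι Φ < ∞ →
      (∀ X, d ≤ |(Matrix.of fun a b : β =>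
        secondPartial φ (e (Sum.inr b)) (e' (Sum.inr a)) X).det|) →
      (∀ X, d ≤ |(Matrix.of fun a b : β =>
        secondPartial φ (e' (Sum.inr b)) (e (Sum.inr a)) X).det|) →
      (∀ z y l Z, w₂ (pull (fun k => e (Sum.inl k)) Z, y.2) ≤
        c * w₁ (pull (fun k => e' (Sum.inl k)) Z, z.2) * w (R Z, l.2) *
          V (kerFreq φ (pull fun k => e (Sum.inl k)) (pull fun k => e' (Sum.inl k)) R z y l Z)) →
      ∀ a : 𝓢'(EuclideanSpace ℝ σ, ℂ), modNorm w ∞ 1 χσ a < ∞ →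
      ∃ T : 𝓢'(EuclideanSpace ℝ α, ℂ) → 𝓢'(EuclideanSpace ℝ α, ℂ),
        (∀ f g : 𝓢(EuclideanSpace ℝ α, ℂ),
          Integrable (fun l : EuclideanSpace ℝ σ × EuclideanSpace ℝ σ => k * stft κ a l.1 l.2 *
            kerInt φ (pull fun k => e (Sum.inl k)) (pull fun k => e' (Sum.inl k)) R f g κ l) ∧
          T (f : 𝓢'(EuclideanSpace ℝ α, ℂ)) g =
            ∫ l : EuclideanSpace ℝ σ × EuclideanSpace ℝ σ, k * stft κ a l.1 l.2 *
            kerInt φ (pull fun k => e (Sum.inl k)) (pull fun k => e' (Sum.inl k)) R f g κ l) ∧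
        (∀ f g, modNorm w₁ p p χ f < ∞ → modNorm w₁ p p χ g < ∞ → T (f + g) = T f + T g) ∧
        (∀ (r : ℂ) f, modNorm w₁ p p χ f < ∞ → T (r • f) = r • T f) ∧
        ∀ f, modNorm w₁ p p χ f < ∞ → modNorm w₂ p p χ (T f) ≤
          ENNReal.ofReal (C * d⁻¹ * (modNorm w ∞ 1 χσ a).toReal *
            Real.exp (C * (hessNorm (fun z => V z.2) χι Φ).toReal)) * modNorm w₁ p p χ f := by
  obtain ⟨γ, hγ⟩ := exists_dual_window χ hχ
  obtain ⟨Ca, hCa, hA⟩ := exists_stft_bound hw χσ hχσ κ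
  obtain ⟨C₁, hC₁, hmul⟩ := exists_isMultiplier_phase hV hcV hsub hdil χι hχι
  -- Large enough for the decay to be integrable both on the space of the symbol and on that of the
  -- functions.
  set M := Fintype.card σ + Fintype.card α + 1 with hMdef
  have hM : Fintype.card σ < M := by omega
  have hM' : Fintype.card α < M := by omega
  obtain ⟨K, c', hc', hform⟩ := isSchurForm_opForm e e' R hR (N' := N' + (Fintype.card ι + 1))
    hM hM' γ κ hw₁ hw₂ hw (fun Θ => (hV.pos Θ).le) hV.continuous.measurable hc
  have hJα := lintegral_decay_lt_top (ι := α) hM'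
  have hJV := lintegral_decay_mul_weight_lt_top hV (Nat.lt_succ_self (Fintype.card ι))
  set Jα := ∫⁻ x : EuclideanSpace ℝ α, ENNReal.ofReal (decay M x)
  set JV := ∫⁻ Θ : EuclideanSpace ℝ ι, ENNReal.ofReal (decay (N' + (Fintype.card ι + 1)) Θ) *
    ENNReal.ofReal (V Θ)
  have hfc := (fourierConst_pos α).le
  have hsχ := schwartzNorm_nonneg K χ
  set q : ℝ := fourierConst α ^ 2 * (c' * schwartzNorm K χ) with hq
  have hq0 : 0 ≤ q := by positivity
  set C₂ : ℝ := q * (Jα.toReal ^ 2 * (JV.toReal * (‖k‖ * Ca.toReal))) with hC₂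
  have hC₂0 : 0 ≤ C₂ := by positivity
  -- `C₁` is needed in the exponent and `C₂` in front; the sum serves in both places, and adding one
  -- makes it positive.
  refine ⟨C₁ + C₂ + 1, by positivity, fun d hd φ Φ hφ hΦ hfin hdet hdet' hW a ha => ?_⟩
  set H := (hessNorm (fun z => V z.2) χι Φ).toReal with hH
  have hH0 : 0 ≤ H := ENNReal.toReal_nonneg
  obtain ⟨b, hbm, hbint, hb⟩ := (hmul φ Φ hφ hΦ hfin).exists_majorant
    (fun Θ => ENNReal.ofReal (decay (N' + (Fintype.card ι + 1)) Θ))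
    (continuous_decay _).measurable.ennreal_ofReal
  obtain ⟨A, hAm, hAb, hAint⟩ := hA a
  have hbd : ∀ i j, ∃ B, ∀ X, |secondPartial φ i j X| ≤ B := fun i j =>
    exists_bound_of_isGivenBy hV hdil hχι (continuous_secondPartial hφ i j) (hΦ i j)
      ((modNorm_le_hessNorm _ _ _ i j).trans_lt hfin)
  have huc : ∀ i j, UniformContinuous (secondPartial φ i j) := fun i j =>
    uniformContinuous_of_isGivenBy hV hdil hχι (continuous_secondPartial hφ i j) (hΦ i j)
      ((modNorm_le_hessNorm _ _ _ i j).trans_lt hfin)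
  have hs : Continuous fun l : EuclideanSpace ℝ σ × EuclideanSpace ℝ σ => k * stft κ a l.1 l.2 :=
    continuous_const.mul (continuous_stft κ a)
  have hF : ∀ l : EuclideanSpace ℝ σ × EuclideanSpace ℝ σ,
      ‖k * stft κ a l.1 l.2‖ₑ * ENNReal.ofReal (w l) ≤ ‖k‖ₑ * A l.2 := fun l => by
    rw [enorm_mul, mul_assoc]
    exact mul_le_mul_right (hAb l.1 l.2) _
  have h := hform φ b hφ hbm hb hbd huc d hd hdet hdet' hW _ _ (hAm.const_mul ‖k‖ₑ) hF
  have hS : Jα ^ 2 * (ENNReal.ofReal d⁻¹ * (∫⁻ Θ, b Θ * ENNReal.ofReal (V Θ)) *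
      ∫⁻ l, ‖k‖ₑ * A l) ≤ ENNReal.ofReal (Jα.toReal ^ 2 * (d⁻¹ * (Real.exp (C₁ * H) * JV.toReal) *
        (‖k‖ * (Ca.toReal * (modNorm w ∞ 1 χσ a).toReal)))) := by
    rw [lintegral_const_mul _ hAm]
    calc _ ≤ Jα ^ 2 * (ENNReal.ofReal d⁻¹ * (ENNReal.ofReal (Real.exp (C₁ * H)) * JV) *
          (‖k‖ₑ * (Ca * modNorm w ∞ 1 χσ a))) := by gcongr
      _ = _ := by
          rw [ENNReal.ofReal_mul (by positivity), ENNReal.ofReal_mul (by positivity),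
            ENNReal.ofReal_mul (by positivity), ENNReal.ofReal_mul (by positivity),
            ENNReal.ofReal_mul (by positivity), ENNReal.ofReal_mul (by positivity),
            ENNReal.ofReal_pow (by positivity), ENNReal.ofReal_toReal hJα.ne,
            ENNReal.ofReal_toReal hJV.ne, ENNReal.ofReal_toReal hCa.ne,
            ENNReal.ofReal_toReal ha.ne, ofReal_norm]
  obtain ⟨T, hT, hadd, hsmul, hbound⟩ := h.exists_operator (χ := χ) hw₁ hw₂ hc'
    (hS.trans_lt ENNReal.ofReal_lt_top).ne hp1 hp (B := opForm φ (pull fun k => e (Sum.inl k))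
      (pull fun k => e' (Sum.inl k)) R κ _) (fun f g => enorm_opForm_le f g)
    (fun g => (stronglyMeasurable_opForm_atom hφ.continuous hs γ g).aestronglyMeasurable)
    (fun f g g' => opForm_add hφ.continuous hR hs) opForm_smul
    (fun f g => opForm_eq_integral hφ.continuous hR hs f χ γ g hγ)
  refine ⟨T, fun f g => ⟨integrable_opForm hφ.continuous hs (hT f g).1, (hT f g).2⟩, hadd, hsmul,
    fun f hf => (hbound f hf).trans (mul_le_mul_left ?_ _)⟩
  refine (mul_le_mul_right hS _).trans ?_
  rw [← ENNReal.ofReal_mul hq0]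
  refine ENNReal.ofReal_le_ofReal ?_
  have ha0 : 0 ≤ (modNorm w ∞ 1 χσ a).toReal := ENNReal.toReal_nonneg
  calc _ = C₂ * d⁻¹ * (modNorm w ∞ 1 χσ a).toReal * Real.exp (C₁ * H) := by
        simp only [hC₂]; ring
    _ ≤ _ := by
        gcongr <;> linarith

end Main

/-! ### Application to the phase function and the given weights -/

section Phase

variable {n m : ℕ}

theorem secondPartial_comm {ι : Type} [Fintype ι] [DecidableEq ι] {φ : EuclideanSpace ℝ ι → ℝ}
    (hφ : ContDiff ℝ 2 φ) (i j : ι) (X : EuclideanSpace ℝ ι) :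
    secondPartial φ i j X = secondPartial φ j i X := by
  have hd : Differentiable ℝ (fderiv ℝ φ) :=
    (hφ.fderiv_right (m := 1) (by norm_num)).differentiable one_ne_zero
  have h1 : ∀ k l, secondPartial φ k l X = fderiv ℝ (fderiv ℝ φ) X (EuclideanSpace.single k 1)
      (EuclideanSpace.single l 1) := fun k l => by
    rw [secondPartial, fderiv_clm_apply (hd X) (differentiableAt_const _)]
    simp
  have h2 : IsSymmSndFDerivAt ℝ φ X :=
    hφ.contDiffAt.isSymmSndFDerivAt (by simp)
  rw [h1, h1, h2.eq]

/-- The exchange of the first two sets of coordinates of `(x, y, ζ)`. -/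
def swapEquiv (n m : ℕ) : Fin n ⊕ (Fin n ⊕ Fin m) ≃ Fin n ⊕ (Fin n ⊕ Fin m) where
  toFun := Sum.elim (fun i => Sum.inr (Sum.inl i))
    (Sum.elim (fun i => Sum.inl i) fun k => Sum.inr (Sum.inr k))
  invFun := Sum.elim (fun i => Sum.inr (Sum.inl i))
    (Sum.elim (fun i => Sum.inl i) fun k => Sum.inr (Sum.inr k))
  left_inv := by rintro (i | i | k) <;> rfl
  right_inv := by rintro (i | i | k) <;> rfl

/-- The Jacobian of `(y, ζ) ↦ (φ'_x, φ'_ζ)` differentiates in the opposite order, so symmetry of the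
second derivatives is used. The Jacobian for the second Schur bound is the transpose and needs no
symmetry. -/
theorem mixedHessian_eq {φ : Rnnm n m → ℝ} (hφ : ContDiff ℝ 2 φ) (X : Rnnm n m) :
    (Matrix.of fun a b : Fin n ⊕ Fin m => secondPartial φ (Equiv.refl _ (Sum.inr b))
      (swapEquiv n m (Sum.inr a)) X) = mixedHessian φ X := by
  ext (a | a) (b | b) <;> exact secondPartial_comm hφ _ _ X

theorem mixedHessian_transpose_eq (φ : Rnnm n m → ℝ) (X : Rnnm n m) :
    (Matrix.of fun a b : Fin n ⊕ Fin m => secondPartial φ (swapEquiv n m (Sum.inr b))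
      (Equiv.refl _ (Sum.inr a)) X) = (mixedHessian φ X).transpose := by
  ext (a | a) (b | b) <;> rfl

/-- The projection `(x, y, ζ) ↦ x`. -/
abbrev projX (n m : ℕ) : Rnnm n m →L[ℝ] Rn n := pull fun k => Equiv.refl _ (Sum.inl k)

/-- The projection `(x, y, ζ) ↦ y`. -/
abbrev projY (n m : ℕ) : Rnnm n m →L[ℝ] Rn n := pull fun k => swapEquiv n m (Sum.inl k)

/-- The projection `(x, y, ζ) ↦ (x, ζ)`. -/
abbrev projXZ (n m : ℕ) : Rnnm n m →L[ℝ] Rnm n m := pull fun k => swapEquiv n m (Sum.inr k)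

theorem projX_apply (X : Rnnm n m) : projX n m X = px X := rfl

theorem projY_apply (X : Rnnm n m) : projY n m X = py X := rfl

theorem projXZ_apply (X : Rnnm n m) : projXZ n m X = mk2 (px X) (pz X) := by
  ext (i | k) <;> rfl

theorem hessNorm_lt_top {v : Rnnm n m × Rnnm n m → ℝ} {χ : 𝓢(Rnnm n m, ℂ)} {d : ℝ}
    {φ : Rnnm n m → ℝ} {Φ} (h : IsPhase v χ d φ Φ) : hessNorm v χ Φ < ∞ := by
  have h1 : hessNorm v χ Φ ≤ ∑ i, ∑ j, modNorm v ∞ 1 χ (Φ i j) :=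
    iSup₂_le fun i j => (Finset.single_le_sum (f := fun j => modNorm v ∞ 1 χ (Φ i j))
      (fun _ _ => zero_le) (Finset.mem_univ j)).trans
      (Finset.single_le_sum (f := fun i => ∑ j, modNorm v ∞ 1 χ (Φ i j))
        (fun _ _ => zero_le) (Finset.mem_univ i))
  exact h1.trans_lt (ENNReal.sum_lt_top.2 fun i _ => ENNReal.sum_lt_top.2 fun j _ => h.mem i j)

/-- Submultiplicativity and the dilation condition survive the passage to an equivalent continuous
weight, with larger constants. As `v` does not depend on the position, a weight of the frequency
alone results. -/
theorem exists_isContModerate_of_isSubmultiplicative {E : Type} [NormedAddCommGroup E]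
    [NormedSpace ℝ E] [MeasureSpace E] {v : E × E → ℝ} (hv : IsPolyModerate v)
    (hsub : IsSubmultiplicative v) (hconst : ∀ X X' Ξ, v (X, Ξ) = v (X', Ξ))
    (hdil : ∃ C : ℝ, ∀ t ∈ Set.Icc (0 : ℝ) 1, ∀ X Ξ, v (X, t • Ξ) ≤ C * v (X, Ξ)) :
    ∃ (N : ℕ) (V : E → ℝ) (c : ℝ), 0 ≤ c ∧ IsContModerate N V ∧
      (∀ X Ξ, V Ξ ≤ v (X, Ξ) ∧ v (X, Ξ) ≤ c * V Ξ) ∧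
      (∀ x y, V (x + y) ≤ c * V x * V y) ∧
      ∀ t ∈ Set.Icc (0 : ℝ) 1, ∀ Ξ, V (t • Ξ) ≤ c * V Ξ := by
  obtain ⟨hpos, -, C₁, N₁, h₁⟩ := hv
  obtain ⟨C₂, h₂⟩ := hsub
  obtain ⟨C₃, h₃⟩ := hdil
  obtain ⟨N, C, V, hC, hV, hVv⟩ := exists_isContModerate (ω := fun Ξ => v (0, Ξ))
    (fun Ξ => hpos _) ⟨C₁, N₁, fun x y => by
      have := h₁ (0, x) (0, y)
      simpa [Prod.norm_def] using this⟩
  -- One constant for all the conclusions: each summand suffices for one of them.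
  refine ⟨N, V, C + |C₂| * C * C + |C₃| * C, by positivity, hV, fun X Ξ => ?_, fun x y => ?_,
    fun t ht Ξ => ?_⟩
  · rw [hconst X 0]
    refine ⟨(hVv Ξ).1, (hVv Ξ).2.trans ?_⟩
    have := (hV.pos Ξ).le
    gcongr
    have : 0 ≤ |C₂| * C * C + |C₃| * C := by positivity
    linarith
  · have hx := hVv x
    have hy := hVv y
    have hx0 := (hV.pos x).le
    have hy0 := (hV.pos y).le
    have hp := (hpos (0, x)).le
    have hp' := (hpos (0, y)).le
    calc V (x + y) ≤ v (0, x + y) := (hVv _).1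
      _ ≤ C₂ * v (0, x) * v (0, y) := by simpa using h₂ (0, x) (0, y)
      _ ≤ |C₂| * (C * V x) * (C * V y) := by
          gcongr
          · exact le_abs_self _
          · exact hx.2
          · exact hy.2
      _ = |C₂| * C * C * V x * V y := by ring
      _ ≤ _ := by
          gcongr
          have : 0 ≤ |C₃| * C := by positivity
          linarith
  · have hx0 := (hV.pos Ξ).le
    have hp := (hpos (0, Ξ)).le
    calc V (t • Ξ) ≤ v (0, t • Ξ) := (hVv _).1
      _ ≤ C₃ * v (0, Ξ) := h₃ t ht 0 Ξ
      _ ≤ |C₃| * (C * V Ξ) := by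
          gcongr
          · exact le_abs_self _
          · exact (hVv Ξ).2
      _ = |C₃| * C * V Ξ := by ring
      _ ≤ _ := by
          gcongr
          have : 0 ≤ |C₂| * C * C := by positivity
          linarith

theorem modNorm_mono {ι : Type} [Fintype ι] {u u' : EuclideanSpace ℝ ι × EuclideanSpace ℝ ι → ℝ}
    (hu : ∀ z, 0 < u z) (h : ∀ z, u z ≤ u' z) (p q : ℝ≥0∞) (χ : 𝓢(EuclideanSpace ℝ ι, ℂ))
    (f : 𝓢'(EuclideanSpace ℝ ι, ℂ)) : modNorm u p q χ f ≤ modNorm u' p q χ f := by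
  have h1 := modNorm_le_mul (ω := u) (w := u') (c := 1) (fun z => by
    rw [one_mul, abs_of_pos (hu z)]
    exact (h z).trans (le_abs_self _)) p q χ f
  rwa [ENNReal.ofReal_one, one_mul] at h1

/-- Boundedness of Fourier integral operators, in terms of a bound for the weights at the
frequencies which occur in the interaction of atoms. -/
theorem exists_bounded_operator_of_isPhase {σ : Type} [Fintype σ]
    (R : Rnnm n m →L[ℝ] EuclideanSpace ℝ σ)
    (hR : ∀ Y, ‖Y‖ ≤ ‖projY n m Y‖ + ‖R Y‖) {p : ℝ≥0∞} (hp1 : 1 < p) (hp : p ≠ ∞)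
    {ω₁ ω₂ : Rn n × Rn n → ℝ} {ω : EuclideanSpace ℝ σ × EuclideanSpace ℝ σ → ℝ}
    (hω₁ : IsPolyModerate ω₁) (hω₂ : IsPolyModerate ω₂) (hω : IsPolyModerate ω)
    {v : Rnnm n m × Rnnm n m → ℝ} (hv : IsPolyModerate v)
    (hsub : IsSubmultiplicative v) (hconst : ∀ X X' Ξ, v (X, Ξ) = v (X', Ξ))
    (hdil : ∃ C : ℝ, ∀ t ∈ Set.Icc (0 : ℝ) 1, ∀ X Ξ, v (X, t • Ξ) ≤ C * v (X, Ξ))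
    {c : ℝ} (hc : 0 ≤ c) (χ : 𝓢(Rn n, ℂ)) (hχ : χ ≠ 0) (χ₃ : 𝓢(Rnnm n m, ℂ)) (hχ₃ : χ₃ ≠ 0)
    (χσ : 𝓢(EuclideanSpace ℝ σ, ℂ)) (hχσ : χσ ≠ 0) (κ : 𝓢(EuclideanSpace ℝ σ, ℂ)) (k : ℂ) :
    ∃ C : ℝ, 0 < C ∧ ∀ d : ℝ, 0 < d → ∀ φ Φ, IsPhase v χ₃ d φ Φ →
      (∀ z y l Z, ω₂ (px Z, y.2) ≤ c * ω₁ (py Z, z.2) * ω (R Z, l.2) *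
          v (0, kerFreq φ (projX n m) (projY n m) R z y l Z)) →
      ∀ a : 𝓢'(EuclideanSpace ℝ σ, ℂ), modNorm ω ∞ 1 χσ a < ∞ →
      ∃ T : 𝓢'(Rn n, ℂ) → 𝓢'(Rn n, ℂ),
        (∀ f g : 𝓢(Rn n, ℂ),
          Integrable (fun l : EuclideanSpace ℝ σ × EuclideanSpace ℝ σ => k * stft κ a l.1 l.2 *
            kerInt φ (projX n m) (projY n m) R f g κ l) ∧
          T (f : 𝓢'(Rn n, ℂ)) g =
            ∫ l : EuclideanSpace ℝ σ × EuclideanSpace ℝ σ, k * stft κ a l.1 l.2 *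
              kerInt φ (projX n m) (projY n m) R f g κ l) ∧
        IsBoundedLinear (modNorm ω₁ p p χ) (modNorm ω₂ p p χ)
          (C * d⁻¹ * (modNorm ω ∞ 1 χσ a).toReal * Real.exp (C * (hessNorm v χ₃ Φ).toReal)) T := by
  obtain ⟨N₁, c₁, w₁, hc₁, hw₁, h₁⟩ := exists_isContModerate hω₁.1 hω₁.2.2
  obtain ⟨N₂, c₂, w₂, hc₂, hw₂, h₂⟩ := exists_isContModerate hω₂.1 hω₂.2.2
  obtain ⟨N₃, c₃, w, hc₃, hw, h₃⟩ := exists_isContModerate hω.1 hω.2.2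
  obtain ⟨N', V, cV, hcV, hV, hVv, hVsub, hVdil⟩ :=
    exists_isContModerate_of_isSubmultiplicative hv hsub hconst hdil
  obtain ⟨C, hC, hop⟩ := exists_bounded_operator (Equiv.refl _) (swapEquiv n m) R hR
    (N := N₁ + N₂ + N₃) hp1 hp (hw₁.mono (by omega)) (hw₂.mono (by omega)) (hw.mono (by omega)) hV
    hcV hVsub hVdil (c := c * c₁ * c₃ * cV) (by positivity) χ hχ χ₃ hχ₃ χσ hχσ κ k
  -- The regularized weights lie below the original ones, so replacing them in the norms of `a`,
  -- `φ''` and `f` is free. Only the target norm costs a factor, namely `c₂`.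
  refine ⟨C + c₂ * C, by positivity, fun d hd φ Φ hΦ hW a ha => ?_⟩
  have hhess : hessNorm (fun z => V z.2) χ₃ Φ ≤ hessNorm v χ₃ Φ :=
    iSup₂_mono fun i j => modNorm_mono (fun z => hV.pos z.2) (fun z => (hVv z.1 z.2).1) _ _ _ _
  have hfin := hessNorm_lt_top hΦ
  have ha' := (modNorm_mono hw.pos (fun z => (h₃ z).1) ∞ 1 χσ a)
  obtain ⟨T, hT, hadd, hsmul, hbound⟩ := hop d hd φ Φ hΦ.contDiff hΦ.isGivenBy
    (hhess.trans_lt hfin)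
    (fun X => by rw [mixedHessian_eq hΦ.contDiff]; exact hΦ.det X)
    (fun X => by rw [mixedHessian_transpose_eq, Matrix.det_transpose]; exact hΦ.det X)
    (fun z y l Z => by
      have e1 := (hω₁.1 (py Z, z.2)).le
      have e2 := (hω.1 (R Z, l.2)).le
      have e3 := (hv.1 (0, kerFreq φ (projX n m) (projY n m) R z y l Z)).le
      have e4 := (hw₁.pos (py Z, z.2)).le
      have e5 := (hw.pos (R Z, l.2)).le
      calc _ ≤ ω₂ (px Z, y.2) := (h₂ _).1
        _ ≤ _ := hW z y l Z
        _ ≤ c * (c₁ * w₁ (py Z, z.2)) * (c₃ * w (R Z, l.2)) *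
            (cV * V (kerFreq φ (projX n m) (projY n m) R z y l Z)) := by
            gcongr
            · exact (h₁ _).2
            · exact (h₃ _).2
            · exact (hVv _ _).2
        _ = _ := by
            simp only [← projY_apply]
            ring) a (ha'.trans_lt ha)
  have hlt : ∀ f, modNorm ω₁ p p χ f < ∞ → modNorm w₁ p p χ f < ∞ := fun f hf =>
    (modNorm_mono hw₁.pos (fun z => (h₁ z).1) p p χ f).trans_lt hf
  refine ⟨T, hT, fun f g hf hg => hadd f g (hlt f hf) (hlt g hg), fun r f hf => hsmul r f (hlt f hf),
    fun f hf => ?_⟩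
  have h4 : modNorm ω₂ p p χ (T f) ≤ ENNReal.ofReal c₂ * modNorm w₂ p p χ (T f) :=
    modNorm_le_mul (fun z => by
      rw [abs_of_pos (hω₂.1 z), abs_of_pos (hw₂.pos z)]
      exact (h₂ z).2) p p χ _
  refine h4.trans ((mul_le_mul_right (hbound f (hlt f hf)) _).trans ?_)
  rw [← mul_assoc, ← ENNReal.ofReal_mul hc₂.le]
  refine mul_le_mul' (ENNReal.ofReal_le_ofReal ?_) (modNorm_mono hw₁.pos (fun z => (h₁ z).1) p p χ f)
  have h5 : (modNorm w ∞ 1 χσ a).toReal ≤ (modNorm ω ∞ 1 χσ a).toReal := ENNReal.toReal_mono ha.ne ha'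
  have h6 : (hessNorm (fun z => V z.2) χ₃ Φ).toReal ≤ (hessNorm v χ₃ Φ).toReal :=
    ENNReal.toReal_mono hfin.ne hhess
  have h7 : 0 ≤ (hessNorm (fun z => V z.2) χ₃ Φ).toReal := ENNReal.toReal_nonneg
  have h8 : 0 ≤ (modNorm w ∞ 1 χσ a).toReal := ENNReal.toReal_nonneg
  have h9 : 0 < c₂ * C := by positivity
  generalize (modNorm w ∞ 1 χσ a).toReal = r at *
  generalize (modNorm ω ∞ 1 χσ a).toReal = r' at *
  generalize (hessNorm (fun z => V z.2) χ₃ Φ).toReal = s at *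
  generalize (hessNorm v χ₃ Φ).toReal = s' at *
  have h10 : 0 ≤ r' := h8.trans h5
  calc _ = c₂ * C * d⁻¹ * r * Real.exp (C * s) := by ring
    _ ≤ _ := by gcongr <;> linarith

end Phase

/-! ### Symbols and amplitudes -/

section Parts

variable {n m : ℕ}

theorem norm_le_norm_pull_add_norm_pull {α β ι : Type} [Fintype α] [Fintype β] [Fintype ι]
    (e : α ⊕ β ≃ ι) (Z : EuclideanSpace ℝ ι) :
    ‖Z‖ ≤ ‖pull (fun k => e (Sum.inl k)) Z‖ + ‖pull (fun k => e (Sum.inr k)) Z‖ := by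
  refine abs_le_of_sq_le_sq' ?_ (by positivity) |>.2
  have h : ‖Z‖ ^ 2 = ‖pull (fun k => e (Sum.inl k)) Z‖ ^ 2 +
      ‖pull (fun k => e (Sum.inr k)) Z‖ ^ 2 := by
    simp only [EuclideanSpace.norm_sq_eq, pull_apply]
    rw [← e.sum_comp, Fintype.sum_sum_type]
  rw [h]
  nlinarith [mul_nonneg (norm_nonneg (pull (fun k => e (Sum.inl k)) Z))
    (norm_nonneg (pull (fun k => e (Sum.inr k)) Z))]

theorem adjoint_pull_inr {α β ι : Type} [Fintype α] [Fintype β] [Fintype ι] (e : α ⊕ β ≃ ι) :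
    (pull (fun k => e (Sum.inr k))).adjoint = inR e := by
  symm
  rw [ContinuousLinearMap.eq_adjoint_iff]
  intro x y
  simp only [PiLp.inner_apply]
  rw [← e.sum_comp, Fintype.sum_sum_type]
  simp [inR_apply]

theorem mk3_eq (x y : Rn n) (ζ : Rn m) :
    mk3 x y ζ = inL (swapEquiv n m) y + inR (swapEquiv n m) (mk2 x ζ) := by
  ext (i | i | k) <;> simp [mk3, mk2, inL_apply, inR_apply, swapEquiv]

theorem mk2_px2_pz2 (Y : Rnm n m) : mk2 (px2 Y) (pz2 Y) = Y := by
  ext (i | k) <;> rfl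

/-- The frequency of the interaction of atoms, for amplitudes `a (x, y, ζ)`. -/
theorem add_kerFreq_id (φ : Rnnm n m → ℝ) (z w : Rn n × Rn n) (l : Rnnm n m × Rnnm n m)
    (Z : Rnnm n m) :
    l.2 + kerFreq φ (projX n m) (projY n m) (ContinuousLinearMap.id ℝ _) z w l Z =
      mk3 (w.2 - px (gradient φ Z)) (-z.2 - py (gradient φ Z)) (-pz (gradient φ Z)) := by
  rw [kerFreq, adjoint_pull_inl, adjoint_pull_inl, ContinuousLinearMap.adjoint_id]
  ext (i | i | k) <;> simp [mk3, inL_apply, swapEquiv, px, py, pz] <;> ring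

/-- The frequency of the interaction of atoms, for symbols `a (x, ζ)`. -/
theorem add_kerFreq_projXZ (φ : Rnnm n m → ℝ) (z w : Rn n × Rn n) (l : Rnm n m × Rnm n m)
    (Z : Rnnm n m) :
    l.2 + mk2 (px (kerFreq φ (projX n m) (projY n m) (projXZ n m) z w l Z))
      (pz (kerFreq φ (projX n m) (projY n m) (projXZ n m) z w l Z)) =
      mk2 (w.2 - px (gradient φ Z)) (-pz (gradient φ Z)) := by
  rw [kerFreq, adjoint_pull_inl, adjoint_pull_inl, adjoint_pull_inr]
  ext (i | k) <;> simp [mk2, inL_apply, inR_apply, swapEquiv, px, pz] <;> ring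

theorem add_py_kerFreq_projXZ (φ : Rnnm n m → ℝ) (z w : Rn n × Rn n) (l : Rnm n m × Rnm n m)
    (Z : Rnnm n m) :
    z.2 + py (kerFreq φ (projX n m) (projY n m) (projXZ n m) z w l Z) = -py (gradient φ Z) := by
  rw [kerFreq, adjoint_pull_inl, adjoint_pull_inl, adjoint_pull_inr]
  ext i
  simp [inL_apply, inR_apply, swapEquiv, py]
  ring

theorem stftFun_opKernelFun (φ : Rnnm n m → ℝ) (f g : 𝓢(Rn n, ℂ)) (κ : 𝓢(Rnnm n m, ℂ))
    (l : Rnnm n m × Rnnm n m) : stftFun κ (opKernelFun φ f g) l.1 (-l.2) =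
      (fourierConst (Fin n ⊕ (Fin n ⊕ Fin m)) * (((2 * π) ^ n)⁻¹ : ℝ)) *
        kerInt φ (projX n m) (projY n m) (ContinuousLinearMap.id ℝ _) f g κ l := by
  rw [stftFun, kerInt, mul_assoc]
  congr 1
  rw [← integral_const_mul]
  congr 1
  funext Y
  rw [opKernelFun, kerFun, projX_apply, projY_apply, ContinuousLinearMap.id_apply]
  ring

/-- The inner integral over `y` in the kernel and the outer one over `(x, ζ)` combine by Fubini's
theorem into one integral over `(x, y, ζ)`. -/
theorem stftFun_opZeroKernelFun {φ : Rnnm n m → ℝ} (hφ : Continuous φ) (f g : 𝓢(Rn n, ℂ))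
    (κ : 𝓢(Rnm n m, ℂ)) (l : Rnm n m × Rnm n m) :
    stftFun κ (opZeroKernelFun φ f g) l.1 (-l.2) = fourierConst (Fin n ⊕ Fin m) *
      kerInt φ (projX n m) (projY n m) (projXZ n m) f g κ l := by
  rw [stftFun, kerInt, integral_eq_integral_split (swapEquiv n m)
    (integrable_kerFun hφ (norm_le_norm_pull_add_norm_pull (swapEquiv n m)) f g κ l)]
  congr 2
  funext Y
  rw [opZeroKernelFun, mul_assoc, ← integral_mul_const]
  congr 1
  funext y
  have h := mk3_eq (px2 Y) y (pz2 Y)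
  rw [mk2_px2_pz2] at h
  rw [← h, kerFun, projXZ_apply]
  have e1 : projX n m (mk3 (px2 Y) y (pz2 Y)) = px2 Y := rfl
  have e2 : projY n m (mk3 (px2 Y) y (pz2 Y)) = y := rfl
  have e3 : mk2 (px (mk3 (px2 Y) y (pz2 Y))) (pz (mk3 (px2 Y) y (pz2 Y))) = Y := mk2_px2_pz2 Y
  rw [e1, e2, e3]
  ring

/-- Use the hypothesis with `ξ = y.2` and `η = -z.2`: the frequency in `ω` becomes `l.2` plus
`kerFreq`, and moderateness of `ω` splits off the factor `v`. -/
theorem weight_le_of_amplitude {ω₁ ω₂ : Rn n × Rn n → ℝ} {v ω : Rnnm n m × Rnnm n m → ℝ}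
    (hω₁ : ∀ z, 0 < ω₁ z) (hω : ∀ z, 0 < ω z) (hv : ∀ z, 0 < v z)
    (hconst : ∀ X X' Ξ, v (X, Ξ) = v (X', Ξ)) {C C₀ : ℝ}
    (h : ∀ X Ξ Ξ', ω (X, Ξ + Ξ') ≤ C * ω (X, Ξ) * v (X, Ξ')) {φ : Rnnm n m → ℝ}
    (hφ : ∀ X ξ η, ω₂ (px X, ξ) / ω₁ (py X, -η) ≤
      C₀ * ω (X, mk3 (ξ - px (gradient φ X)) (η - py (gradient φ X)) (-pz (gradient φ X))))
    (z y : Rn n × Rn n) (l : Rnnm n m × Rnnm n m) (Z : Rnnm n m) :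
    ω₂ (px Z, y.2) ≤ |C₀| * |C| * ω₁ (py Z, z.2) * ω (Z, l.2) *
      v (0, kerFreq φ (projX n m) (projY n m) (ContinuousLinearMap.id ℝ _) z y l Z) := by
  have h1 := hφ Z y.2 (-z.2)
  rw [neg_neg, div_le_iff₀ (hω₁ _), ← add_kerFreq_id φ z y l Z] at h1
  set Θ := kerFreq φ (projX n m) (projY n m) (ContinuousLinearMap.id ℝ _) z y l Z
  have h2 := h Z l.2 Θ
  rw [hconst Z 0] at h2
  have p1 := (hω₁ (py Z, z.2)).le
  have p2 := (hω (Z, l.2)).le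
  have p3 := (hω (Z, l.2 + Θ)).le
  have p4 := (hv (0, Θ)).le
  calc _ ≤ C₀ * ω (Z, l.2 + Θ) * ω₁ (py Z, z.2) := h1
    _ ≤ |C₀| * (|C| * ω (Z, l.2) * v (0, Θ)) * ω₁ (py Z, z.2) := by
        gcongr
        · exact le_abs_self _
        · refine h2.trans ?_
          gcongr
          exact le_abs_self _
    _ = _ := by ring

/-- As the symbol has no `y`-frequency, the `y`-component of `kerFreq` is absorbed by `ω₁`, whose
argument `-φ'_y` equals `z.2` plus that component. The remaining components are absorbed by `ω`.
This explains the product form of `v`. -/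
theorem weight_le_of_symbol {ω₁ ω₂ : Rn n × Rn n → ℝ} {v : Rnnm n m × Rnnm n m → ℝ}
    {v₁ : Rn n → ℝ} {v₂ : Rnm n m → ℝ} {ω : Rnm n m × Rnm n m → ℝ}
    (hω₁ : ∀ z, 0 < ω₁ z) (hω : ∀ z, 0 < ω z) (hv₁ : ∀ z, 0 < v₁ z) (hv₂ : ∀ z, 0 < v₂ z)
    (hv : ∀ X Ξ, v (X, Ξ) = v₁ (py Ξ) * v₂ (mk2 (px Ξ) (pz Ξ))) {C C' C₀ : ℝ}
    (h₁ : ∀ y η η', ω₁ (y, η + η') ≤ C * ω₁ (y, η) * v₁ η')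
    (h₂ : ∀ Y Ξ Ξ', ω (Y, Ξ + Ξ') ≤ C' * ω (Y, Ξ) * v₂ Ξ') {φ : Rnnm n m → ℝ}
    (hφ : ∀ X ξ, ω₂ (px X, ξ) / ω₁ (py X, -py (gradient φ X)) ≤
      C₀ * ω (mk2 (px X) (pz X), mk2 (ξ - px (gradient φ X)) (-pz (gradient φ X))))
    (z y : Rn n × Rn n) (l : Rnm n m × Rnm n m) (Z : Rnnm n m) :
    ω₂ (px Z, y.2) ≤ |C₀| * |C| * |C'| * ω₁ (py Z, z.2) * ω (projXZ n m Z, l.2) *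
      v (0, kerFreq φ (projX n m) (projY n m) (projXZ n m) z y l Z) := by
  have h1 := hφ Z y.2
  rw [div_le_iff₀ (hω₁ _), ← add_kerFreq_projXZ φ z y l Z, ← add_py_kerFreq_projXZ φ z y l Z,
    ← projXZ_apply] at h1
  rw [hv]
  set Θ := kerFreq φ (projX n m) (projY n m) (projXZ n m) z y l Z
  have p1 := (hω₁ (py Z, z.2)).le
  have p2 := (hω (projXZ n m Z, l.2)).le
  have p3 := (hω (projXZ n m Z, l.2 + mk2 (px Θ) (pz Θ))).le
  have p4 := (hω₁ (py Z, z.2 + py Θ)).le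
  have p5 := (hv₁ (py Θ)).le
  have p6 := (hv₂ (mk2 (px Θ) (pz Θ))).le
  calc _ ≤ C₀ * ω (projXZ n m Z, l.2 + mk2 (px Θ) (pz Θ)) * ω₁ (py Z, z.2 + py Θ) := h1
    _ ≤ |C₀| * (|C'| * ω (projXZ n m Z, l.2) * v₂ (mk2 (px Θ) (pz Θ))) *
        (|C| * ω₁ (py Z, z.2) * v₁ (py Θ)) := by
        gcongr
        · exact le_abs_self _
        · refine (h₂ _ _ _).trans ?_
          gcongr
          exact le_abs_self _
        · refine (h₁ _ _ _).trans ?_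
          gcongr
          exact le_abs_self _
    _ = _ := by ring

end Parts

end FourierOp

end

/-- Both parts are instances of `exists_bounded_operator_of_isPhase`: for symbols `R` is the
projection to `(x, ζ)`, for amplitudes the identity. -/
theorem mainTheorem6 (n m : ℕ) (p : ℝ≥0∞) (hp1 : 1 < p) (hp2 : p < ∞)
    (ω₁ ω₂ : FourierOp.Rn n × FourierOp.Rn n → ℝ)
    (hω₁ : FourierOp.IsPolyModerate ω₁) (hω₂ : FourierOp.IsPolyModerate ω₂)
    (v : FourierOp.Rnnm n m × FourierOp.Rnnm n m → ℝ) (hv : FourierOp.IsPolyModerate v)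
    (hv_sub : FourierOp.IsSubmultiplicative v)
    (hv_const : ∀ X X' Ξ, v (X, Ξ) = v (X', Ξ))
    (hv_dil : ∃ C : ℝ, ∀ t ∈ Set.Icc (0 : ℝ) 1, ∀ X Ξ, v (X, t • Ξ) ≤ C * v (X, Ξ))
    (χ : 𝓢(FourierOp.Rn n, ℂ)) (hχ : χ ≠ 0)
    (χ₂ : 𝓢(FourierOp.Rnm n m, ℂ)) (hχ₂ : χ₂ ≠ 0)
    (χ₃ : 𝓢(FourierOp.Rnnm n m, ℂ)) (hχ₃ : χ₃ ≠ 0)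
    (κ₂ : 𝓢(FourierOp.Rnm n m, ℂ)) (hκ₂ : ∫ Y, κ₂ Y ^ 2 = 1)
    (κ₃ : 𝓢(FourierOp.Rnnm n m, ℂ)) (hκ₃ : ∫ X, κ₃ X ^ 2 = 1)
    (C₀ : ℝ) :
    -- symbols `a (x, ζ)`
    (∀ (v₁ : FourierOp.Rn n → ℝ) (v₂ : FourierOp.Rnm n m → ℝ) (ω : FourierOp.Rnm n m × FourierOp.Rnm n m → ℝ),
      FourierOp.IsPolyModerate v₁ → FourierOp.IsPolyModerate v₂ → FourierOp.IsPolyModerate ω →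
      (∀ X Ξ, v (X, Ξ) = v₁ (FourierOp.py Ξ) * v₂ (FourierOp.mk2 (FourierOp.px Ξ) (FourierOp.pz Ξ))) →
      (∃ C : ℝ, ∀ y η η', ω₁ (y, η + η') ≤ C * ω₁ (y, η) * v₁ η') →
      (∃ C : ℝ, ∀ Y Ξ Ξ', ω (Y, Ξ + Ξ') ≤ C * ω (Y, Ξ) * v₂ Ξ') →
      ∃ C : ℝ, 0 < C ∧ ∀ d : ℝ, 0 < d → ∀ φ Φ, FourierOp.IsPhase v χ₃ d φ Φ →
        (∀ X ξ, ω₂ (FourierOp.px X, ξ) / ω₁ (FourierOp.py X, -FourierOp.py (gradient φ X)) ≤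
          C₀ * ω (FourierOp.mk2 (FourierOp.px X) (FourierOp.pz X),
            FourierOp.mk2 (ξ - FourierOp.px (gradient φ X)) (-FourierOp.pz (gradient φ X)))) →
        ∀ a : 𝓢'(FourierOp.Rnm n m, ℂ), FourierOp.modNorm ω ∞ 1 χ₂ a < ∞ →
          ∃ T : 𝓢'(FourierOp.Rn n, ℂ) → 𝓢'(FourierOp.Rn n, ℂ),
            FourierOp.ExtendsOpZero κ₂ φ a T ∧
            FourierOp.IsBoundedLinear (FourierOp.modNorm ω₁ p p χ) (FourierOp.modNorm ω₂ p p χ)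
              (C * d⁻¹ * (FourierOp.modNorm ω ∞ 1 χ₂ a).toReal *
                Real.exp (C * (FourierOp.hessNorm v χ₃ Φ).toReal)) T) ∧
    -- amplitudes `a (x, y, ζ)`
    (∀ ω : FourierOp.Rnnm n m × FourierOp.Rnnm n m → ℝ, FourierOp.IsPolyModerate ω →
      (∃ C : ℝ, ∀ X Ξ Ξ', ω (X, Ξ + Ξ') ≤ C * ω (X, Ξ) * v (X, Ξ')) →
      ∃ C : ℝ, 0 < C ∧ ∀ d : ℝ, 0 < d → ∀ φ Φ, FourierOp.IsPhase v χ₃ d φ Φ →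
        (∀ X ξ η, ω₂ (FourierOp.px X, ξ) / ω₁ (FourierOp.py X, -η) ≤
          C₀ * ω (X, FourierOp.mk3 (ξ - FourierOp.px (gradient φ X)) (η - FourierOp.py (gradient φ X))
            (-FourierOp.pz (gradient φ X)))) →
        ∀ a : 𝓢'(FourierOp.Rnnm n m, ℂ), FourierOp.modNorm ω ∞ 1 χ₃ a < ∞ →
          ∃ T : 𝓢'(FourierOp.Rn n, ℂ) → 𝓢'(FourierOp.Rn n, ℂ),
            FourierOp.ExtendsOp κ₃ φ a T ∧
            FourierOp.IsBoundedLinear (FourierOp.modNorm ω₁ p p χ) (FourierOp.modNorm ω₂ p p χ)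
              (C * d⁻¹ * (FourierOp.modNorm ω ∞ 1 χ₃ a).toReal *
                Real.exp (C * (FourierOp.hessNorm v χ₃ Φ).toReal)) T) := by
  refine ⟨fun v₁ v₂ ω hv₁ hv₂ hω hvv h₁ h₂ => ?_, fun ω hω h => ?_⟩
  · obtain ⟨C₁, h₁⟩ := h₁
    obtain ⟨C₂, h₂⟩ := h₂
    obtain ⟨C, hC, hop⟩ := FourierOp.exists_bounded_operator_of_isPhase
      (FourierOp.projXZ n m)
      (FourierOp.norm_le_norm_pull_add_norm_pull (FourierOp.swapEquiv n m)) hp1 hp2.ne hω₁ hω₂ hω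
      hv hv_sub hv_const hv_dil (c := |C₀| * |C₁| * |C₂|) (by positivity) χ hχ χ₃ hχ₃ χ₂ hχ₂ κ₂
      -- The normalization of the short-time Fourier transform of the kernel function.
      (FourierOp.fourierConst (Fin n ⊕ Fin m))
    refine ⟨C, hC, fun d hd φ Φ hΦ hφ a ha => ?_⟩
    obtain ⟨T, hT, hb⟩ := hop d hd φ Φ hΦ (FourierOp.weight_le_of_symbol hω₁.1 hω.1 hv₁.1 hv₂.1 hvv
      h₁ h₂ hφ) a ha
    have e : ∀ f g, FourierOp.pairingIntegrand κ₂ a (FourierOp.opZeroKernelFun φ f g) = fun l =>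
        FourierOp.fourierConst (Fin n ⊕ Fin m) * FourierOp.stft κ₂ a l.1 l.2 *
          FourierOp.kerInt φ (FourierOp.projX n m) (FourierOp.projY n m) (FourierOp.projXZ n m)
            f g κ₂ l := fun f g => by
      funext l
      rw [FourierOp.pairingIntegrand,
        FourierOp.stftFun_opZeroKernelFun hΦ.contDiff.continuous f g κ₂ l]
      ring
    refine ⟨T, fun f g => ?_, hb⟩
    rw [FourierOp.stftPairing, e]
    exact hT f g
  · obtain ⟨C₁, h⟩ := h
    obtain ⟨C, hC, hop⟩ := FourierOp.exists_bounded_operator_of_isPhase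
      (ContinuousLinearMap.id ℝ (FourierOp.Rnnm n m))
      (fun Y => le_add_of_nonneg_left (norm_nonneg _)) hp1 hp2.ne hω₁ hω₂ hω
      hv hv_sub hv_const hv_dil (c := |C₀| * |C₁|) (by positivity) χ hχ χ₃ hχ₃ χ₃ hχ₃ κ₃
      -- For amplitudes the normalization also contains the factor `(2π) ^ (-n)` from the definition
      -- of `Op_φ`.
      (FourierOp.fourierConst (Fin n ⊕ (Fin n ⊕ Fin m)) * (((2 * π) ^ n)⁻¹ : ℝ))
    refine ⟨C, hC, fun d hd φ Φ hΦ hφ a ha => ?_⟩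
    obtain ⟨T, hT, hb⟩ := hop d hd φ Φ hΦ (FourierOp.weight_le_of_amplitude hω₁.1 hω.1 hv.1 hv_const
      h hφ) a ha
    have e : ∀ f g, FourierOp.pairingIntegrand κ₃ a (FourierOp.opKernelFun φ f g) = fun l =>
        FourierOp.fourierConst (Fin n ⊕ (Fin n ⊕ Fin m)) * (((2 * π) ^ n)⁻¹ : ℝ) *
          FourierOp.stft κ₃ a l.1 l.2 * FourierOp.kerInt φ (FourierOp.projX n m)
            (FourierOp.projY n m) (ContinuousLinearMap.id ℝ _) f g κ₃ l := fun f g => by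
      funext l
      rw [FourierOp.pairingIntegrand, FourierOp.stftFun_opKernelFun φ f g κ₃ l]
      ring
    refine ⟨T, fun f g => ?_, hb⟩
    rw [FourierOp.stftPairing, e]
    exact hT f g
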